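/- Let $(M,g)$ be a smooth Lorentzian manifold (signature $(-,+,\dots,+)$) and let $h$ be an auxiliary smooth Riemannian metric on $M$, with norm $\|\cdot\|$ on tangent vectors. For $p\in M$ let $R(p)$ be the injectivity radius of $h$ at $p$ (the supremum of the $r>0$ such that the exponential map $\exp_p$ of $h$ is defined on the ball of radius $r$ in $(T_pM,h_p)$ and maps it diffeomorphically onto an open set), and let $G(p)$ be the supremum, over the normal coordinate patch of $h$ around $p$ of radius $R(p)$, of the operator norm with respect to $h$ of the Christoffel symbols $\Gamma^\alpha_{\beta\gamma}$ of the Levi-Civita connection of $g$ in these coordinates. A smooth map $y$ from a subset of the Minkowski plane $\mathbb R^{1,1}$, with coordinates $(t,x)$, to $M$ is a wave map if $\nabla_t\partial_t y-\nabla_x\partial_x y=0$, i.e. in local coordinates $$\partial_t^2y^\alpha-\partial_x^2y^\alpha+\Gamma^\alpha_{\beta\gamma}(y)\,(\partial_ty^\beta\partial_ty^\gamma-\partial_xy^\beta\partial_xy^\gamma)=0 .$$ Let $k=(k_0,k_1):\mathbb R\to TM$ be a smooth curve such that $\partial_xk_0$ and $k_1$ are bounded together with all their covariant derivatives along $k_0$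 (with respect to $h$), and such that $g(\partial_xk_0,\partial_xk_0)\ge 0\ge g(k_1,k_1)$ everywhere. Let $\delta>0$ and $0\le G(\delta)<\infty$ be such that $G(p)\le G(\delta)$ for all $p$ in the $\delta$-neighbourhood, with respect to the distance of $h$, of the image of $k_0$. Put $u=k_1+\partial_xk_0$, $v=k_1-\partial_xk_0$, let $\underline u$, $\underline v$ be their $C^1$ norms (the larger of the suprema over $x\in\mathbb R$ of the $h$-norm of the field and of the $h$-norm of its $h$-covariant derivative along $k_0$), and $$R_k=\inf_{p\in \mathrm{im}(k_0)}R(p),\qquad L_k=\min\Big\{\frac{R_k}{5},\frac1{11\,G(\delta)},\frac{\delta}{5}\Big\},\qquad l=\frac{L_k}{\underline u+\underline v}$$ (with $1/0=\infty$, and $0/0=0$). Then: 1. (Existence) There are an open neighbourhood $U$ of the $x$-axis in $\mathbb R^{1,1}$ that contains the strip $\{(t,x):0\le t\le l/\sqrt2\}$, and a smooth wave map $y:U\to M$ with $y(0,x)=k_0(x)$ and $\partial_ty(0,x)=k_1(x)$ for all $x\in\mathbb R$. Moreover $U$ can be chosen to contain, with each point $(t,x)$, the closed characteristic triangle $\{(s,x'):\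 s \text{ between } 0 \text{ and } t,\ |x'-x|\le|t|-|s|\}$. 2. (Uniqueness) If $D\subseteq\mathbb R^{1,1}$ contains, with each of its points, its closed characteristic triangle (for example the set $U$, the strip, or a characteristic triangle with base on the $x$-axis), then any two maps $D\to M$ that are smooth on $D$, are wave maps in the interior of $D$, and satisfy the above initial conditions at the points of $D$ on the $x$-axis, are equal on $D$. 3. If $k$ is a closed curve in $TM$ (i.e. periodic), then $l>0$. -/

import Mathlib

open Set Manifold
open scoped Manifold ContDiff ENNReal NNReal

noncomputable section

namespace WaveMap

variable {E : Type*} [NormedAddCommGroup E] [NormedSpace ℝ E]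
  {M : Type*} [TopologicalSpace M] [ChartedSpace E M] [IsManifold 𝓘(ℝ, E) ∞ M]

/-! ### Metrics -/

variable (E M) in
/-- A field of bilinear forms on the tangent spaces of `M`. -/
abbrev FormField : Type _ :=
  ∀ p : M, TangentSpace 𝓘(ℝ, E) p →L[ℝ] TangentSpace 𝓘(ℝ, E) p →L[ℝ] ℝ

variable (E M) in
/-- A smooth Lorentzian metric on `M`, of signature `(-, +, …, +)`: at each point there is a
timelike vector on whose orthogonal complement the form is positive definite. -/
structure LorentzMetric where
  /-- The bilinear form on each tangent space. -/
  inner : FormField E M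
  symm : ∀ (p : M) (v w : TangentSpace 𝓘(ℝ, E) p), inner p v w = inner p w v
  signature : ∀ p : M, ∃ τ : TangentSpace 𝓘(ℝ, E) p, inner p τ τ < 0 ∧
    ∀ w : TangentSpace 𝓘(ℝ, E) p, inner p τ w = 0 → w ≠ 0 → 0 < inner p w w
  contMDiff : ContMDiff 𝓘(ℝ, E) (𝓘(ℝ, E).prod 𝓘(ℝ, E →L[ℝ] E →L[ℝ] ℝ)) ∞
    (fun p ↦ Bundle.TotalSpace.mk' (E →L[ℝ] E →L[ℝ] ℝ) p (inner p))

variable (E M) in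
/-- A smooth Riemannian metric on `M`. -/
abbrev RiemMetric : Type _ :=
  Bundle.ContMDiffRiemannianMetric 𝓘(ℝ, E) ∞ E (fun p : M ↦ TangentSpace 𝓘(ℝ, E) p)

/-- The length `√(h(v, v))` of a tangent vector. -/
def vnorm (h : RiemMetric E M) {p : M} (v : TangentSpace 𝓘(ℝ, E) p) : ℝ :=
  √(h.inner p v v)

open scoped Bundle in
/-- The Riemannian distance of `h` (infimum of the `h`-lengths of `C^1` paths). -/
def hdist (h : RiemMetric E M) (p q : M) : ℝ≥0∞ :=
  letI : Bundle.RiemannianBundle (fun p : M ↦ TangentSpace 𝓘(ℝ, E) p) := ⟨h.toRiemannianMetric⟩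
  riemannianEDist 𝓘(ℝ, E) p q

/-! ### Christoffel symbols, covariant derivative along curves -/

/-- The coordinates `E` of tangent vectors at `p` given by the differential of `e`. -/
def toCoord (e : OpenPartialHomeomorph M E) (p : M) : TangentSpace 𝓘(ℝ, E) p →L[ℝ] E :=
  mfderiv 𝓘(ℝ, E) 𝓘(ℝ, E) e p

/-- The tangent vectors at `e⁻¹(z)` with given coordinates: the differential of `e⁻¹`. -/
def fromCoord (e : OpenPartialHomeomorph M E) (z : E) :
    E →L[ℝ] TangentSpace 𝓘(ℝ, E) (e.symm z) :=
  mfderiv 𝓘(ℝ, E) 𝓘(ℝ, E) e.symm z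

/-- The metric `B` in the coordinates `e`: a function of the coordinate `z`, with values in the
bilinear forms on the coordinate space. -/
def coordForm (B : FormField E M) (e : OpenPartialHomeomorph M E) (z : E) : E →L[ℝ] E →L[ℝ] ℝ :=
  (ContinuousLinearMap.precomp ℝ (fromCoord e z)).comp ((B (e.symm z)).comp (fromCoord e z))

/-- The covector `c ↦ ½ (∂_a B(b, c) + ∂_b B(a, c) - ∂_c B(a, b))` at the coordinate `z`
(Christoffel symbols of the first kind). -/
def christoffelLower (B : FormField E M) (e : OpenPartialHomeomorph M E) (z a b : E) :
    E →L[ℝ] ℝ :=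
  letI F : E →L[ℝ] E →L[ℝ] E →L[ℝ] ℝ := fderiv ℝ (coordForm B e) z
  (1 / 2 : ℝ) • (F a b + F b a - (F.flip a).flip b)

/-- The Christoffel symbols `Γ(z)(a, b) = (Γ^α_{βγ}(z) a^β b^γ)_α` of the Levi-Civita connection
of `B` in the coordinates `e`. -/
def christoffel (B : FormField E M) (e : OpenPartialHomeomorph M E) (z a b : E) : E :=
  (coordForm B e z).inverse (christoffelLower B e z a b)

variable (E) in
/-- The velocity of a curve. -/
def velocity (c : ℝ → M) (s : ℝ) : TangentSpace 𝓘(ℝ, E) (c s) :=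
  mfderiv 𝓘(ℝ, ℝ) 𝓘(ℝ, E) c s (1 : ℝ)

/-- The covariant derivative `∇_s V` of a vector field `V` along a curve `c`, for the Levi-Civita
connection of `B`: in a chart it is `dV^α/ds + Γ^α_{βγ}(c) (dc^β/ds) V^γ`. -/
def covDeriv (B : FormField E M) (c : ℝ → M) (V : ∀ s, TangentSpace 𝓘(ℝ, E) (c s)) (s : ℝ) :
    TangentSpace 𝓘(ℝ, E) (c s) :=
  letI e : OpenPartialHomeomorph M E := chartAt E (c s)
  letI Ve : ℝ → E := fun r ↦ toCoord e (c r) (V r)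
  (toCoord e (c s)).inverse
    (deriv Ve s + christoffel B e (e (c s)) (deriv (fun r ↦ e (c r)) s) (Ve s))

/-! ### Exponential map, normal coordinates, injectivity radius -/

/-- `exp_p(v)` is defined and equal to `q`: there is an `h`-geodesic on `[0, 1]` (on a
neighbourhood of it) starting at `p` with velocity `v` and reaching `q` at time `1`. -/
def IsExp (h : RiemMetric E M) (p : M) (v : TangentSpace 𝓘(ℝ, E) p) (q : M) : Prop :=
  ∃ (γ : ℝ → M) (J : Set ℝ), IsOpen J ∧ Icc 0 1 ⊆ J ∧
    ContMDiffOn 𝓘(ℝ, ℝ) 𝓘(ℝ, E) ∞ γ J ∧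
    (∀ s ∈ J, covDeriv h.inner γ (velocity E γ) s = 0) ∧
    (⟨γ 0, velocity E γ 0⟩ : TangentBundle 𝓘(ℝ, E) M) = ⟨p, v⟩ ∧ γ 1 = q

/-- The tangent space at `p` is the model space `E` (a tangent vector is identified with its
coordinates in the preferred chart at `p`). -/
def ofModel (p : M) : E →L[ℝ] TangentSpace 𝓘(ℝ, E) p := ContinuousLinearMap.id ℝ E

/-- `e` is the normal coordinate chart of radius `r` at `p`: `exp_p` is defined on the ball of
radius `r` in `(T_p M, h_p)`, it is a diffeomorphism of that ball onto an open subset of `M`, and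
`e` is its inverse. -/
def IsNormalChart (h : RiemMetric E M) (p : M) (r : ℝ) (e : OpenPartialHomeomorph M E) : Prop :=
  0 < r ∧ e ∈ IsManifold.maximalAtlas 𝓘(ℝ, E) ∞ M ∧
    e.target = {v : E | vnorm h (ofModel p v) < r} ∧
    ∀ v ∈ e.target, IsExp h p (ofModel p v) (e.symm v)

/-- The injectivity radius of `h` at `p`. -/
def injRadius (h : RiemMetric E M) (p : M) : ℝ≥0∞ :=
  ⨆ (r : ℝ) (e : OpenPartialHomeomorph M E) (_ : IsNormalChart h p r e), ENNReal.ofReal r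

/-- The operator norm, with respect to `h`, of the Christoffel symbols of `B` in the coordinates
`e` at the coordinate `z`. -/
def christoffelNorm (h : RiemMetric E M) (B : FormField E M) (e : OpenPartialHomeomorph M E)
    (z : E) : ℝ≥0∞ :=
  letI N : E → ℝ := fun a ↦ √(coordForm h.inner e z a a)
  ⨆ (a : E) (b : E) (_ : N a ≤ 1) (_ : N b ≤ 1), ENNReal.ofReal (N (christoffel B e z a b))

/-- The function `G`: the supremum, over the normal coordinate patch of `h` around `p`, of the
operator norm (with respect to `h`) of the Christoffel symbols of `B` in normal coordinates
at `p`. -/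
def christoffelBound (h : RiemMetric E M) (B : FormField E M) (p : M) : ℝ≥0∞ :=
  ⨆ (r : ℝ) (e : OpenPartialHomeomorph M E) (_ : IsNormalChart h p r e) (z ∈ e.target),
    christoffelNorm h B e z

/-! ### Initial data -/

/-- The base curve `k₀` of a curve `k = (k₀, k₁)` in `TM`. -/
def k₀ (k : ℝ → TangentBundle 𝓘(ℝ, E) M) (x : ℝ) : M := (k x).proj

/-- The vector field `k₁` along `k₀` of a curve `k = (k₀, k₁)` in `TM`. -/
def k₁ (k : ℝ → TangentBundle 𝓘(ℝ, E) M) (x : ℝ) : TangentSpace 𝓘(ℝ, E) (k₀ k x) := (k x).snd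

/-- The initial value `u = k₁ + ∂ₓ k₀` of `∂_ξ y = ∂_t y + ∂ₓ y`. -/
def dataU (k : ℝ → TangentBundle 𝓘(ℝ, E) M) (x : ℝ) : TangentSpace 𝓘(ℝ, E) (k₀ k x) :=
  k₁ k x + velocity E (k₀ k) x

/-- The initial value `v = k₁ - ∂ₓ k₀` of `∂_η y = ∂_t y - ∂ₓ y`. -/
def dataV (k : ℝ → TangentBundle 𝓘(ℝ, E) M) (x : ℝ) : TangentSpace 𝓘(ℝ, E) (k₀ k x) :=
  k₁ k x - velocity E (k₀ k) x

/-- The `C^1` norm (for `h`) of a vector field along a curve: the larger of the supremum norms of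
the field and of its covariant derivative. -/
def c1Norm (h : RiemMetric E M) (c : ℝ → M) (V : ∀ s, TangentSpace 𝓘(ℝ, E) (c s)) : ℝ≥0∞ :=
  max (⨆ x, ENNReal.ofReal (vnorm h (V x))) (⨆ x, ENNReal.ofReal (vnorm h (covDeriv h.inner c V x)))

/-- A vector field along a curve all of whose covariant derivatives (for `h`), including the
zeroth, are bounded. -/
def BoundedDerivs (h : RiemMetric E M) (c : ℝ → M) (V : ∀ s, TangentSpace 𝓘(ℝ, E) (c s)) : Prop :=
  ∀ j : ℕ, ∃ C : ℝ, ∀ x : ℝ, vnorm h ((covDeriv h.inner c)^[j] V x) ≤ C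

/-- `L_k = min {R_k / 5, 1 / (11 G), δ / 5}`, with `R_k` the infimum of the injectivity radius
of `h` along `k₀`. -/
def Lk (h : RiemMetric E M) (k : ℝ → TangentBundle 𝓘(ℝ, E) M) (δ : ℝ) (G : ℝ≥0) : ℝ≥0∞ :=
  min ((⨅ x, injRadius h (k₀ k x)) / 5) (min (1 / (11 * (G : ℝ≥0∞))) (ENNReal.ofReal δ / 5))

/-- `l = L_k / (‖u‖_{C^1} + ‖v‖_{C^1})`. -/
def stripLength (h : RiemMetric E M) (k : ℝ → TangentBundle 𝓘(ℝ, E) M) (δ : ℝ) (G : ℝ≥0) :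
    ℝ≥0∞ :=
  Lk h k δ G / (c1Norm h (k₀ k) (dataU k) + c1Norm h (k₀ k) (dataV k))

/-- The strip of all `(t, x)` with `0 ≤ t ≤ l / √2`. -/
def strip (l : ℝ≥0∞) : Set (ℝ × ℝ) := {p | 0 ≤ p.1 ∧ ENNReal.ofReal (√2 * p.1) ≤ l}

/-! ### Wave maps on subsets of the Minkowski plane, with coordinates `(t, x)` -/

/-- The closed characteristic triangle with vertex `p = (t, x)` and base on the `x`-axis. -/
def charTriangle (p : ℝ × ℝ) : Set (ℝ × ℝ) :=
  {q | q.1 ∈ uIcc 0 p.1 ∧ |q.2 - p.2| ≤ |p.1| - |q.1|}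

/-- A set that contains, with each point, the characteristic triangle below (or above) it. -/
def IsCharClosed (D : Set (ℝ × ℝ)) : Prop := ∀ p ∈ D, charTriangle p ⊆ D

/-- `y` is a smooth wave map on `D`: it is smooth on `D` (up to the points of `D` on the boundary),
and `∇_t ∂_t y - ∇_x ∂_x y = 0` in the interior. -/
def IsWaveMapOn (g : LorentzMetric E M) (D : Set (ℝ × ℝ)) (y : ℝ × ℝ → M) : Prop :=
  ContMDiffOn 𝓘(ℝ, ℝ × ℝ) 𝓘(ℝ, E) ∞ y D ∧
    ∀ t x : ℝ, (t, x) ∈ interior D →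
      covDeriv g.inner (fun s ↦ y (s, x)) (velocity E fun s ↦ y (s, x)) t
        - covDeriv g.inner (fun s ↦ y (t, s)) (velocity E fun s ↦ y (t, s)) x = 0

/-- `y(0, x) = k₀(x)` and `∂_t y(0, x) = k₁(x)` for all points `(0, x)` of `D`. -/
def HasData (k : ℝ → TangentBundle 𝓘(ℝ, E) M) (D : Set (ℝ × ℝ)) (y : ℝ × ℝ → M) : Prop :=
  ∀ x : ℝ, ((0 : ℝ), x) ∈ D →
    (⟨y (0, x), mfderivWithin 𝓘(ℝ, ℝ × ℝ) 𝓘(ℝ, E) y D (0, x) ((1, 0) : ℝ × ℝ)⟩ :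
      TangentBundle 𝓘(ℝ, E) M) = k x

end WaveMap

end

/-! In the characteristic directions `(1, 1)` and `(1, -1)` the wave map equation says that the
mixed covariant Hessian of `y` vanishes. In a chart this is a semilinear transport system for `(y,
∂_ξ y, ∂_η y)` with speeds of modulus at most one, so everything propagates inside characteristic
triangles. The covariant Hessian is a tensor (`coordHess_chart_comp`), so results in charts patch to
results on `M`.

Uniqueness: on a small triangle in one chart it follows from a weighted maximum estimate along
characteristics (`coordinate_wave_unique`). A continuity argument in the height covers a whole
triangle (`wave_unique_fwdTriangle`), hence every characteristically closed set (`wave_unique`).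

Local existence: the system on the cone below a point is rescaled to a fixed cone and solved by
contraction among continuous functions. The implicit function theorem in that Banach space makes the
solution depend smoothly on the apex, which is its smoothness as a function
(`exists_transport_solution`). The size of the domain depends only on a bound for the data and is
locally uniform in the initial point (`exists_local_wave`). By uniqueness all solutions glue to a
maximal one (`exists_maximal_solution`).

The strip is reached by an a priori bound. In normal coordinates of `h` at `y(q)` the metric `h` is
constant to first order, so the derivative of `|∂_ξ y|²` along `η` is at most `2 G |∂_ξ y|² |∂_η y|`
(`exists_hasFDerivAt_energy`). If the data are bounded by `C`, a bootstrap bounds both derivatives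
by `2C` up to a height `T` with `8CTG ≤ 1` and `2CT < δ` (`energy_le_of_wave`). The curves `t ↦ y(t,
x)` then have length at most `2CT`. By the Gauss lemma they stay in a compact ball of a normal chart
at `k₀(x)` of radius larger than `2CT` (`IsNormalChart.mem_ball_of_vnorm_le`). So at a lowest point
missing from the maximal domain `y` has a cluster value, and local existence of uniform size near
that value continues the solution past the point (`IsSolution.fwdTriangle_subset`). The definition
of `l` yields the inequalities on `T` with room to spare (`bounds_of_le_Lk`).

For periodic data the injectivity radius is bounded below on the compact image of `k₀` and the `C^1`
norms are finite, so `l > 0`. -/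

open Filter
open scoped Topology

noncomputable section

namespace WaveMap

set_option linter.unusedSectionVars false
set_option maxSynthPendingDepth 3

/-! ### Metrics in the coordinates of a chart. -/

section CoordinateGeometry

variable {E : Type*} [NormedAddCommGroup E] [NormedSpace ℝ E]
  {M : Type*} [TopologicalSpace M] [ChartedSpace E M] [IsManifold 𝓘(ℝ, E) ∞ M]

/-- A smooth field of nondegenerate symmetric bilinear forms. -/
structure IsPseudoMetric (B : FormField E M) : Prop where
  symm : ∀ (p : M) (v w : TangentSpace 𝓘(ℝ, E) p), B p v w = B p w v
  nondeg : ∀ (p : M) (v : TangentSpace 𝓘(ℝ, E) p),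
    (∀ w : TangentSpace 𝓘(ℝ, E) p, B p v w = 0) → v = 0
  contMDiff : ContMDiff 𝓘(ℝ, E) (𝓘(ℝ, E).prod 𝓘(ℝ, E →L[ℝ] E →L[ℝ] ℝ)) ∞
    (fun p ↦ Bundle.TotalSpace.mk' (E →L[ℝ] E →L[ℝ] ℝ) p (B p))

theorem LorentzMetric.isPseudoMetric (g : LorentzMetric E M) : IsPseudoMetric g.inner where
  symm := g.symm
  nondeg p v hv := by
    obtain ⟨τ, -, h⟩ := g.signature p
    by_contra hne
    have h1 : g.inner p τ v = 0 := by rw [g.symm]; exact hv τ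
    have h2 := h v h1 hne
    rw [hv v] at h2
    exact lt_irrefl _ h2
  contMDiff := g.contMDiff

theorem RiemMetric.isPseudoMetric (h : RiemMetric E M) : IsPseudoMetric (E := E) (M := M) h.inner where
  symm := h.symm
  nondeg p v hv := by
    by_contra hne
    have h2 := h.pos p v hne
    rw [hv v] at h2
    exact lt_irrefl _ h2
  contMDiff := h.contMDiff

/-- Base points such as `e.symm (e p)` and `p` are equal but not definitionally so. Since every
tangent space is the model space, values of the form can still be compared on plain vectors of `E`.
-/
theorem formField_congr (B : FormField E M) {p q : M} (hpq : p = q) (a b : E) :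
    (B p : E →L[ℝ] E →L[ℝ] ℝ) a b = (B q : E →L[ℝ] E →L[ℝ] ℝ) a b := by
  subst hpq; rfl

variable {e e' : OpenPartialHomeomorph M E}

theorem contMDiffOn_chart (he : e ∈ IsManifold.maximalAtlas 𝓘(ℝ, E) ∞ M) :
    ContMDiffOn 𝓘(ℝ, E) 𝓘(ℝ, E) ∞ e e.source :=
  contMDiffOn_of_mem_maximalAtlas he

theorem contMDiffOn_chart_symm (he : e ∈ IsManifold.maximalAtlas 𝓘(ℝ, E) ∞ M) :
    ContMDiffOn 𝓘(ℝ, E) 𝓘(ℝ, E) ∞ e.symm e.target :=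
  contMDiffOn_symm_of_mem_maximalAtlas he

theorem contMDiffAt_chart_symm (he : e ∈ IsManifold.maximalAtlas 𝓘(ℝ, E) ∞ M) {z : E}
    (hz : z ∈ e.target) : ContMDiffAt 𝓘(ℝ, E) 𝓘(ℝ, E) ∞ e.symm z :=
  (contMDiffOn_chart_symm he).contMDiffAt (e.open_target.mem_nhds hz)

theorem contMDiffAt_chart (he : e ∈ IsManifold.maximalAtlas 𝓘(ℝ, E) ∞ M) {p : M}
    (hp : p ∈ e.source) : ContMDiffAt 𝓘(ℝ, E) 𝓘(ℝ, E) ∞ e p :=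
  (contMDiffOn_chart he).contMDiffAt (e.open_source.mem_nhds hp)

theorem coordForm_apply (B : FormField E M) (e : OpenPartialHomeomorph M E) (z a b : E) :
    coordForm B e z a b = B (e.symm z) (fromCoord e z a) (fromCoord e z b) := rfl

theorem toCoord_fromCoord (he : e ∈ IsManifold.maximalAtlas 𝓘(ℝ, E) ∞ M) {z : E}
    (hz : z ∈ e.target) (a : E) : toCoord e (e.symm z) (fromCoord e z a) = a := by
  have h1 := (contMDiffAt_chart_symm he hz).mdifferentiableAt (by simp)
  have h2 := (contMDiffAt_chart he (e.map_target hz)).mdifferentiableAt (by simp)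
  have h3 : (e ∘ e.symm) =ᶠ[𝓝 z] id := by
    filter_upwards [e.open_target.mem_nhds hz] with w hw using e.right_inv hw
  have h4 := mfderiv_comp z h2 h1
  rw [h3.mfderiv_eq, mfderiv_id] at h4
  exact (congrArg (fun L : E →L[ℝ] E => L a) h4).symm

theorem fromCoord_toCoord (he : e ∈ IsManifold.maximalAtlas 𝓘(ℝ, E) ∞ M) {p : M}
    (hp : p ∈ e.source) (v : E) : (fromCoord e (e p) (toCoord e p v) : E) = v := by
  have h1 := (contMDiffAt_chart_symm he (e.map_source hp)).mdifferentiableAt (by simp)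
  have h2 := (contMDiffAt_chart he hp).mdifferentiableAt (by simp)
  have h3 : (e.symm ∘ e) =ᶠ[𝓝 p] id := by
    filter_upwards [e.open_source.mem_nhds hp] with w hw using e.left_inv hw
  have h4 := mfderiv_comp p h1 h2
  rw [h3.mfderiv_eq, mfderiv_id] at h4
  exact (congrArg (fun L : E →L[ℝ] E => L v) h4).symm

/-- The change of coordinates from `e` to `e'`. -/
theorem contDiffAt_transition (he : e ∈ IsManifold.maximalAtlas 𝓘(ℝ, E) ∞ M)
    (he' : e' ∈ IsManifold.maximalAtlas 𝓘(ℝ, E) ∞ M) {z : E}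
    (hz : z ∈ e.target) (hz' : e.symm z ∈ e'.source) : ContDiffAt ℝ ∞ (e' ∘ e.symm) z := by
  rw [← contMDiffAt_iff_contDiffAt]
  exact (contMDiffAt_chart he' hz').comp z (contMDiffAt_chart_symm he hz)

theorem fromCoord_transition (he : e ∈ IsManifold.maximalAtlas 𝓘(ℝ, E) ∞ M)
    (he' : e' ∈ IsManifold.maximalAtlas 𝓘(ℝ, E) ∞ M) {z : E}
    (hz : z ∈ e.target) (hz' : e.symm z ∈ e'.source) (a : E) :
    (fromCoord e' (e' (e.symm z)) (fderiv ℝ (e' ∘ e.symm) z a) : E) = fromCoord e z a := by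
  have h0 := (contMDiffAt_iff_contDiffAt.2 (contDiffAt_transition he he' hz hz')).mdifferentiableAt
    (by simp)
  have h1 := (contMDiffAt_chart_symm he' (e'.map_source hz')).mdifferentiableAt (by simp)
  have h3 : (e'.symm ∘ (e' ∘ e.symm)) =ᶠ[𝓝 z] e.symm := by
    have : e.symm ⁻¹' e'.source ∈ 𝓝 z :=
      (e.continuousAt_symm hz).preimage_mem_nhds (e'.open_source.mem_nhds hz')
    filter_upwards [this] with w hw using e'.left_inv hw
  have h4 := mfderiv_comp z (I' := 𝓘(ℝ, E)) h1 h0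
  rw [h3.mfderiv_eq, mfderiv_eq_fderiv] at h4
  exact (congrArg (fun L : E →L[ℝ] E => L a) h4).symm

theorem coordForm_transition (B : FormField E M)
    (he : e ∈ IsManifold.maximalAtlas 𝓘(ℝ, E) ∞ M)
    (he' : e' ∈ IsManifold.maximalAtlas 𝓘(ℝ, E) ∞ M) {z : E}
    (hz : z ∈ e.target) (hz' : e.symm z ∈ e'.source) (a b : E) :
    coordForm B e z a b = coordForm B e' (e' (e.symm z)) (fderiv ℝ (e' ∘ e.symm) z a)
      (fderiv ℝ (e' ∘ e.symm) z b) := by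
  rw [coordForm_apply, coordForm_apply]
  have h1 := fromCoord_transition he he' hz hz' a
  have h2 := fromCoord_transition he he' hz hz' b
  refine (formField_congr B (e'.left_inv hz').symm (fromCoord e z a) (fromCoord e z b)).trans ?_
  exact (congrArg₂ (fun x y : E => (B (e'.symm (e' (e.symm z))) : E →L[ℝ] E →L[ℝ] ℝ) x y) h1 h2).symm

theorem coordForm_symm {B : FormField E M} (hB : IsPseudoMetric B) (z a b : E) :
    coordForm B e z a b = coordForm B e z b a := hB.symm _ _ _

/-- The constant vectors `a`, `b` of the coordinate space are pushed forward by `e.symm` to smooth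
sections, and pairing smooth sections with a smooth form field is smooth. -/
theorem contDiffOn_coordForm [FiniteDimensional ℝ E] {B : FormField E M} (hB : IsPseudoMetric B)
    (he : e ∈ IsManifold.maximalAtlas 𝓘(ℝ, E) ∞ M) :
    ContDiffOn ℝ ∞ (coordForm B e) e.target := by
  have key : ∀ a b : E, ContDiffOn ℝ ∞ (fun z => coordForm B e z a b) e.target := by
    intro a b
    have hsec : ∀ a : E, ContMDiffOn 𝓘(ℝ, E) 𝓘(ℝ, E).tangent ∞
        (fun z => (⟨e.symm z, fromCoord e z a⟩ : TangentBundle 𝓘(ℝ, E) M)) e.target := by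
      intro a
      have h1 := (contMDiffOn_chart_symm he).contMDiffOn_tangentMapWithin (m := ∞) (by simp)
        e.open_target.uniqueMDiffOn
      have h2 : ContMDiff 𝓘(ℝ, E) 𝓘(ℝ, E).tangent ∞
          (fun z : E => (⟨z, a⟩ : TangentBundle 𝓘(ℝ, E) E)) := by
        exact (contMDiff_vectorSpace_iff_contDiff
          (V := fun z : E => (a : TangentSpace 𝓘(ℝ, E) z))).2 contDiff_const
      refine (h1.comp h2.contMDiffOn (fun z hz => hz)).congr ?_
      intro z hz
      simp only [Function.comp, tangentMapWithin, fromCoord]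
      rw [mfderivWithin_of_isOpen e.open_target hz]
      rfl
    have := ContMDiffOn.clm_bundle_apply₂ (F₁ := E) (F₂ := E) (F₃ := ℝ) (E₃ := Bundle.Trivial M ℝ)
      (b := e.symm) (hB.contMDiff.comp_contMDiffOn (contMDiffOn_chart_symm he)) (hsec a) (hsec b)
    rw [← contMDiffOn_iff_contDiffOn]
    intro z hz
    have := this z hz
    rw [Bundle.contMDiffWithinAt_totalSpace] at this
    exact this.2
  -- In finite dimensions smoothness of an operator-valued map can be tested on fixed vectors.
  rw [contDiffOn_clm_apply]
  intro a
  rw [contDiffOn_clm_apply]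
  exact key a

theorem toCoord_injective (he : e ∈ IsManifold.maximalAtlas 𝓘(ℝ, E) ∞ M) {p : M}
    (hp : p ∈ e.source) {v w : E} (h : toCoord e p v = toCoord e p w) : v = w := by
  rw [← fromCoord_toCoord he hp v, ← fromCoord_toCoord he hp w, h]

theorem coordForm_nondeg {B : FormField E M} (hB : IsPseudoMetric B)
    (he : e ∈ IsManifold.maximalAtlas 𝓘(ℝ, E) ∞ M) {z : E} (hz : z ∈ e.target) {a : E}
    (h : ∀ b, coordForm B e z a b = 0) : a = 0 := by
  have h1 : fromCoord e z a = 0 := by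
    refine hB.nondeg _ _ fun w => ?_
    have h2 := h (toCoord e (e.symm z) w)
    rw [coordForm_apply] at h2
    have h3 := fromCoord_toCoord he (e.map_target hz) w
    rw [e.right_inv hz] at h3
    exact (congrArg (fun x : E => (B (e.symm z) : E →L[ℝ] E →L[ℝ] ℝ) (fromCoord e z a) x) h3).symm.trans h2
  have h4 := toCoord_fromCoord he hz a
  rw [h1, map_zero] at h4
  exact h4.symm

variable [FiniteDimensional ℝ E]

/-- A nondegenerate form is an injection of `E` into its dual, which has the same dimension. This
makes the `inverse` in the definition of `christoffel` a true inverse and not the default value `0`.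
-/
theorem coordForm_isInvertible {B : FormField E M} (hB : IsPseudoMetric B)
    (he : e ∈ IsManifold.maximalAtlas 𝓘(ℝ, E) ∞ M) {z : E} (hz : z ∈ e.target) :
    (coordForm B e z).IsInvertible := by
  have hinj : Function.Injective (coordForm B e z : E →ₗ[ℝ] (E →L[ℝ] ℝ)) := by
    rw [injective_iff_map_eq_zero]
    intro a ha
    refine coordForm_nondeg hB he hz fun b => ?_
    exact congrArg (fun L : E →L[ℝ] ℝ => L b) ha
  have hdim : Module.finrank ℝ E = Module.finrank ℝ (E →L[ℝ] ℝ) := by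
    rw [← (LinearMap.toContinuousLinearMap (𝕜 := ℝ) (E := E) (F' := ℝ)).finrank_eq]
    exact (Subspace.dual_finrank_eq).symm
  let L := LinearEquiv.ofInjectiveOfFinrankEq _ hinj hdim
  exact ⟨L.toContinuousLinearEquiv, by ext a b; rfl⟩

theorem coordForm_christoffel {B : FormField E M} (hB : IsPseudoMetric B)
    (he : e ∈ IsManifold.maximalAtlas 𝓘(ℝ, E) ∞ M) {z : E} (hz : z ∈ e.target) (a b : E) :
    coordForm B e z (christoffel B e z a b) = christoffelLower B e z a b :=
  (coordForm_isInvertible hB he hz).self_apply_inverse _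

theorem christoffelLower_apply (B : FormField E M) (e : OpenPartialHomeomorph M E)
    (z a b c : E) :
    christoffelLower B e z a b c = 1 / 2 * (fderiv ℝ (coordForm B e) z a b c +
      fderiv ℝ (coordForm B e) z b a c - fderiv ℝ (coordForm B e) z c a b) := rfl

theorem fderiv_coordForm_symm {B : FormField E M} (hB : IsPseudoMetric B)
    (he : e ∈ IsManifold.maximalAtlas 𝓘(ℝ, E) ∞ M) {z : E} (hz : z ∈ e.target) (a b c : E) :
    fderiv ℝ (coordForm B e) z a b c = fderiv ℝ (coordForm B e) z a c b := by
  have hd : DifferentiableAt ℝ (coordForm B e) z :=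
    ((contDiffOn_coordForm hB he).contDiffAt (e.open_target.mem_nhds hz)).differentiableAt (by simp)
  have h1 : ∀ b c, fderiv ℝ (coordForm B e) z a b c
      = fderiv ℝ (fun z => coordForm B e z b c) z a := by
    intro b c
    rw [fderiv_clm_apply (hd.clm_apply (differentiableAt_const b)) (differentiableAt_const c),
      fderiv_clm_apply hd (differentiableAt_const b)]
    simp
  rw [h1, h1]
  congr 2
  ext z
  exact coordForm_symm hB z b c

end CoordinateGeometry

/-! ### Christoffel symbols: smoothness, symmetry and change of chart. -/

section ChristoffelSymbols

variable {E : Type*} [NormedAddCommGroup E] [NormedSpace ℝ E] [FiniteDimensional ℝ E]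
  {M : Type*} [TopologicalSpace M] [ChartedSpace E M] [IsManifold 𝓘(ℝ, E) ∞ M]
  {e e' : OpenPartialHomeomorph M E} {B : FormField E M}

/-- The Christoffel symbols of the first kind as a bilinear map. -/
def christoffelLowerL (B : FormField E M) (e : OpenPartialHomeomorph M E) (z : E) :
    E →L[ℝ] E →L[ℝ] E →L[ℝ] ℝ :=
  letI F : E →L[ℝ] E →L[ℝ] E →L[ℝ] ℝ := fderiv ℝ (coordForm B e) z
  (1 / 2 : ℝ) • (F + ContinuousLinearMap.flipₗᵢ ℝ E E (E →L[ℝ] ℝ) F -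
    (ContinuousLinearMap.compL ℝ E (E →L[ℝ] E →L[ℝ] ℝ) (E →L[ℝ] E →L[ℝ] ℝ)
      ((ContinuousLinearMap.flipₗᵢ ℝ E E ℝ).toContinuousLinearEquiv :
        (E →L[ℝ] E →L[ℝ] ℝ) →L[ℝ] (E →L[ℝ] E →L[ℝ] ℝ)))
      (ContinuousLinearMap.flipₗᵢ ℝ E E (E →L[ℝ] ℝ) F))

/-- The Christoffel symbols as a bilinear map. -/
def christoffelL (B : FormField E M) (e : OpenPartialHomeomorph M E) (z : E) : E →L[ℝ] E →L[ℝ] E :=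
  ContinuousLinearMap.compL ℝ E (E →L[ℝ] E →L[ℝ] ℝ) (E →L[ℝ] E)
    (ContinuousLinearMap.compL ℝ E (E →L[ℝ] ℝ) E (coordForm B e z).inverse)
    (christoffelLowerL B e z)

/-- Gives access to linearity and to the calculus of continuous linear maps for `christoffel`. -/
theorem christoffelL_apply (z a b : E) : christoffelL B e z a b = christoffel B e z a b := rfl

theorem contDiffOn_christoffelL (hB : IsPseudoMetric B)
    (he : e ∈ IsManifold.maximalAtlas 𝓘(ℝ, E) ∞ M) :
    ContDiffOn ℝ ∞ (christoffelL B e) e.target := by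
  have : CompleteSpace E := FiniteDimensional.complete ℝ E
  have h0 := contDiffOn_coordForm hB he
  have h1 : ContDiffOn ℝ ∞ (fderiv ℝ (coordForm B e)) e.target :=
    h0.fderiv_of_isOpen e.open_target (by simp)
  have h2 : ContDiffOn ℝ ∞ (fun z => (coordForm B e z).inverse) e.target := by
    intro z hz
    obtain ⟨L, hL⟩ := coordForm_isInvertible hB he hz
    have h3 : ContDiffAt ℝ ∞ ContinuousLinearMap.inverse (coordForm B e z) := by
      rw [← hL]; exact contDiffAt_map_inverse L
    exact h3.comp_contDiffWithinAt z (h0 z hz)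
  have h3 : ContDiffOn ℝ ∞ (christoffelLowerL B e) e.target := by
    have h4 : ContDiffOn ℝ ∞
        (fun z => ContinuousLinearMap.flipₗᵢ ℝ E E (E →L[ℝ] ℝ) (fderiv ℝ (coordForm B e) z))
        e.target := (ContinuousLinearMap.flipₗᵢ ℝ E E (E →L[ℝ] ℝ)).contDiff.comp_contDiffOn h1
    refine ContDiffOn.const_smul _ ((h1.add h4).sub ?_)
    exact (ContinuousLinearMap.contDiff _).comp_contDiffOn h4
  refine ContDiffOn.clm_apply ?_ h3
  refine (ContinuousLinearMap.contDiff _).comp_contDiffOn ?_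
  exact (ContinuousLinearMap.contDiff _).comp_contDiffOn h2

theorem christoffel_symm (hB : IsPseudoMetric B)
    (he : e ∈ IsManifold.maximalAtlas 𝓘(ℝ, E) ∞ M) {z : E} (hz : z ∈ e.target) (a b : E) :
    christoffel B e z a b = christoffel B e z b a := by
  unfold christoffel
  congr 1
  ext c
  rw [christoffelLower_apply, christoffelLower_apply, fderiv_coordForm_symm hB he hz c a b]
  ring

/-- Product rule applied to `coordForm_transition`. The two terms with the second derivative of the
coordinate change are the source of the inhomogeneous term in `christoffel_transition`. -/
theorem fderiv_coordForm_transition (hB : IsPseudoMetric B)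
    (he : e ∈ IsManifold.maximalAtlas 𝓘(ℝ, E) ∞ M)
    (he' : e' ∈ IsManifold.maximalAtlas 𝓘(ℝ, E) ∞ M) {z : E}
    (hz : z ∈ e.target) (hz' : e.symm z ∈ e'.source) (a b c : E) :
    fderiv ℝ (coordForm B e) z c a b =
      fderiv ℝ (coordForm B e') (e' (e.symm z)) (fderiv ℝ (e' ∘ e.symm) z c)
        (fderiv ℝ (e' ∘ e.symm) z a) (fderiv ℝ (e' ∘ e.symm) z b)
      + coordForm B e' (e' (e.symm z)) (fderiv ℝ (fderiv ℝ (e' ∘ e.symm)) z c a)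
        (fderiv ℝ (e' ∘ e.symm) z b)
      + coordForm B e' (e' (e.symm z)) (fderiv ℝ (e' ∘ e.symm) z a)
        (fderiv ℝ (fderiv ℝ (e' ∘ e.symm)) z c b) := by
  have hφ := contDiffAt_transition he he' hz hz'
  set φ := e' ∘ e.symm with hφdef
  have hd : DifferentiableAt ℝ (coordForm B e) z :=
    ((contDiffOn_coordForm hB he).contDiffAt (e.open_target.mem_nhds hz)).differentiableAt (by simp)
  have hd' : DifferentiableAt ℝ (coordForm B e') (φ z) :=
    ((contDiffOn_coordForm hB he').contDiffAt
      (e'.open_target.mem_nhds (e'.map_source hz'))).differentiableAt (by simp)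
  have hφd : DifferentiableAt ℝ φ z := hφ.differentiableAt (by simp)
  have hφ2 : DifferentiableAt ℝ (fderiv ℝ φ) z :=
    (hφ.fderiv_right (m := ∞) (by simp)).differentiableAt (by simp)
  have heq : (fun w => coordForm B e w a b) =ᶠ[𝓝 z]
      fun w => coordForm B e' (φ w) (fderiv ℝ φ w a) (fderiv ℝ φ w b) := by
    have h1 : e.symm ⁻¹' e'.source ∈ 𝓝 z :=
      (e.continuousAt_symm hz).preimage_mem_nhds (e'.open_source.mem_nhds hz')
    filter_upwards [h1, e.open_target.mem_nhds hz] with w hw hw2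
    exact coordForm_transition B he he' hw2 hw a b
  have hL : HasFDerivAt (fun w => coordForm B e w a b) _ z :=
    ((hd.hasFDerivAt.clm_apply (hasFDerivAt_const a z)).clm_apply (hasFDerivAt_const b z))
  have hc : HasFDerivAt (fun w => coordForm B e' (φ w)) _ z :=
    hd'.hasFDerivAt.comp z hφd.hasFDerivAt
  have hR := ((hc.clm_apply
    (hφ2.hasFDerivAt.clm_apply (hasFDerivAt_const a z))).clm_apply
    (hφ2.hasFDerivAt.clm_apply (hasFDerivAt_const b z)))
  have := hL.unique (hR.congr_of_eventuallyEq heq)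
  have := congrArg (fun L : E →L[ℝ] ℝ => L c) this
  simp only [add_apply, ContinuousLinearMap.comp_apply,
    ContinuousLinearMap.flip_apply, zero_apply,
    map_zero, zero_add] at this
  rw [this]
  simp only [hφdef, Function.comp_apply]
  ring

theorem fderiv_fderiv_symm {V F : Type*} [NormedAddCommGroup V] [NormedSpace ℝ V]
    [NormedAddCommGroup F] [NormedSpace ℝ F] {f : V → F} {p : V} (hf : ContDiffAt ℝ 2 f p)
    (u w : V) : fderiv ℝ (fderiv ℝ f) p u w = fderiv ℝ (fderiv ℝ f) p w u := by
  have h1 := hf.isSymmSndFDerivAt (by simp)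
  exact h1 u w

theorem fderiv_transition_injective
    (he : e ∈ IsManifold.maximalAtlas 𝓘(ℝ, E) ∞ M)
    (he' : e' ∈ IsManifold.maximalAtlas 𝓘(ℝ, E) ∞ M) {z : E}
    (hz : z ∈ e.target) (hz' : e.symm z ∈ e'.source) {a b : E}
    (hab : fderiv ℝ (e' ∘ e.symm) z a = fderiv ℝ (e' ∘ e.symm) z b) : a = b := by
  have h1 := fromCoord_transition he he' hz hz' a
  have h2 := fromCoord_transition he he' hz hz' b
  rw [hab, h2] at h1
  have h3 := congrArg (fun x : E => (toCoord e (e.symm z) x : E)) h1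
  exact ((toCoord_fromCoord he hz b).symm.trans (h3.trans (toCoord_fromCoord he hz a))).symm

theorem fderiv_transition_surjective
    (he : e ∈ IsManifold.maximalAtlas 𝓘(ℝ, E) ∞ M)
    (he' : e' ∈ IsManifold.maximalAtlas 𝓘(ℝ, E) ∞ M) {z : E}
    (hz : z ∈ e.target) (hz' : e.symm z ∈ e'.source) :
    Function.Surjective (fderiv ℝ (e' ∘ e.symm) z) := by
  have : Function.Injective (fderiv ℝ (e' ∘ e.symm) z : E →ₗ[ℝ] E) :=
    fun a b hab => fderiv_transition_injective he he' hz hz' hab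
  exact LinearMap.injective_iff_surjective.1 this

/-- Both sides are paired with an arbitrary vector, written as the image of some `c`, so that the
formula for the symbols of the first kind applies. By symmetry of the second derivative, the terms
that contain it at `(a, c)` and `(b, c)` cancel, and only the one at `(a, b)` survives. -/
theorem christoffel_transition (hB : IsPseudoMetric B)
    (he : e ∈ IsManifold.maximalAtlas 𝓘(ℝ, E) ∞ M)
    (he' : e' ∈ IsManifold.maximalAtlas 𝓘(ℝ, E) ∞ M) {z : E}
    (hz : z ∈ e.target) (hz' : e.symm z ∈ e'.source) (a b : E) :
    fderiv ℝ (e' ∘ e.symm) z (christoffel B e z a b) =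
      christoffel B e' (e' (e.symm z)) (fderiv ℝ (e' ∘ e.symm) z a) (fderiv ℝ (e' ∘ e.symm) z b)
      + fderiv ℝ (fderiv ℝ (e' ∘ e.symm)) z a b := by
  rw [← sub_eq_zero]
  refine coordForm_nondeg hB he' (e'.map_source hz') fun c' => ?_
  obtain ⟨c, rfl⟩ := fderiv_transition_surjective he he' hz hz' c'
  rw [map_sub, map_add, sub_apply, add_apply,
    ← coordForm_transition B he he' hz hz', coordForm_christoffel hB he hz,
    coordForm_christoffel hB he' (e'.map_source hz'), christoffelLower_apply,
    christoffelLower_apply]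
  have hφ : ContDiffAt ℝ 2 (e' ∘ e.symm) z :=
    (contDiffAt_transition he he' hz hz').of_le ENat.LEInfty.out
  rw [fderiv_coordForm_transition hB he he' hz hz', fderiv_coordForm_transition hB he he' hz hz',
    fderiv_coordForm_transition hB he he' hz hz', fderiv_fderiv_symm hφ b a,
    fderiv_fderiv_symm hφ c a, fderiv_fderiv_symm hφ c b]
  have hs := coordForm_symm (e := e') hB (e' (e.symm z))
  rw [hs (fderiv ℝ (fderiv ℝ (e' ∘ e.symm)) z a c) (fderiv ℝ (e' ∘ e.symm) z b),
    hs (fderiv ℝ (e' ∘ e.symm) z a) (fderiv ℝ (fderiv ℝ (e' ∘ e.symm)) z b c)]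
  ring

end ChristoffelSymbols

/-! ### The covariant Hessian is independent of the chart. -/

section Hessian

variable {E : Type*} [NormedAddCommGroup E] [NormedSpace ℝ E] [FiniteDimensional ℝ E]
  {M : Type*} [TopologicalSpace M] [ChartedSpace E M] [IsManifold 𝓘(ℝ, E) ∞ M]
  {e e' : OpenPartialHomeomorph M E} {B : FormField E M}
  {V : Type*} [NormedAddCommGroup V] [NormedSpace ℝ V]

/-- The covariant Hessian `D²z(u, w) + Γ(Dz u, Dz w)` of a map `z` into the coordinate space. -/
def coordHess (B : FormField E M) (e : OpenPartialHomeomorph M E) (z : V → E) (p u w : V) : E :=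
  fderiv ℝ (fderiv ℝ z) p u w + christoffel B e (z p) (fderiv ℝ z p u) (fderiv ℝ z p w)

/-- The second derivative of the coordinate change in the chain rule cancels the inhomogeneous term
in the transformation law of the Christoffel symbols. Hence the Hessian transforms like a tangent
vector. -/
theorem coordHess_transition (hB : IsPseudoMetric B)
    (he : e ∈ IsManifold.maximalAtlas 𝓘(ℝ, E) ∞ M)
    (he' : e' ∈ IsManifold.maximalAtlas 𝓘(ℝ, E) ∞ M) {z : V → E} {p : V}
    (hz : z p ∈ e.target) (hz' : e.symm (z p) ∈ e'.source) (hzc : ContDiffAt ℝ 2 z p) (u w : V) :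
    coordHess B e' ((e' ∘ e.symm) ∘ z) p u w =
      fderiv ℝ (e' ∘ e.symm) (z p) (coordHess B e z p u w) := by
  have hφ := contDiffAt_transition he he' hz hz'
  have hz1 : DifferentiableAt ℝ z p := hzc.differentiableAt (by simp)
  have hz2 : DifferentiableAt ℝ (fderiv ℝ z) p :=
    (hzc.fderiv_right (m := 1) (by norm_num)).differentiableAt (by simp)
  have hφ1 : DifferentiableAt ℝ (e' ∘ e.symm) (z p) := hφ.differentiableAt (by simp)
  have hφ2 : DifferentiableAt ℝ (fderiv ℝ (e' ∘ e.symm)) (z p) :=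
    (hφ.fderiv_right (m := ∞) (by simp)).differentiableAt (by simp)
  have h1 : fderiv ℝ ((e' ∘ e.symm) ∘ z) =ᶠ[𝓝 p]
      fun q => (fderiv ℝ (e' ∘ e.symm) (z q)).comp (fderiv ℝ z q) := by
    have h2 : ∀ᶠ q in 𝓝 p, DifferentiableAt ℝ z q := by
      have := (hzc.eventually (by simp))
      filter_upwards [this] with q hq using hq.differentiableAt (by simp)
    have h3 : ∀ᶠ q in 𝓝 (z p), DifferentiableAt ℝ (e' ∘ e.symm) q := by
      have := (hφ.of_le (m := 1) (by simp)).eventually (by simp)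
      filter_upwards [this] with q hq using hq.differentiableAt (by simp)
    filter_upwards [h2, hzc.continuousAt.eventually h3] with q hq hq'
    exact fderiv_comp q hq' hq
  have h4 : HasFDerivAt (fun q => (fderiv ℝ (e' ∘ e.symm) (z q)).comp (fderiv ℝ z q)) _ p :=
    (hφ2.hasFDerivAt.comp p hz1.hasFDerivAt).clm_comp hz2.hasFDerivAt
  have h5 : fderiv ℝ (fderiv ℝ ((e' ∘ e.symm) ∘ z)) p u w =
      fderiv ℝ (fderiv ℝ (e' ∘ e.symm)) (z p) (fderiv ℝ z p u) (fderiv ℝ z p w)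
        + fderiv ℝ (e' ∘ e.symm) (z p) (fderiv ℝ (fderiv ℝ z) p u w) := by
    rw [h1.fderiv_eq, h4.fderiv]
    simp [add_comm]
  unfold coordHess
  rw [h5, h1.self_of_nhds, map_add, christoffel_transition hB he he' hz hz']
  simp only [ContinuousLinearMap.comp_apply, Function.comp_apply]
  abel

theorem toCoord_transition (he : e ∈ IsManifold.maximalAtlas 𝓘(ℝ, E) ∞ M)
    (he' : e' ∈ IsManifold.maximalAtlas 𝓘(ℝ, E) ∞ M) {p : M} (hp : p ∈ e.source)
    (hp' : p ∈ e'.source) (v : E) :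
    (toCoord e' p v : E) = fderiv ℝ (e' ∘ e.symm) (e p) (toCoord e p v) := by
  have hz' : e.symm (e p) ∈ e'.source := by rwa [e.left_inv hp]
  have h0 := (contMDiffAt_iff_contDiffAt.2
    (contDiffAt_transition he he' (e.map_source hp) hz')).mdifferentiableAt (by simp)
  have h1 := (contMDiffAt_chart he hp).mdifferentiableAt (by simp)
  have h3 : ((e' ∘ e.symm) ∘ e) =ᶠ[𝓝 p] e' := by
    filter_upwards [e.open_source.mem_nhds hp] with w hw
    simp [e.left_inv hw]
  have h4 := mfderiv_comp p (I' := 𝓘(ℝ, E)) h0 h1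
  rw [h3.mfderiv_eq, mfderiv_eq_fderiv] at h4
  exact congrArg (fun L : E →L[ℝ] E => L v) h4

theorem toCoord_isInvertible (he : e ∈ IsManifold.maximalAtlas 𝓘(ℝ, E) ∞ M) {p : M}
    (hp : p ∈ e.source) : (toCoord e p).IsInvertible := by
  have hinj : Function.Injective ((show E →L[ℝ] E from toCoord e p) : E →ₗ[ℝ] E) :=
    fun v w h => toCoord_injective he hp h
  exact ⟨(LinearEquiv.ofInjectiveOfFinrankEq _ hinj rfl).toContinuousLinearEquiv, by ext; rfl⟩

theorem contDiffAt_chart_comp {c : V → M} {s : V} {n : WithTop ℕ∞} (hn : n ≤ (∞ : WithTop ℕ∞))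
    (he : e ∈ IsManifold.maximalAtlas 𝓘(ℝ, E) ∞ M)
    (hc : ContMDiffAt 𝓘(ℝ, V) 𝓘(ℝ, E) n c s) (hs : c s ∈ e.source) :
    ContDiffAt ℝ n (e ∘ c) s := by
  rw [← contMDiffAt_iff_contDiffAt]
  exact ((contMDiffAt_chart he hs).of_le hn).comp s hc

theorem toCoord_mfderiv {c : V → M} {s : V} (he : e ∈ IsManifold.maximalAtlas 𝓘(ℝ, E) ∞ M)
    (hc : MDifferentiableAt 𝓘(ℝ, V) 𝓘(ℝ, E) c s) (hs : c s ∈ e.source) (u : V) :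
    (toCoord e (c s) (mfderiv 𝓘(ℝ, V) 𝓘(ℝ, E) c s u) : E) = fderiv ℝ (e ∘ c) s u := by
  have h1 := (contMDiffAt_chart he hs).mdifferentiableAt (by simp)
  have h4 := mfderiv_comp s h1 hc
  rw [mfderiv_eq_fderiv] at h4
  exact (congrArg (fun L : V →L[ℝ] E => L u) h4).symm

theorem toCoord_velocity {c : ℝ → M} {s : ℝ} (he : e ∈ IsManifold.maximalAtlas 𝓘(ℝ, E) ∞ M)
    (hc : MDifferentiableAt 𝓘(ℝ, ℝ) 𝓘(ℝ, E) c s) (hs : c s ∈ e.source) :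
    (toCoord e (c s) (velocity E c s) : E) = deriv (e ∘ c) s := by
  rw [← fderiv_apply_one_eq_deriv]
  exact toCoord_mfderiv he hc hs (1 : ℝ)

theorem coordHess_congr {z z' : V → E} {p : V} (h : z =ᶠ[𝓝 p] z') (u w : V) :
    coordHess B e z p u w = coordHess B e z' p u w := by
  unfold coordHess
  rw [h.fderiv_eq, h.fderiv.fderiv_eq, h.self_of_nhds]

/-- In particular the vanishing of the Hessian may be tested in any chart, which is how both the
geodesic and the wave map equation are moved between charts. -/
theorem coordHess_chart_comp (hB : IsPseudoMetric B)
    (he : e ∈ IsManifold.maximalAtlas 𝓘(ℝ, E) ∞ M)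
    (he' : e' ∈ IsManifold.maximalAtlas 𝓘(ℝ, E) ∞ M) {y : V → M} {p : V}
    (hy : ContMDiffAt 𝓘(ℝ, V) 𝓘(ℝ, E) 2 y p) (hp : y p ∈ e.source) (hp' : y p ∈ e'.source)
    (u w : V) :
    coordHess B e' (e' ∘ y) p u w = fderiv ℝ (e' ∘ e.symm) (e (y p))
      (coordHess B e (e ∘ y) p u w) := by
  have hz' : e.symm ((e ∘ y) p) ∈ e'.source := by simpa [e.left_inv hp] using hp'
  refine Eq.trans ?_ (coordHess_transition (z := e ∘ y) (p := p) hB he he' (e.map_source hp) hz'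
    (contDiffAt_chart_comp (c := y) (s := p) ENat.LEInfty.out he hy hp) u w)
  refine coordHess_congr ?_ u w
  filter_upwards [hy.continuousAt.preimage_mem_nhds (e.open_source.mem_nhds hp)] with q hq
  simp [e.left_inv hq]

/-- The covariant derivative of the velocity of a curve, in the coordinates of any chart. -/
theorem toCoord_covDeriv_velocity (hB : IsPseudoMetric B)
    (he : e ∈ IsManifold.maximalAtlas 𝓘(ℝ, E) ∞ M) {c : ℝ → M} {s : ℝ}
    (hc : ContMDiffAt 𝓘(ℝ, ℝ) 𝓘(ℝ, E) 2 c s) (hs : c s ∈ e.source) :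
    (toCoord e (c s) (covDeriv B c (velocity E c) s) : E) = coordHess B e (e ∘ c) s 1 1 := by
  have he0 : chartAt E (c s) ∈ IsManifold.maximalAtlas 𝓘(ℝ, E) ∞ M :=
    IsManifold.chart_mem_maximalAtlas _
  have hs0 := mem_chart_source E (c s)
  have hc0 : ∀ᶠ r in 𝓝 s, MDifferentiableAt 𝓘(ℝ, ℝ) 𝓘(ℝ, E) c r := by
    filter_upwards [(contMDiffAt_iff_contMDiffAt_nhds (by simp)).1 hc] with r hr using hr.mdifferentiableAt (by simp)
  have h1 : toCoord (chartAt E (c s)) (c s) (covDeriv B c (velocity E c) s)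
      = coordHess B (chartAt E (c s)) (chartAt E (c s) ∘ c) s (1 : ℝ) 1 := by
    unfold covDeriv
    rw [(toCoord_isInvertible he0 hs0).self_apply_inverse]
    have h2 : (fun r => (toCoord (chartAt E (c s)) (c r) (velocity E c r) : E)) =ᶠ[𝓝 s]
        deriv (chartAt E (c s) ∘ c) := by
      filter_upwards [hc0, hc.continuousAt.preimage_mem_nhds
        ((chartAt E (c s)).open_source.mem_nhds hs0)] with r hr hr'
      exact toCoord_velocity he0 hr hr'
    have h3 : ContDiffAt ℝ 2 (chartAt E (c s) ∘ c) s :=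
      contDiffAt_chart_comp ENat.LEInfty.out he0 hc hs0
    have h4 : DifferentiableAt ℝ (fderiv ℝ (chartAt E (c s) ∘ c)) s :=
      (h3.fderiv_right (m := 1) (by norm_num)).differentiableAt (by simp)
    have h5 : deriv (deriv (chartAt E (c s) ∘ c)) s
        = fderiv ℝ (fderiv ℝ (chartAt E (c s) ∘ c)) s (1 : ℝ) 1 := by
      have : deriv (chartAt E (c s) ∘ c) = fun r => fderiv ℝ (chartAt E (c s) ∘ c) r 1 := by
        ext r; rw [fderiv_apply_one_eq_deriv]
      rw [this, ← fderiv_apply_one_eq_deriv, fderiv_clm_apply h4 (differentiableAt_const _)]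
      simp
    unfold coordHess
    rw [fderiv_apply_one_eq_deriv]
    refine congrArg₂ (· + ·) (h2.deriv_eq.trans h5) ?_
    exact congrArg₂ (fun x y => christoffel B _ _ x y) rfl h2.self_of_nhds
  -- `covDeriv` is computed in the preferred chart at `c s`; tensoriality carries the result to `e`.
  refine (toCoord_transition he0 he hs0 hs _).trans ?_
  rw [h1, ← coordHess_chart_comp hB he0 he hc hs0 hs]

end Hessian

/-! ### Smoothness of superposition operators on spaces of continuous functions. -/

section Superposition

universe u v

variable {K : Type*} [TopologicalSpace K] [CompactSpace K]

/-- The superposition operator `w ↦ f ∘ w` on spaces of continuous functions. -/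
def superpose {E F : Type*} [TopologicalSpace E] [TopologicalSpace F] {f : E → F}
    (hf : Continuous f) (w : C(K, E)) : C(K, F) := (⟨f, hf⟩ : C(E, F)).comp w

@[simp] theorem superpose_apply {E F : Type*} [TopologicalSpace E] [TopologicalSpace F] {f : E → F}
    (hf : Continuous f) (w : C(K, E)) (κ : K) : superpose hf w κ = f (w κ) := rfl

theorem continuous_superpose {E F : Type*} [TopologicalSpace E] [TopologicalSpace F] {f : E → F}
    (hf : Continuous f) : Continuous (superpose hf : C(K, E) → C(K, F)) :=
  ContinuousMap.continuous_postcomp _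

/-- Pointwise application of operator-valued functions to vector-valued functions. -/
def pointwiseApply (K : Type*) [TopologicalSpace K] [CompactSpace K] (E F : Type*)
    [NormedAddCommGroup E] [NormedSpace ℝ E] [NormedAddCommGroup F] [NormedSpace ℝ F] :
    C(K, E →L[ℝ] F) →L[ℝ] C(K, E) →L[ℝ] C(K, F) :=
  LinearMap.mkContinuous₂
    (LinearMap.mk₂ ℝ (fun a w => (⟨fun κ => a κ (w κ), by fun_prop⟩ : C(K, F)))
      (fun a b w => by ext κ; rfl) (fun r a w => by ext κ; rfl)
      (fun a v w => by ext κ; exact map_add (a κ) (v κ) (w κ))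
      (fun r a w => by ext κ; exact map_smul (a κ) r (w κ)))
    1 (fun a w => by
      rw [ContinuousMap.norm_le _ (by positivity)]
      intro κ
      refine ((a κ).le_opNorm _).trans ?_
      rw [one_mul]
      exact mul_le_mul (a.norm_coe_le_norm κ) (w.norm_coe_le_norm κ) (norm_nonneg _) (norm_nonneg _))

theorem norm_pointwiseApply_le {E F : Type*} [NormedAddCommGroup E] [NormedSpace ℝ E]
    [NormedAddCommGroup F] [NormedSpace ℝ F] (a : C(K, E →L[ℝ] F)) :
    ‖pointwiseApply K E F a‖ ≤ ‖a‖ := by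
  have h : ‖pointwiseApply K E F a‖ ≤ 1 * ‖a‖ :=
    ((pointwiseApply K E F).le_opNorm a).trans
      (mul_le_mul_of_nonneg_right (LinearMap.mkContinuous₂_norm_le _ zero_le_one _) (norm_nonneg _))
  simpa using h

/-- Continuity of the superposition operator of `fderiv ℝ f` at `w` is a uniform statement along the
range of `w`. Perturbing `w` by constant functions shows that `fderiv ℝ f` varies by at most `ε` on
the ball of one radius `δ` about every `w κ`, and the mean value inequality concludes. -/
theorem hasFDerivAt_superpose {E F : Type*} [NormedAddCommGroup E] [NormedSpace ℝ E]
    [NormedAddCommGroup F] [NormedSpace ℝ F] {f : E → F} (hf : Differentiable ℝ f)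
    (hf' : Continuous (fderiv ℝ f)) (w : C(K, E)) :
    HasFDerivAt (superpose hf.continuous : C(K, E) → C(K, F))
      (pointwiseApply K E F (superpose hf' w)) w := by
  rw [hasFDerivAt_iff_isLittleO_nhds_zero, Asymptotics.isLittleO_iff]
  intro ε hε
  have h1 := Metric.continuous_iff.1 (continuous_superpose (K := K) hf') w ε hε
  obtain ⟨δ, hδ, h1⟩ := h1
  filter_upwards [Metric.ball_mem_nhds (0 : C(K, E)) hδ] with v hv
  rw [mem_ball_zero_iff] at hv
  rw [ContinuousMap.norm_le _ (by positivity)]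
  intro κ
  have h2 : ∀ z ∈ Metric.ball (w κ) δ, ‖fderiv ℝ f z - fderiv ℝ f (w κ)‖ ≤ ε := by
    intro z hz
    have h3 : dist (w + ContinuousMap.const K (z - w κ)) w < δ := by
      rw [dist_eq_norm, add_sub_cancel_left]
      refine lt_of_le_of_lt ?_ (mem_ball_iff_norm.1 hz)
      rw [ContinuousMap.norm_le _ (norm_nonneg _)]
      intro κ'
      rfl
    have h4 := h1 _ h3
    have h5 := (ContinuousMap.dist_apply_le_dist (f := superpose hf' (w + ContinuousMap.const K (z - w κ)))
      (g := superpose hf' w) κ).trans h4.le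
    simpa [dist_eq_norm] using h5
  have h6 := (convex_ball (w κ) δ).norm_image_sub_le_of_norm_hasFDerivWithin_le'
    (f := f) (f' := fderiv ℝ f) (φ := fderiv ℝ f (w κ)) (C := ε)
    (fun z _ => (hf z).hasFDerivAt.hasFDerivWithinAt) h2 (Metric.mem_ball_self hδ)
    (y := w κ + v κ) (by
      rw [mem_ball_iff_norm, add_sub_cancel_left]
      exact (v.norm_coe_le_norm κ).trans_lt hv)
  rw [add_sub_cancel_left] at h6
  refine le_trans (le_of_eq ?_) (h6.trans (mul_le_mul_of_nonneg_left (v.norm_coe_le_norm κ) hε.le))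
  rfl

/-- Induction on `n`: the derivative is a fixed continuous linear map applied to the superposition
operator of `fderiv ℝ f`. The target is quantified inside, in the universe `max u v`, because the
induction passes from `F` to `E →L[ℝ] F`. -/
theorem contDiff_superpose_nat {E : Type u} [NormedAddCommGroup E] [NormedSpace ℝ E] (n : ℕ) :
    ∀ {F : Type (max u v)} [NormedAddCommGroup F] [NormedSpace ℝ F] {f : E → F}
      (_ : ContDiff ℝ n f) (hc : Continuous f),
      ContDiff ℝ n (superpose hc : C(K, E) → C(K, F)) := by
  induction n with
  | zero => intro F _ _ f hf hc; exact contDiff_zero.2 (continuous_superpose hc)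
  | succ n ih =>
    intro F _ _ f hf hc
    rw [Nat.cast_succ] at hf ⊢
    rw [contDiff_succ_iff_fderiv] at hf ⊢
    have hf' : Continuous (fderiv ℝ f) := hf.2.2.continuous
    have hd := hasFDerivAt_superpose (K := K) hf.1 hf'
    refine ⟨fun w => (hd w).differentiableAt, fun h => absurd h (by simp), ?_⟩
    have : fderiv ℝ (superpose hc : C(K, E) → C(K, F)) =
        fun w => pointwiseApply K E F (superpose hf' w) := by
      ext1 w; exact (hd w).fderiv
    rw [this]
    exact (ContinuousLinearMap.contDiff _).comp (ih hf.2.2 hf')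

theorem contDiff_superpose {E : Type u} [NormedAddCommGroup E] [NormedSpace ℝ E]
    {F : Type (max u v)} [NormedAddCommGroup F] [NormedSpace ℝ F] {f : E → F}
    (hf : ContDiff ℝ ∞ f) : ContDiff ℝ ∞ (superpose hf.continuous : C(K, E) → C(K, F)) :=
  contDiff_infty.2 fun n => contDiff_superpose_nat.{u, v} n (hf.of_le (by exact_mod_cast le_top)) _

end Superposition

/-! ### The unit cone and integration along its characteristic segments. -/

section Transport

variable {X : Type*} [NormedAddCommGroup X] [NormedSpace ℝ X] [FiniteDimensional ℝ X]

/-- The unit cone of points `(s, σ)` with `0 ≤ s ≤ 1` and `‖σ‖ ≤ 1 - s`. -/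
def unitCone (X : Type*) [NormedAddCommGroup X] : Set (ℝ × X) :=
  {p | 0 ≤ p.1 ∧ p.1 ≤ 1 ∧ ‖p.2‖ ≤ 1 - p.1}

instance : CompactSpace (unitCone X) := by
  rw [← isCompact_iff_compactSpace]
  have : ProperSpace X := FiniteDimensional.proper ℝ X
  refine IsCompact.of_isClosed_subset
    ((isCompact_Icc (a := (0 : ℝ)) (b := 1)).prod (isCompact_closedBall (0 : X) 1)) ?_ ?_
  · have h1 : IsClosed {p : ℝ × X | ‖p.2‖ ≤ 1 - p.1} := isClosed_le (by fun_prop) (by fun_prop)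
    exact (isClosed_le continuous_const continuous_fst).inter
      ((isClosed_le continuous_fst continuous_const).inter h1)
  · rintro ⟨s, σ⟩ ⟨h0, h1, h2⟩
    exact ⟨⟨h0, h1⟩, by simp only [mem_closedBall_zero_iff]; simp only at h0 h2; linarith⟩

/-- The apex of the unit cone. -/
def coneApex (X : Type*) [NormedAddCommGroup X] : unitCone X := ⟨(1, 0), by simp [unitCone]⟩

/-- The segment from `κ` down to the base of the cone with slope `c`. -/
def coneSegment {c : X} (hc : ‖c‖ ≤ 1) (κ : unitCone X) (θ : ℝ) : unitCone X :=
  -- Clamping makes the segment a continuous function of every real `θ`; the integrals only see `θ ∈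
  -- [0, 1]`.
  ⟨(κ.1.1 * projIcc (0 : ℝ) 1 zero_le_one θ,
    κ.1.2 - (κ.1.1 * (1 - projIcc (0 : ℝ) 1 zero_le_one θ)) • c), by
    obtain ⟨⟨s, σ⟩, h0, h1, h2⟩ := κ
    have h3 := (projIcc (0 : ℝ) 1 zero_le_one θ).2
    set θ' : ℝ := ((projIcc (0 : ℝ) 1 zero_le_one θ : Icc (0 : ℝ) 1) : ℝ)
    simp only at h0 h1 h2 h3 ⊢
    refine ⟨mul_nonneg h0 h3.1, mul_le_one₀ h1 h3.1 h3.2, ?_⟩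
    have h4 : ‖(s * (1 - θ')) • c‖ ≤ s * (1 - θ') := by
      rw [norm_smul, Real.norm_of_nonneg (mul_nonneg h0 (by linarith [h3.2]))]
      exact mul_le_of_le_one_right (mul_nonneg h0 (by linarith [h3.2])) hc
    refine (norm_sub_le _ _).trans ?_
    simp only
    linarith⟩

theorem continuous_coneSegment {c : X} (hc : ‖c‖ ≤ 1) :
    Continuous (fun p : unitCone X × ℝ => coneSegment hc p.1 p.2) := by
  refine Continuous.subtype_mk ?_ _
  have h1 : Continuous fun p : unitCone X × ℝ => (projIcc (0 : ℝ) 1 zero_le_one p.2 : ℝ) :=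
    continuous_subtype_val.comp (continuous_projIcc.comp continuous_snd)
  fun_prop

variable {ι : Type*} [Fintype ι] {F : Type*} [NormedAddCommGroup F] [NormedSpace ℝ F]

/-- Integration along the segments of slopes `c i`. -/
def coneIntegral {c : ι → X} (hc : ∀ i, ‖c i‖ ≤ 1) :
    C(unitCone X, ι → F) →L[ℝ] C(unitCone X, ι → F) :=
  LinearMap.mkContinuous
    -- The factor `κ.1.1` comes from the substitution `r = κ.1.1 * θ`, which fixes the interval of
    -- integration.
    { toFun := fun w => ⟨fun κ i => κ.1.1 • ∫ θ in (0 : ℝ)..1, w (coneSegment (hc i) κ θ) i, by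
        refine continuous_pi fun i => Continuous.smul (by fun_prop) ?_
        refine intervalIntegral.continuous_parametric_intervalIntegral_of_continuous' ?_ 0 1
        exact (continuous_apply i).comp (w.continuous.comp (continuous_coneSegment (hc i)))⟩
      map_add' := fun w w' => by
        ext κ i
        have h : ∀ w : C(unitCone X, ι → F), IntervalIntegrable
            (fun θ => w (coneSegment (hc i) κ θ) i) MeasureTheory.volume 0 1 := fun w =>
          Continuous.intervalIntegrable ((continuous_apply i).comp (w.continuous.comp
            ((continuous_coneSegment (hc i)).comp (by fun_prop : Continuous fun θ : ℝ => (κ, θ))))) _ _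
        simp only [ContinuousMap.coe_mk, ContinuousMap.add_apply, Pi.add_apply]
        rw [intervalIntegral.integral_add (h w) (h w'), smul_add]
      map_smul' := fun r w => by
        ext κ i
        simp only [ContinuousMap.coe_mk, ContinuousMap.smul_apply, Pi.smul_apply, RingHom.id_apply]
        rw [intervalIntegral.integral_smul, smul_comm] }
    1 (fun w => by
      rw [ContinuousMap.norm_le _ (by positivity)]
      intro κ
      refine (pi_norm_le_iff_of_nonneg (by positivity)).2 fun i => ?_
      simp only [LinearMap.coe_mk, AddHom.coe_mk, ContinuousMap.coe_mk]
      rw [norm_smul]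
      refine mul_le_mul ?_ ?_ (norm_nonneg _) zero_le_one
      · rw [Real.norm_of_nonneg κ.2.1]; exact κ.2.2.1
      · have := intervalIntegral.norm_integral_le_of_norm_le_const (a := (0 : ℝ)) (b := 1)
          (f := fun θ => w (coneSegment (hc i) κ θ) i) (C := ‖w‖)
          (fun θ _ => (norm_le_pi_norm _ i).trans (w.norm_coe_le_norm _))
        simpa using this)

theorem coneIntegral_apply {c : ι → X} (hc : ∀ i, ‖c i‖ ≤ 1) (w : C(unitCone X, ι → F))
    (κ : unitCone X) (i : ι) : coneIntegral hc w κ i =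
      κ.1.1 • ∫ θ in (0 : ℝ)..1, w (coneSegment (hc i) κ θ) i := rfl

theorem norm_coneIntegral_le {c : ι → X} (hc : ∀ i, ‖c i‖ ≤ 1) :
    ‖(coneIntegral hc : C(unitCone X, ι → F) →L[ℝ] C(unitCone X, ι → F))‖ ≤ 1 :=
  LinearMap.mkContinuous_norm_le _ zero_le_one _

end Transport

/-! ### Smooth solutions of semilinear transport systems on a slab. -/

section TransportSolution

universe u v w

variable {X : Type u} [NormedAddCommGroup X] [NormedSpace ℝ X] [FiniteDimensional ℝ X]
  {ι : Type w} [Fintype ι] {F : Type (max u v)} [NormedAddCommGroup F] [NormedSpace ℝ F]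

/-- The function `κ = (s, σ) ↦ σ - s c` on the unit cone. -/
def coneShift (c : X) : C(unitCone X, X) := ⟨fun κ => κ.1.2 - κ.1.1 • c, by fun_prop⟩

/-- The transported initial values on the cone with apex `(t, x)`, scaled to the unit cone. -/
def coneData (c : ι → X) {V₀ : X → ι → F} (hV₀ : Continuous V₀) (p : ℝ × X) :
    C(unitCone X, ι → F) :=
  ⟨fun κ i => V₀ (p.2 + p.1 • coneShift (c i) κ) i, by
    refine continuous_pi fun i => (continuous_apply i).comp (hV₀.comp ?_)
    fun_prop⟩

/-- Each component is a smooth superposition operator applied to a function on the cone that depends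
smoothly on the apex `p`; the components are then assembled by continuous linear injections. -/
theorem contDiff_coneData (c : ι → X) {V₀ : X → ι → F} (hV₀ : ContDiff ℝ ∞ V₀) :
    ContDiff ℝ ∞ (coneData c hV₀.continuous) := by
  have h1 : ∀ i, ContDiff ℝ ∞ fun p : ℝ × X =>
      (ContinuousMap.const (unitCone X) p.2 + p.1 • coneShift (c i) : C(unitCone X, X)) := by
    intro i
    have h2 : ContDiff ℝ ∞ fun x : X => (ContinuousMap.const (unitCone X) x : C(unitCone X, X)) :=
      (ContinuousLinearMap.const ℝ (unitCone X) : X →L[ℝ] C(unitCone X, X)).contDiff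
    exact (h2.comp contDiff_snd).add (contDiff_fst.smul contDiff_const)
  have h0 : ∀ i, ContDiff ℝ ∞ fun x => V₀ x i := fun i => contDiff_pi.1 hV₀ i
  have h3 : ∀ i, ContDiff ℝ ∞ fun p : ℝ × X => superpose (K := unitCone X) (h0 i).continuous
      (ContinuousMap.const (unitCone X) p.2 + p.1 • coneShift (c i)) := fun i =>
    (contDiff_superpose.{u, max u v} (K := unitCone X) (h0 i)).comp (h1 i)
  classical
  let S : ∀ i : ι, C(unitCone X, F) →L[ℝ] C(unitCone X, ι → F) := fun i =>
    ContinuousLinearMap.compLeftContinuous ℝ (unitCone X)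
      (ContinuousLinearMap.single ℝ (fun _ : ι => F) i)
  have h4 : coneData c hV₀.continuous = fun p => ∑ i, S i (superpose (K := unitCone X)
      (h0 i).continuous (ContinuousMap.const (unitCone X) p.2 + p.1 • coneShift (c i))) := by
    ext p κ i
    have h5 : ∀ j, (S j (superpose (K := unitCone X)
      (h0 j).continuous (ContinuousMap.const (unitCone X) p.2 + p.1 • coneShift (c j)))) κ i
      = (Pi.single j (V₀ (p.2 + p.1 • coneShift (c j) κ) j) : ι → F) i := fun j => rfl
    rw [ContinuousMap.coe_sum, Finset.sum_apply, Finset.sum_apply]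
    simp only [h5, Finset.sum_pi_single, Finset.mem_univ, if_true]
    rfl
  rw [h4]
  exact ContDiff.sum fun i _ => (S i).contDiff.comp (h3 i)

variable {c : ι → X} (hc : ∀ i, ‖c i‖ ≤ 1) {f : (ι → F) → ι → F} {V₀ : X → ι → F}

/-- The integral operator of the scaled transport system. -/
def transportOp (hf : Continuous f) (hV₀ : Continuous V₀) (p : ℝ × X)
    (w : C(unitCone X, ι → F)) : C(unitCone X, ι → F) :=
  coneData c hV₀ p + p.1 • coneIntegral hc (superpose hf w)

theorem norm_coneIntegral_apply_le (w : C(unitCone X, ι → F)) : ‖coneIntegral hc w‖ ≤ ‖w‖ := by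
  have h := (coneIntegral hc : C(unitCone X, ι → F) →L[ℝ] _).le_opNorm w
  exact h.trans (mul_le_of_le_one_left (norm_nonneg _) (norm_coneIntegral_le hc))

theorem contractingWith_transportOp (hf : Continuous f) (hV₀ : Continuous V₀) {L : ℝ≥0}
    (hL : LipschitzWith L f) {p : ℝ × X} (hp : |p.1| * L < 1) :
    ContractingWith (‖p.1‖₊ * L) (transportOp hc hf hV₀ p) := by
  refine ⟨by rw [← NNReal.coe_lt_coe]; simpa using hp, LipschitzWith.of_dist_le_mul fun w w' => ?_⟩
  rw [dist_eq_norm, dist_eq_norm]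
  unfold transportOp
  rw [add_sub_add_left_eq_sub, ← smul_sub, ← map_sub, norm_smul]
  push_cast
  rw [mul_assoc]
  refine mul_le_mul_of_nonneg_left ?_ (norm_nonneg _)
  refine (norm_coneIntegral_apply_le hc _).trans ?_
  rw [ContinuousMap.norm_le _ (by positivity)]
  intro κ
  have h1 := hL.dist_le_mul (w κ) (w' κ)
  rw [dist_eq_norm, dist_eq_norm] at h1
  exact h1.trans (mul_le_mul_of_nonneg_left ((w - w').norm_coe_le_norm κ) L.2)

/-- The map `(p, w) ↦ w - transportOp p w` is smooth and its partial derivative in `w` is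
invertible, so the implicit function theorem applies. Near `p` the implicit function solves the
fixed point equation, whose solution is unique, so it is `W`. -/
theorem contDiffAt_of_transportOp_fixed [CompleteSpace F] (hf : ContDiff ℝ ∞ f)
    (hV₀ : ContDiff ℝ ∞ V₀) {L : ℝ≥0}
    (hL : LipschitzWith L f) {T : ℝ} (hT : T * L < 1) {W : ℝ × X → C(unitCone X, ι → F)}
    (hW : ∀ p, |p.1| < T → transportOp hc hf.continuous hV₀.continuous p (W p) = W p)
    {p : ℝ × X} (hp : |p.1| < T) : ContDiffAt ℝ ∞ W p := by
  have hlt : ∀ q : ℝ × X, |q.1| < T → |q.1| * L < 1 := fun q hq =>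
    (mul_le_mul_of_nonneg_right hq.le L.2).trans_lt hT
  have : CompleteSpace X := FiniteDimensional.complete ℝ X
  let G : (ℝ × X) × C(unitCone X, ι → F) → C(unitCone X, ι → F) := fun u =>
    u.2 - transportOp hc hf.continuous hV₀.continuous u.1 u.2
  have hG : ContDiff ℝ ∞ G := by
    refine contDiff_snd.sub (((contDiff_coneData.{u, v} c hV₀).comp contDiff_fst).add ?_)
    exact (contDiff_fst.comp contDiff_fst).smul ((coneIntegral hc).contDiff.comp
      ((contDiff_superpose.{max w u v, max w u v} hf).comp contDiff_snd))
  have hGd := hG.differentiable (by simp)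
  set D := p.1 • (coneIntegral hc).comp (pointwiseApply (unitCone X) (ι → F) (ι → F)
    (superpose (hf.continuous_fderiv (by simp)) (W p))) with hD
  have hpart : (fderiv ℝ G (p, W p)).comp (ContinuousLinearMap.inr ℝ (ℝ × X) C(unitCone X, ι → F))
      = ContinuousLinearMap.id ℝ _ - D := by
    have h1 : HasFDerivAt (fun w : C(unitCone X, ι → F) => ((p, w) : (ℝ × X) × C(unitCone X, ι → F)))
        (ContinuousLinearMap.inr ℝ (ℝ × X) C(unitCone X, ι → F)) (W p) :=
      hasFDerivAt_prodMk_right p (W p)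
    have h2 := (hGd (p, W p)).hasFDerivAt.comp (W p) h1
    have h3 := hasFDerivAt_superpose (K := unitCone X) (hf.differentiable (by simp))
      (hf.continuous_fderiv (by simp)) (W p)
    have h4 : HasFDerivAt (fun w => G (p, w)) (ContinuousLinearMap.id ℝ _ - D) (W p) := by
      refine (hasFDerivAt_id (W p)).sub ?_
      change HasFDerivAt (fun w => coneData c hV₀.continuous p +
        p.1 • coneIntegral hc (superpose hf.continuous w)) D (W p)
      exact HasFDerivAt.const_add _ ((((coneIntegral hc).hasFDerivAt
        (x := superpose hf.continuous (W p))).comp (W p) h3).const_smul p.1)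
    exact h2.unique h4
  have hinv : ((fderiv ℝ G (p, W p)).comp
      (ContinuousLinearMap.inr ℝ (ℝ × X) C(unitCone X, ι → F))).IsInvertible := by
    rw [hpart]
    -- The Lipschitz constant bounds the derivative of `f`, so `D` has norm at most `|p.1| * L` and
    -- `1 - D` is invertible by the Neumann series.
    have hDn : ‖D‖ < 1 := by
      refine lt_of_le_of_lt ?_ (hlt p hp)
      rw [hD, norm_smul]
      refine mul_le_mul_of_nonneg_left ?_ (abs_nonneg _)
      refine (ContinuousLinearMap.opNorm_comp_le _ _).trans ?_
      refine (mul_le_of_le_one_left (norm_nonneg _) (norm_coneIntegral_le hc)).trans ?_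
      refine (norm_pointwiseApply_le _).trans ?_
      exact (ContinuousMap.norm_le _ L.coe_nonneg).2 fun κ => norm_fderiv_le_of_lipschitz ℝ hL
    exact ⟨ContinuousLinearEquiv.unitsEquiv ℝ _ (Units.oneSub D hDn), rfl⟩
  have hGu : G (p, W p) = 0 := by simp only [G, hW p hp, sub_self]
  have hcd : ContDiffAt ℝ ∞ G (p, W p) := hG.contDiffAt
  refine (hcd.contDiffAt_implicitFunction (by simp) hinv).congr_of_eventuallyEq ?_
  have hopen : ∀ᶠ q : ℝ × X in 𝓝 p, |q.1| < T :=
    (isOpen_lt (continuous_abs.comp continuous_fst) continuous_const).mem_nhds hp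
  filter_upwards [hopen, hcd.eventually_apply_implicitFunction (by simp) hinv] with q hq hq'
  rw [hGu, sub_eq_zero] at hq'
  exact (contractingWith_transportOp hc hf.continuous hV₀.continuous hL
    (hlt q hq)).fixedPoint_unique' (hW q hq) hq'.symm

/-- The subcone with apex `κ`, scaled to the unit cone. -/
def subcone (κ κ' : unitCone X) : unitCone X :=
  ⟨(κ.1.1 * κ'.1.1, κ.1.2 + κ.1.1 • κ'.1.2), by
    obtain ⟨⟨s, σ⟩, h0, h1, h2⟩ := κ
    obtain ⟨⟨s', σ'⟩, h0', h1', h2'⟩ := κ'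
    simp only at h0 h1 h2 h0' h1' h2'
    refine ⟨mul_nonneg h0 h0', mul_le_one₀ h1 h0' h1', (norm_add_le _ _).trans ?_⟩
    simp only
    rw [norm_smul, Real.norm_of_nonneg h0]
    nlinarith⟩

theorem continuous_subcone (κ : unitCone X) : Continuous (subcone κ) := by
  refine Continuous.subtype_mk ?_ _
  fun_prop

/-- Self-similarity: rescaling to a subcone carries characteristic segments to characteristic
segments. -/
theorem subcone_coneSegment (κ κ' : unitCone X) (i : ι) (θ : ℝ) :
    subcone κ (coneSegment (hc i) κ' θ) = coneSegment (hc i) (subcone κ κ') θ := by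
  refine Subtype.ext (Prod.ext ?_ ?_)
  · simp [subcone, coneSegment, mul_assoc]
  · simp only [subcone, coneSegment, smul_sub, smul_smul, add_sub_assoc, mul_assoc]

/-- Semilinear transport systems `(∂_t + c_i · ∂_x) V_i = f_i(V)` with smooth initial values and
a smooth Lipschitz nonlinearity have smooth solutions on slabs `|t| < T`, `T Lip(f) < 1`. -/
theorem exists_transport_solution [CompleteSpace F] (hc : ∀ i, ‖c i‖ ≤ 1) (hf : ContDiff ℝ ∞ f)
    (hV₀ : ContDiff ℝ ∞ V₀) {L : ℝ≥0} (hL : LipschitzWith L f) {T : ℝ} (hT : T * L < 1) :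
    ∃ V : ℝ × X → ι → F, ContDiffOn ℝ ∞ V {p | |p.1| < T} ∧ (∀ x, 0 < T → V (0, x) = V₀ x) ∧
      ∀ t x, |t| < T → ∀ i, HasDerivAt (fun r : ℝ => V (t + r, x + r • c i) i)
        (f (V (t, x)) i) 0 := by
  have hlt : ∀ q : ℝ × X, |q.1| < T → |q.1| * L < 1 := fun q hq =>
    (mul_le_mul_of_nonneg_right hq.le L.2).trans_lt hT
  have hopen : IsOpen {p : ℝ × X | |p.1| < T} :=
    isOpen_lt (continuous_abs.comp continuous_fst) continuous_const
  classical
  -- `W p` is the solution on the cone with apex `p`, seen on the unit cone. Off the slab the value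
  -- `0` is a dummy.
  let W : ℝ × X → C(unitCone X, ι → F) := fun p =>
    if h : |p.1| < T then (contractingWith_transportOp hc hf.continuous hV₀.continuous hL
      (hlt p h)).fixedPoint _ else 0
  have hW : ∀ p, |p.1| < T → transportOp hc hf.continuous hV₀.continuous p (W p) = W p := by
    intro p hp
    simp only [W, dif_pos hp]
    exact (contractingWith_transportOp hc hf.continuous hV₀.continuous hL
      (hlt p hp)).fixedPoint_isFixedPt
  let V : ℝ × X → ι → F := fun p => W p (coneApex X)
  -- `W p` restricted to a subcone and rescaled solves the fixed point equation for the apex of the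
  -- subcone. By uniqueness the separately constructed functions are all restrictions of the single
  -- function `V`.
  have hVW : ∀ p : ℝ × X, |p.1| < T → ∀ κ : unitCone X,
      W p κ = V (p.1 * κ.1.1, p.2 + p.1 • κ.1.2) := by
    intro p hp κ
    have hq : |p.1 * κ.1.1| < T := by
      rw [abs_mul, abs_of_nonneg κ.2.1]
      exact (mul_le_of_le_one_right (abs_nonneg _) κ.2.2.1).trans_lt hp
    set q : ℝ × X := (p.1 * κ.1.1, p.2 + p.1 • κ.1.2) with hqdef
    let w' : C(unitCone X, ι → F) := (W p).comp ⟨subcone κ, continuous_subcone κ⟩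
    have hw' : transportOp hc hf.continuous hV₀.continuous q w' = w' := by
      ext κ' i
      have h1 := congrArg (fun w : C(unitCone X, ι → F) => w (subcone κ κ') i) (hW p hp)
      refine Eq.trans ?_ h1
      simp only [transportOp, ContinuousMap.add_apply, ContinuousMap.smul_apply, Pi.add_apply,
        Pi.smul_apply, coneIntegral_apply]
      congr 1
      · simp only [coneData, coneShift, ContinuousMap.coe_mk, hqdef, subcone]
        refine congrFun (congrArg V₀ ?_) i
        module
      · simp only [hqdef, subcone, smul_smul, superpose_apply]
        congr 1
        · ring
        · refine intervalIntegral.integral_congr fun θ _ => ?_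
          simp only [w', ContinuousMap.comp_apply, ContinuousMap.coe_mk]
          rw [subcone_coneSegment hc κ κ' i θ]
          rfl
    have h2 : w' = W q := (contractingWith_transportOp hc hf.continuous hV₀.continuous hL
      (hlt q hq)).fixedPoint_unique' hw' (hW q hq)
    have h3 := congrArg (fun w : C(unitCone X, ι → F) => w (coneApex X)) h2
    refine Eq.trans ?_ h3
    simp only [w', ContinuousMap.comp_apply, ContinuousMap.coe_mk]
    congr 1
    refine Subtype.ext (Prod.ext ?_ ?_) <;> simp [subcone, coneApex]
  have hVs : ContDiffOn ℝ ∞ V {p | |p.1| < T} := by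
    intro p hp
    have h1 := contDiffAt_of_transportOp_fixed.{u, v, w} hc hf hV₀ hL hT hW hp
    exact ((ContinuousMap.evalCLM ℝ (coneApex X) : C(unitCone X, ι → F) →L[ℝ] (ι → F)).contDiff.contDiffAt.comp
      p h1).contDiffWithinAt
  -- At the apex, after the substitution `r = τ * θ`, the fixed point equation is the integral
  -- equation along a characteristic.
  have hint : ∀ τ x₀ i, |τ| < T → V (τ, x₀ + τ • c i) i =
      V₀ x₀ i + ∫ r in (0 : ℝ)..τ, f (V (r, x₀ + r • c i)) i := by
    intro τ x₀ i hτ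
    have h1 := congrArg (fun w : C(unitCone X, ι → F) => w (coneApex X) i)
      (hW (τ, x₀ + τ • c i) hτ)
    refine h1.symm.trans ?_
    simp only [transportOp, ContinuousMap.add_apply, ContinuousMap.smul_apply, Pi.add_apply,
        Pi.smul_apply, coneIntegral_apply]
    congr 1
    · simp [coneData, coneShift, coneApex]
    · have h2 := intervalIntegral.smul_integral_comp_mul_left (a := 0) (b := 1)
        (fun r : ℝ => f (V (r, x₀ + r • c i)) i) τ
      rw [mul_zero, mul_one] at h2
      rw [← h2]
      simp only [coneApex, one_smul]
      congr 1
      refine intervalIntegral.integral_congr fun θ hθ => ?_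
      rw [uIcc_of_le zero_le_one] at hθ
      simp only [superpose_apply]
      rw [hVW _ hτ]
      simp only [coneSegment, projIcc_of_mem zero_le_one hθ, one_mul, zero_sub]
      have hx : x₀ + τ • c i + τ • -((1 - θ) • c i) = x₀ + (τ * θ) • c i := by module
      rw [hx]
  refine ⟨V, hVs, ?_, ?_⟩
  · intro x hT0
    ext i
    have := hint 0 x i (by simpa using hT0)
    simpa using this
  · intro t x ht i
    have hcont : ContinuousOn (fun r : ℝ => f (V (r, (x - t • c i) + r • c i)) i) (Ioo (-T) T) := by
      refine (continuous_apply i).comp_continuousOn (hf.continuous.comp_continuousOn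
        (hVs.continuousOn.comp (by fun_prop) ?_))
      intro r hr
      exact abs_lt.2 hr
    have htI : t ∈ Ioo (-T) T := abs_lt.1 ht
    have hT0 : 0 < T := (abs_nonneg t).trans_lt ht
    have h1 : HasDerivAt (fun τ => ∫ r in (0 : ℝ)..τ, f (V (r, (x - t • c i) + r • c i)) i)
        (f (V (t, (x - t • c i) + t • c i)) i) t := by
      refine intervalIntegral.integral_hasDerivAt_right ?_
        (hcont.stronglyMeasurableAtFilter isOpen_Ioo t htI) (hcont.continuousAt (isOpen_Ioo.mem_nhds htI))
      refine ContinuousOn.intervalIntegrable (hcont.mono ?_)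
      exact (convex_Ioo (-T) T).ordConnected.uIcc_subset ⟨by linarith, hT0⟩ htI
    rw [sub_add_cancel] at h1
    have h2 : HasDerivAt (fun τ => V (τ, (x - t • c i) + τ • c i) i) (f (V (t, x)) i) t := by
      refine (h1.const_add (V₀ (x - t • c i) i)).congr_of_eventuallyEq ?_
      filter_upwards [isOpen_Ioo.mem_nhds htI] with τ hτ
      exact hint τ _ i (abs_lt.2 hτ)
    have h3 : HasDerivAt (fun r : ℝ => t + r) 1 0 := (hasDerivAt_id (0 : ℝ)).const_add t
    have h4 := HasDerivAt.scomp (0 : ℝ) (h := fun r : ℝ => t + r) (by simpa using h2) h3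
    rw [one_smul] at h4
    refine h4.congr_of_eventuallyEq (Eventually.of_forall fun r => ?_)
    simp only [Function.comp_apply]
    have hx : x + r • c i = x - t • c i + (t + r) • c i := by module
    rw [hx]

end TransportSolution

/-! ### Smooth cutoff. -/

section Cutoff

variable {W : Type*} [NormedAddCommGroup W] [NormedSpace ℝ W] [FiniteDimensional ℝ W]
  {W' : Type*} [NormedAddCommGroup W'] [NormedSpace ℝ W']

/-- Multiplication by a bump function. It replaces a nonlinearity by a globally Lipschitz one, and
data on an interval by data on the whole line. -/
theorem exists_contDiff_eventuallyEq_nhdsSet {U K : Set W} (hU : IsOpen U) (hK : IsCompact K)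
    (hKU : K ⊆ U) {f : W → W'} (hf : ContDiffOn ℝ ∞ f U) :
    ∃ f' : W → W', ContDiff ℝ ∞ f' ∧ HasCompactSupport f' ∧ f' =ᶠ[𝓝ˢ K] f := by
  have : ProperSpace W := FiniteDimensional.proper ℝ W
  obtain ⟨T, hT, hKT, hTU⟩ := exists_compact_between hK hU hKU
  obtain ⟨χ, h1, h0, -⟩ := exists_contMDiffMap_one_nhds_of_subset_interior (n := (⊤ : ℕ∞)) 𝓘(ℝ, W)
    hK.isClosed hKT
  have hχ : ContDiff ℝ ∞ χ := contMDiff_iff_contDiff.1 χ.contMDiff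
  refine ⟨fun x => χ x • f x, ?_, ?_, ?_⟩
  · rw [contDiff_iff_contDiffAt]
    intro x
    by_cases hx : x ∈ U
    · exact hχ.contDiffAt.smul (hf.contDiffAt (hU.mem_nhds hx))
    · have : (fun x => χ x • f x) =ᶠ[𝓝 x] fun _ => 0 := by
        filter_upwards [hT.isClosed.isOpen_compl.mem_nhds (fun h => hx (hTU h))] with y hy
        rw [h0 y hy, zero_smul]
      exact contDiffAt_const.congr_of_eventuallyEq this
  · exact HasCompactSupport.intro hT fun x hx => by rw [h0 x hx, zero_smul]
  · filter_upwards [h1] with x hx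
    rw [hx, one_smul]

end Cutoff

/-! ### The wave map equation as a first-order system. -/

section CoordinateCauchyProblem

/-- The open diamond of radius `ρ` around `(t₀, x₀)`. -/
def diamond (t₀ x₀ ρ : ℝ) : Set (ℝ × ℝ) := {p | |p.1 - t₀| + |p.2 - x₀| < ρ}

theorem isOpen_diamond (t₀ x₀ ρ : ℝ) : IsOpen (diamond t₀ x₀ ρ) :=
  isOpen_lt (by fun_prop) continuous_const

universe u

variable {E : Type u} [NormedAddCommGroup E] [NormedSpace ℝ E] [FiniteDimensional ℝ E]

/-- The nonlinearity of the first-order form `V = (y, ∂_ξ y, ∂_η y)` of the wave map equation. -/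
def waveNonlinearity (Γ : E → E →L[ℝ] E →L[ℝ] E) (V : Fin 3 → E) : Fin 3 → E :=
  ![(1 / 2 : ℝ) • (V 1 + V 2), -Γ (V 0) (V 1) (V 2), -Γ (V 0) (V 1) (V 2)]

theorem contDiffOn_waveNonlinearity {Γ : E → E →L[ℝ] E →L[ℝ] E} {O : Set E}
    (hΓ : ContDiffOn ℝ ∞ Γ O) : ContDiffOn ℝ ∞ (waveNonlinearity Γ) {V | V 0 ∈ O} := by
  have h0 : ∀ i, ContDiffOn ℝ ∞ (fun V : Fin 3 → E => V i) {V | V 0 ∈ O} := fun i =>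
    (contDiff_apply ℝ E i).contDiffOn
  have h1 : ContDiffOn ℝ ∞ (fun V : Fin 3 → E => -Γ (V 0) (V 1) (V 2)) {V | V 0 ∈ O} :=
    (((hΓ.comp (h0 0) (fun V hV => hV)).clm_apply (h0 1)).clm_apply (h0 2)).neg
  rw [contDiffOn_pi]
  intro i
  fin_cases i
  · exact (((h0 1).add (h0 2)).const_smul (1 / 2 : ℝ))
  · exact h1
  · exact h1

/-- The characteristic speeds of `(y, ∂_ξ y, ∂_η y)`. -/
def waveSpeed : Fin 3 → ℝ := ![0, -1, 1]

theorem norm_waveSpeed_le (i : Fin 3) : ‖waveSpeed i‖ ≤ 1 := by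
  fin_cases i <;> simp [waveSpeed]

/-- The system alone does not say that `V 1` and `V 2` are derivatives of `V 0`. The defect `Z = ∂_x
y - (V 1 - V 2) / 2` has zero time derivative because the components `1` and `2` have the same
right-hand side, and it vanishes on the axis by the choice of data. -/
theorem wave_first_order {Γ : E → E →L[ℝ] E →L[ℝ] E} {S : Set (ℝ × ℝ)} {x₀ ρ : ℝ}
    {V : ℝ × ℝ → Fin 3 → E} (hS : IsOpen S)
    (hV : ContDiffOn ℝ ∞ V S) (hDS : diamond 0 x₀ ρ ⊆ S)
    (hdV : ∀ p ∈ diamond 0 x₀ ρ, ∀ i, HasDerivAt (fun r : ℝ => V (p.1 + r, p.2 + r • waveSpeed i) i)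
        (waveNonlinearity Γ (V p) i) 0)
    {κ₀ κ₁ : ℝ → E} (hV0 : ∀ x, |x - x₀| < ρ → V (0, x) = ![κ₀ x, κ₁ x + deriv κ₀ x, κ₁ x - deriv κ₀ x])
    {p : ℝ × ℝ} (hp : p ∈ diamond 0 x₀ ρ) :
    fderiv ℝ (fun q => V q 0) p (1, 1) = V p 1 ∧ fderiv ℝ (fun q => V q 0) p (1, -1) = V p 2 ∧
    fderiv ℝ (fderiv ℝ (fun q => V q 0)) p (1, 1) (1, -1) = - Γ (V p 0) (V p 1) (V p 2) := by
  have hDo := isOpen_diamond 0 x₀ ρ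
  have hVi : ∀ i, ∀ q ∈ S, ContDiffAt ℝ ∞ (fun q => V q i) q := fun i q hq =>
    contDiffAt_pi.1 (hV.contDiffAt (hS.mem_nhds hq)) i
  have hdi : ∀ i, ∀ q ∈ S, DifferentiableAt ℝ (fun q => V q i) q := fun i q hq =>
    (hVi i q hq).differentiableAt (by simp)
  have key : ∀ q ∈ diamond 0 x₀ ρ, ∀ i, fderiv ℝ (fun q => V q i) q (1, waveSpeed i) =
      waveNonlinearity Γ (V q) i := by
    intro q hq i
    have h1 : HasDerivAt (fun r : ℝ => ((q.1 + r, q.2 + r • waveSpeed i) : ℝ × ℝ))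
        (1, waveSpeed i) 0 := by
      refine ((hasDerivAt_id (0 : ℝ)).const_add q.1).prodMk ?_
      simpa using ((hasDerivAt_id (0 : ℝ)).smul_const (waveSpeed i)).const_add q.2
    have h2 : HasFDerivAt (fun q => V q i) (fderiv ℝ (fun q => V q i) q)
        ((fun r : ℝ => ((q.1 + r, q.2 + r • waveSpeed i) : ℝ × ℝ)) 0) := by
      simpa using (hdi i q (hDS hq)).hasFDerivAt
    have h3 := h2.comp_hasDerivAt (0 : ℝ) h1
    exact h3.unique (hdV q hq i)
  have hy : ∀ q ∈ diamond 0 x₀ ρ, fderiv ℝ (fun q => V q 0) q (1, 0) =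
      (1 / 2 : ℝ) • (V q 1 + V q 2) := fun q hq => key q hq 0
  have hA : ∀ q ∈ diamond 0 x₀ ρ, fderiv ℝ (fun q => V q 1) q (1, -1) =
      - Γ (V q 0) (V q 1) (V q 2) := fun q hq => key q hq 1
  have hB : ∀ q ∈ diamond 0 x₀ ρ, fderiv ℝ (fun q => V q 2) q (1, 1) =
      - Γ (V q 0) (V q 1) (V q 2) := fun q hq => key q hq 2
  have hyd : ∀ q ∈ S, DifferentiableAt ℝ (fderiv ℝ (fun q => V q 0)) q := fun q hq =>
    ((hVi 0 q hq).fderiv_right (m := ∞) (by simp)).differentiableAt (by simp)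
  have split : ∀ (L : ℝ × ℝ →L[ℝ] E) (a b : ℝ), L (a, b) = a • L (1, 0) + b • L (0, 1) := by
    intro L a b
    rw [← map_smul, ← map_smul, ← map_add]; simp
  let Z : ℝ × ℝ → E := fun q => fderiv ℝ (fun q => V q 0) q (0, 1) - (1 / 2 : ℝ) • (V q 1 - V q 2)
  have hZd : ∀ q ∈ diamond 0 x₀ ρ, HasFDerivAt Z
      ((fderiv ℝ (fderiv ℝ (fun q => V q 0)) q).flip (0, 1) -
        (1 / 2 : ℝ) • (fderiv ℝ (fun q => V q 1) q - fderiv ℝ (fun q => V q 2) q)) q := by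
    intro q hq
    refine HasFDerivAt.sub ?_ ((((hdi 1 q (hDS hq)).hasFDerivAt).sub
      ((hdi 2 q (hDS hq)).hasFDerivAt)).const_smul _)
    have := (hyd q (hDS hq)).hasFDerivAt.clm_apply (hasFDerivAt_const ((0, 1) : ℝ × ℝ) q)
    simpa using this
  have hZ1 : ∀ q ∈ diamond 0 x₀ ρ, ((fderiv ℝ (fderiv ℝ (fun q => V q 0)) q).flip (0, 1) -
        (1 / 2 : ℝ) • (fderiv ℝ (fun q => V q 1) q - fderiv ℝ (fun q => V q 2) q)) (1, 0) = 0 := by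
    intro q hq
    have h1 : fderiv ℝ (fderiv ℝ (fun q => V q 0)) q (0, 1) (1, 0) =
        (1 / 2 : ℝ) • (fderiv ℝ (fun q => V q 1) q (0, 1) + fderiv ℝ (fun q => V q 2) q (0, 1)) := by
      have h2 := (hyd q (hDS hq)).hasFDerivAt.clm_apply (hasFDerivAt_const ((1, 0) : ℝ × ℝ) q)
      have h3 : HasFDerivAt (fun q => (1 / 2 : ℝ) • (V q 1 + V q 2)) _ q :=
        ((((hdi 1 q (hDS hq)).hasFDerivAt).add ((hdi 2 q (hDS hq)).hasFDerivAt)).const_smul (1 / 2 : ℝ))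
      have h4 := h2.unique (h3.congr_of_eventuallyEq (by
        filter_upwards [hDo.mem_nhds hq] with q' hq' using hy q' hq'))
      have h5 := congrArg (fun L : ℝ × ℝ →L[ℝ] E => L (0, 1)) h4
      simpa using h5
    have h6 : ContDiffAt ℝ 2 (fun q => V q 0) q := (hVi 0 q (hDS hq)).of_le ENat.LEInfty.out
    have h7 := hA q hq
    have h8 := hB q hq
    rw [split] at h7 h8
    simp only [sub_apply, smul_apply, ContinuousLinearMap.flip_apply]
    rw [fderiv_fderiv_symm h6 (1, 0) (0, 1), h1, ← smul_sub]
    have h9 : fderiv ℝ (fun q => V q 1) q (0, 1) + fderiv ℝ (fun q => V q 2) q (0, 1) -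
        (fderiv ℝ (fun q => V q 1) q (1, 0) - fderiv ℝ (fun q => V q 2) q (1, 0)) = 0 := by
      have h10 := h8.trans h7.symm
      rw [← sub_eq_zero] at h10
      rw [← h10]
      module
    rw [h9, smul_zero]
  have hZ0 : ∀ q ∈ diamond 0 x₀ ρ, Z q = 0 := by
    rintro ⟨t, x⟩ hq
    have hx : |x - x₀| < ρ := by
      have := abs_nonneg (t - 0); simp only [diamond, mem_ofPred_eq] at hq; linarith
    have hmem : ∀ s ∈ uIcc 0 t, ((s, x) : ℝ × ℝ) ∈ diamond 0 x₀ ρ := by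
      intro s hs
      simp only [diamond, mem_ofPred_eq, sub_zero] at hq ⊢
      have : |s| ≤ |t| := by simpa using abs_sub_left_of_mem_uIcc hs
      linarith
    have hderiv : ∀ s ∈ uIcc 0 t, HasDerivAt (fun s => Z (s, x)) 0 s := by
      intro s hs
      have h1 : HasDerivAt (fun s : ℝ => ((s, x) : ℝ × ℝ)) (1, 0) s :=
        (hasDerivAt_id s).prodMk (hasDerivAt_const s x)
      have h2 := (hZd (s, x) (hmem s hs)).comp_hasDerivAt s h1
      rw [hZ1 _ (hmem s hs)] at h2
      exact h2
    have hconst : Z (t, x) = Z (0, x) := by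
      have := (convex_uIcc 0 t).norm_image_sub_le_of_norm_hasDerivWithin_le (f := fun s => Z (s, x))
        (f' := fun _ => 0) (C := 0) (fun s hs => (hderiv s hs).hasDerivWithinAt) (by simp)
        left_mem_uIcc right_mem_uIcc
      rw [zero_mul, norm_le_zero_iff, sub_eq_zero] at this
      exact this
    rw [hconst]
    have h0 : ((0, x) : ℝ × ℝ) ∈ diamond 0 x₀ ρ := hmem 0 left_mem_uIcc
    have h1 : HasDerivAt (fun x : ℝ => ((0, x) : ℝ × ℝ)) (0, 1) x :=
      (hasDerivAt_const x 0).prodMk (hasDerivAt_id x)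
    have h2 := ((hdi 0 (0, x) (hDS h0)).hasFDerivAt.comp_hasDerivAt x h1).deriv
    have h3 : deriv ((fun q => V q 0) ∘ fun x : ℝ => ((0, x) : ℝ × ℝ)) x = deriv κ₀ x := by
      refine Filter.EventuallyEq.deriv_eq ?_
      have : ∀ᶠ x' in 𝓝 x, |x' - x₀| < ρ :=
        (isOpen_lt (by fun_prop) continuous_const : IsOpen {x' : ℝ | |x' - x₀| < ρ}).mem_nhds hx
      filter_upwards [this] with x' hx'
      simp [hV0 x' hx']
    simp only [Z]
    rw [← h2, h3, hV0 x hx]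
    simp only [Matrix.cons_val_one, Matrix.cons_val_zero, Matrix.cons_val]
    module
  have hyx : ∀ q ∈ diamond 0 x₀ ρ, fderiv ℝ (fun q => V q 0) q (0, 1) =
      (1 / 2 : ℝ) • (V q 1 - V q 2) := fun q hq => sub_eq_zero.1 (hZ0 q hq)
  have hη : ∀ q ∈ diamond 0 x₀ ρ, fderiv ℝ (fun q => V q 0) q (1, -1) = V q 2 := by
    intro q hq
    rw [split, hy q hq, hyx q hq]; module
  refine ⟨?_, hη p hp, ?_⟩
  · rw [split, hy p hp, hyx p hp]; module
  · have h2 := (hyd p (hDS hp)).hasFDerivAt.clm_apply (hasFDerivAt_const ((1, -1) : ℝ × ℝ) p)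
    have h4 := h2.unique ((hdi 2 p (hDS hp)).hasFDerivAt.congr_of_eventuallyEq (by
        filter_upwards [hDo.mem_nhds hp] with q' hq' using hη q' hq'))
    have h5 := congrArg (fun L : ℝ × ℝ →L[ℝ] E => L (1, 1)) h4
    rw [← hB p hp]
    simpa using h5

end CoordinateCauchyProblem

/-! ### Transport systems with a nonlinearity defined on an open set only. -/

section LocalTransport

universe u v w

variable {X : Type u} [NormedAddCommGroup X] [NormedSpace ℝ X] [FiniteDimensional ℝ X]
  {ι : Type w} [Fintype ι] {F : Type (max u v)} [NormedAddCommGroup F] [NormedSpace ℝ F]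
  [FiniteDimensional ℝ F]

/-- Local solutions of semilinear transport systems, with an existence time that depends only on
a compact set containing the initial values. -/
theorem exists_local_transport_solution {c : ι → X} (hc : ∀ i, ‖c i‖ ≤ 1)
    {f : (ι → F) → ι → F} {U : Set (ι → F)} (hU : IsOpen U) (hf : ContDiffOn ℝ ∞ f U)
    {K : ι → Set F} (hK : ∀ i, IsCompact (K i)) (hKU : univ.pi K ⊆ U) :
    ∃ ε > 0, ∀ V₀ : X → ι → F, ContDiff ℝ ∞ V₀ → ∃ V : ℝ × X → ι → F,
      ContDiffOn ℝ ∞ V {p | |p.1| < ε} ∧ (∀ x, V (0, x) = V₀ x) ∧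
      ∀ t x, |t| < ε → (∀ i, V₀ (x - t • c i) i ∈ K i) → V (t, x) ∈ U ∧
        ∀ i, HasDerivAt (fun r : ℝ => V (t + r, x + r • c i) i) (f (V (t, x)) i) 0 := by
  have : ProperSpace F := FiniteDimensional.proper ℝ F
  have : CompleteSpace F := FiniteDimensional.complete ℝ F
  have hKc : IsCompact (univ.pi K) := isCompact_univ_pi hK
  obtain ⟨η, hη, hηU⟩ := hKc.exists_cthickening_subset_open hU hKU
  obtain ⟨f', hf', hsupp, heq⟩ := exists_contDiff_eventuallyEq_nhdsSet hU
    (hKc.cthickening (r := η)) hηU hf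
  obtain ⟨L, hL⟩ := hf'.lipschitzWith_of_hasCompactSupport hsupp (by simp)
  obtain ⟨N, hN⟩ := hsupp.exists_bound_of_continuous hf'.continuous
  have hN0 : 0 ≤ N := (norm_nonneg _).trans (hN 0)
  -- `ε * L < 1` gives the contraction. `ε * N < η` keeps every component within `η` of its value at
  -- the foot of its characteristic, where the cut-off nonlinearity is the original one.
  obtain ⟨ε, hε, hεL, hεN⟩ : ∃ ε : ℝ, 0 < ε ∧ ε * L < 1 ∧ ε * N < η := by
    refine ⟨min (1 / (2 * (L + 1))) (η / (2 * (N + 1))), by positivity, ?_, ?_⟩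
    · refine (mul_le_mul_of_nonneg_right (min_le_left _ _) L.coe_nonneg).trans_lt ?_
      rw [div_mul_eq_mul_div, div_lt_one (by positivity)]
      have := L.coe_nonneg; nlinarith
    · refine (mul_le_mul_of_nonneg_right (min_le_right _ _) hN0).trans_lt ?_
      rw [div_mul_eq_mul_div, div_lt_iff₀ (by positivity)]
      nlinarith
  refine ⟨ε, hε, fun V₀ hV₀ => ?_⟩
  obtain ⟨V, hV, hV0, hdV⟩ := exists_transport_solution.{u, v, w} hc hf' hV₀ hL hεL
  refine ⟨V, hV, fun x => hV0 x hε, fun t x ht hx => ?_⟩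
  have hclose : ∀ i, ‖V (t, x) i - V₀ (x - t • c i) i‖ ≤ η := by
    intro i
    have hder : ∀ s ∈ uIcc 0 t, HasDerivAt (fun s : ℝ => V (s, (x - t • c i) + s • c i) i)
        (f' (V (s, (x - t • c i) + s • c i)) i) s := by
      intro s hs
      have hs' : |s| < ε := lt_of_le_of_lt (by simpa using abs_sub_left_of_mem_uIcc hs) ht
      have h1 := hdV s ((x - t • c i) + s • c i) hs' i
      have h2 : HasDerivAt (fun r : ℝ => r - s) 1 s := (hasDerivAt_id s).sub_const s
      have h3 := HasDerivAt.scomp s (h := fun r : ℝ => r - s) (by simpa using h1) h2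
      rw [one_smul] at h3
      refine h3.congr_of_eventuallyEq (Eventually.of_forall fun r => ?_)
      simp only [Function.comp_apply]
      have e1 : s + (r - s) = r := by ring
      have e2 : x - t • c i + s • c i + (r - s) • c i = x - t • c i + r • c i := by module
      rw [e1, e2]
    have h4 := (convex_uIcc 0 t).norm_image_sub_le_of_norm_hasDerivWithin_le
      (f := fun s : ℝ => V (s, (x - t • c i) + s • c i) i)
      (fun s hs => (hder s hs).hasDerivWithinAt)
      (fun s _ => (norm_le_pi_norm _ i).trans (hN _)) left_mem_uIcc right_mem_uIcc
    simp only [sub_add_cancel, zero_smul, add_zero, sub_zero, hV0 _ hε] at h4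
    refine h4.trans ?_
    rw [mul_comm, Real.norm_eq_abs]
    exact (mul_le_mul_of_nonneg_right ht.le hN0).trans hεN.le
  have hmem : V (t, x) ∈ Metric.cthickening η (univ.pi K) := by
    refine Metric.mem_cthickening_of_dist_le _ (fun i => V₀ (x - t • c i) i) _ _ (fun i _ => hx i) ?_
    rw [dist_pi_le_iff hη.le]
    intro i
    rw [dist_eq_norm]
    exact hclose i
  refine ⟨hηU hmem, fun i => ?_⟩
  rw [← (heq.filter_mono (nhds_le_nhdsSet hmem)).self_of_nhds]
  exact hdV t x ht i

end LocalTransport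

/-! ### Local existence in coordinates. -/

section CoordinateCauchyProblem

universe u

variable {E : Type u} [NormedAddCommGroup E] [NormedSpace ℝ E] [FiniteDimensional ℝ E]

/-- Local existence for the wave map equation in coordinates: the size of the domain depends only
on bounds for the first derivatives of the data. -/
theorem exists_coordinate_wave {Γ : E → E →L[ℝ] E →L[ℝ] E} {O : Set E} (hO : IsOpen O)
    (hΓ : ContDiffOn ℝ ∞ Γ O) {z₀ : E} (hz₀ : z₀ ∈ O) {C : ℝ} (hC : 0 ≤ C) :
    ∃ r > 0, ∃ ε > 0, ∀ (x₀ ρ : ℝ) (κ₀ κ₁ : ℝ → E) (J : Set ℝ), ρ ≤ ε → IsOpen J →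
      Icc (x₀ - ρ) (x₀ + ρ) ⊆ J → ContDiffOn ℝ ∞ κ₀ J → ContDiffOn ℝ ∞ κ₁ J →
      ‖κ₀ x₀ - z₀‖ < r → (∀ x ∈ Icc (x₀ - ρ) (x₀ + ρ), ‖deriv κ₀ x‖ ≤ C ∧ ‖κ₁ x‖ ≤ C) →
      ∃ y : ℝ × ℝ → E, ContDiffOn ℝ ∞ y (diamond 0 x₀ ρ) ∧ (∀ p ∈ diamond 0 x₀ ρ, y p ∈ O) ∧
        (∀ p ∈ diamond 0 x₀ ρ, fderiv ℝ (fderiv ℝ y) p (1, 1) (1, -1) +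
          Γ (y p) (fderiv ℝ y p (1, 1)) (fderiv ℝ y p (1, -1)) = 0) ∧
        ∀ x, |x - x₀| < ρ → y (0, x) = κ₀ x ∧ fderiv ℝ y (0, x) (1, 0) = κ₁ x := by
  have : ProperSpace E := FiniteDimensional.proper ℝ E
  obtain ⟨r, hr, hrO⟩ := Metric.isOpen_iff.1 hO z₀ hz₀
  let K : Fin 3 → Set E := ![Metric.closedBall z₀ (r / 2), Metric.closedBall 0 (2 * C),
    Metric.closedBall 0 (2 * C)]
  have hK : ∀ i, IsCompact (K i) := by
    intro i
    fin_cases i <;> exact isCompact_closedBall _ _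
  have hU : IsOpen {V : Fin 3 → E | V 0 ∈ O} := hO.preimage (continuous_apply 0)
  have hKU : univ.pi K ⊆ {V : Fin 3 → E | V 0 ∈ O} := fun V hV =>
    hrO (Metric.closedBall_subset_ball (by linarith) (hV 0 (mem_univ _)))
  obtain ⟨ε, hε, hsol⟩ := exists_local_transport_solution.{0, u, 0} norm_waveSpeed_le hU
    (contDiffOn_waveNonlinearity hΓ) hK hKU
  -- `κ₀` starts within `r / 4` of `z₀` and moves by at most `C * ρ ≤ r / 4`, so it stays in the
  -- closed ball of radius `r / 2`.
  refine ⟨r / 4, by positivity, min ε (r / (4 * (C + 1))), by positivity, ?_⟩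
  intro x₀ ρ κ₀ κ₁ J hρ hJ hIJ hκ₀ hκ₁ hκz hκC
  have hρε : ρ ≤ ε := hρ.trans (min_le_left _ _)
  have hdκ : ContDiffOn ℝ ∞ (deriv κ₀) J := hκ₀.deriv_of_isOpen hJ (by simp)
  have hdata : ContDiffOn ℝ ∞ (fun x => ![κ₀ x, κ₁ x + deriv κ₀ x, κ₁ x - deriv κ₀ x]) J := by
    rw [contDiffOn_pi]
    intro i
    fin_cases i
    exacts [hκ₀, hκ₁.add hdκ, hκ₁.sub hdκ]
  -- The characteristics through the diamond meet the axis inside the interval, so the data may be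
  -- altered outside of it.
  obtain ⟨V₀, hV₀, -, hVeq⟩ := exists_contDiff_eventuallyEq_nhdsSet hJ isCompact_Icc hIJ hdata
  have hVeq' : ∀ x ∈ Icc (x₀ - ρ) (x₀ + ρ),
      V₀ x = ![κ₀ x, κ₁ x + deriv κ₀ x, κ₁ x - deriv κ₀ x] := fun x hx =>
    (hVeq.filter_mono (nhds_le_nhdsSet hx)).self_of_nhds
  obtain ⟨V, hV, hV0, hdV⟩ := hsol V₀ hV₀
  have hDS : diamond 0 x₀ ρ ⊆ {p : ℝ × ℝ | |p.1| < ε} := by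
    intro p hp
    simp only [diamond, mem_ofPred_eq, sub_zero] at hp ⊢
    have := abs_nonneg (p.2 - x₀)
    linarith
  have hS : IsOpen {p : ℝ × ℝ | |p.1| < ε} := isOpen_lt (by fun_prop) continuous_const
  have hV0' : ∀ x, |x - x₀| < ρ → V (0, x) = ![κ₀ x, κ₁ x + deriv κ₀ x, κ₁ x - deriv κ₀ x] := by
    intro x hx
    rw [hV0, hVeq']
    rw [abs_lt] at hx
    constructor <;> linarith
  have hKmem : ∀ x ∈ Icc (x₀ - ρ) (x₀ + ρ), ∀ i, V₀ x i ∈ K i := by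
    intro x hx i
    rw [hVeq' x hx]
    have hρ0 : 0 ≤ ρ := by linarith [hx.1, hx.2]
    obtain ⟨h1, h2⟩ := hκC x hx
    fin_cases i
    · have hdiff : ∀ x ∈ Icc (x₀ - ρ) (x₀ + ρ), HasDerivWithinAt κ₀ (deriv κ₀ x)
          (Icc (x₀ - ρ) (x₀ + ρ)) x := fun x hx =>
        (((hκ₀.contDiffAt (hJ.mem_nhds (hIJ hx))).differentiableAt
          (by simp)).hasDerivAt).hasDerivWithinAt
      have h3 := (convex_Icc (x₀ - ρ) (x₀ + ρ)).norm_image_sub_le_of_norm_hasDerivWithin_le hdiff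
        (fun x hx => (hκC x hx).1) (x := x₀) (y := x) ⟨by linarith, by linarith⟩ hx
      have h4 : ‖x - x₀‖ ≤ ρ := by
        rw [Real.norm_eq_abs, abs_le]; constructor <;> linarith [hx.1, hx.2]
      have h5 : C * ρ ≤ r / 4 := by
        have h6 : ρ ≤ r / (4 * (C + 1)) := hρ.trans (min_le_right _ _)
        rw [le_div_iff₀ (by positivity)] at h6
        nlinarith
      change κ₀ x ∈ Metric.closedBall z₀ (r / 2)
      rw [mem_closedBall_iff_norm]
      have h7 : κ₀ x - z₀ = (κ₀ x - κ₀ x₀) + (κ₀ x₀ - z₀) := by abel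
      rw [h7]
      have := norm_add_le (κ₀ x - κ₀ x₀) (κ₀ x₀ - z₀)
      have := mul_le_mul_of_nonneg_left h4 hC
      linarith
    · change κ₁ x + deriv κ₀ x ∈ Metric.closedBall 0 (2 * C)
      rw [mem_closedBall_zero_iff]
      have := norm_add_le (κ₁ x) (deriv κ₀ x)
      linarith
    · change κ₁ x - deriv κ₀ x ∈ Metric.closedBall 0 (2 * C)
      rw [mem_closedBall_zero_iff]
      have := norm_sub_le (κ₁ x) (deriv κ₀ x)
      linarith
  have hmem : ∀ p ∈ diamond 0 x₀ ρ, ∀ i, V₀ (p.2 - p.1 • waveSpeed i) i ∈ K i := by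
    intro p hp i
    refine hKmem _ ?_ i
    simp only [diamond, mem_ofPred_eq, sub_zero] at hp
    have h1 : |p.1 • waveSpeed i| ≤ |p.1| := by
      rw [smul_eq_mul, abs_mul]
      exact mul_le_of_le_one_right (abs_nonneg _) (norm_waveSpeed_le i)
    have h2 := abs_le.1 h1
    have h3 := neg_abs_le (p.2 - x₀)
    have h4 := le_abs_self (p.2 - x₀)
    constructor <;> linarith [h2.1, h2.2]
  have hall : ∀ p ∈ diamond 0 x₀ ρ, V p ∈ {V : Fin 3 → E | V 0 ∈ O} ∧
        ∀ i, HasDerivAt (fun r : ℝ => V (p.1 + r, p.2 + r • waveSpeed i) i)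
          (waveNonlinearity Γ (V p) i) 0 := fun p hp =>
    hdV p.1 p.2 (hDS hp) (hmem p hp)
  have hfo : ∀ {p : ℝ × ℝ}, p ∈ diamond 0 x₀ ρ → _ := fun {p} hp =>
    wave_first_order (Γ := Γ) hS hV hDS (fun p hp => (hall p hp).2) hV0' hp
  have hyV : ContDiffOn ℝ ∞ (fun q => V q 0) (diamond 0 x₀ ρ) :=
    (contDiffOn_pi.1 hV 0).mono hDS
  refine ⟨fun q => V q 0, hyV, fun p hp => (hall p hp).1, fun p hp => ?_, fun x hx => ⟨?_, ?_⟩⟩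
  · obtain ⟨h1, h2, h3⟩ := hfo hp
    rw [h1, h2, h3]
    simp
  · simp [hV0' x hx]
  · have hp : ((0 : ℝ), x) ∈ diamond 0 x₀ ρ := by simpa [diamond] using hx
    obtain ⟨h1, h2, -⟩ := hfo hp
    have h3 : ((1, 0) : ℝ × ℝ) = (1 / 2 : ℝ) • ((1, 1) + (1, -1)) := by
      ext <;> norm_num
    rw [h3, map_smul, map_add, h1, h2, hV0' x hx]
    simp only [Matrix.cons_val_one, Matrix.cons_val_zero, Matrix.cons_val]
    module

end CoordinateCauchyProblem

/-! ### The wave map equation on the manifold and its symmetries. -/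

section WaveEquation

variable {E : Type*} [NormedAddCommGroup E] [NormedSpace ℝ E] [FiniteDimensional ℝ E]
  {M : Type*} [TopologicalSpace M] [ChartedSpace E M] [IsManifold 𝓘(ℝ, E) ∞ M]
  {e e' : OpenPartialHomeomorph M E} {B : FormField E M}
  {V V' : Type*} [NormedAddCommGroup V] [NormedSpace ℝ V]
  [NormedAddCommGroup V'] [NormedSpace ℝ V']

/-- An affine map has no second derivative, so the Hessian is just pulled back. This serves for
restriction to coordinate lines, for shifts and reflections of time, and for viewing geodesics as
wave maps. -/
theorem coordHess_comp_affine {z : V → E} {ℓ : V' → V} {L : V' →L[ℝ] V} {q : V}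
    (hℓ : ∀ s, ℓ s = q + L s) {s : V'} (hz : ContDiffAt ℝ 2 z (ℓ s)) (a b : V') :
    coordHess B e (z ∘ ℓ) s a b = coordHess B e z (ℓ s) (L a) (L b) := by
  have hℓ' : ∀ s, HasFDerivAt ℓ L s := by
    intro s
    have : ℓ = fun s => q + L s := funext hℓ
    rw [this]
    exact L.hasFDerivAt.const_add q
  have hz1 : ∀ᶠ r in 𝓝 (ℓ s), DifferentiableAt ℝ z r := by
    filter_upwards [hz.eventually (by simp)] with q hq using hq.differentiableAt (by simp)
  have hz2 : DifferentiableAt ℝ (fderiv ℝ z) (ℓ s) :=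
    (hz.fderiv_right (m := 1) (by norm_num)).differentiableAt (by simp)
  have h1 : fderiv ℝ (z ∘ ℓ) =ᶠ[𝓝 s] fun r => (fderiv ℝ z (ℓ r)).comp L := by
    filter_upwards [(hℓ' s).continuousAt.eventually hz1] with r hr
    exact (hr.hasFDerivAt.comp r (hℓ' r)).fderiv
  have h2 : HasFDerivAt (fun r => (fderiv ℝ z (ℓ r)).comp L) _ s :=
    (hz2.hasFDerivAt.comp s (hℓ' s)).clm_comp (hasFDerivAt_const L s)
  unfold coordHess
  rw [h1.fderiv_eq, h2.fderiv, h1.self_of_nhds]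
  simp

theorem coordHess_symm (hB : IsPseudoMetric B) (he : e ∈ IsManifold.maximalAtlas 𝓘(ℝ, E) ∞ M)
    {z : V → E} {p : V} (hz : ContDiffAt ℝ 2 z p) (hp : z p ∈ e.target) (u w : V) :
    coordHess B e z p u w = coordHess B e z p w u := by
  unfold coordHess
  rw [fderiv_fderiv_symm hz, christoffel_symm hB he hp]

theorem coordHess_add_left (z : V → E) (p u u' w : V) :
    coordHess B e z p (u + u') w = coordHess B e z p u w + coordHess B e z p u' w := by
  simp only [coordHess, ← christoffelL_apply, map_add, add_apply]
  abel

theorem coordHess_add_right (z : V → E) (p u w w' : V) :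
    coordHess B e z p u (w + w') = coordHess B e z p u w + coordHess B e z p u w' := by
  simp only [coordHess, ← christoffelL_apply, map_add]
  abel

theorem coordHess_neg_left (z : V → E) (p u w : V) :
    coordHess B e z p (-u) w = -coordHess B e z p u w := by
  simp only [coordHess, ← christoffelL_apply, map_neg, neg_apply]
  abel

theorem coordHess_neg_right (z : V → E) (p u w : V) :
    coordHess B e z p u (-w) = -coordHess B e z p u w := by
  simp only [coordHess, ← christoffelL_apply, map_neg]
  abel

/-- The wave map equation `∇_ξ ∂_η y = 0` at a point. -/
def WaveAt (B : FormField E M) (y : ℝ × ℝ → M) (p : ℝ × ℝ) : Prop :=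
  coordHess B (chartAt E (y p)) (chartAt E (y p) ∘ y) p (1, 1) (1, -1) = 0

theorem waveAt_iff (hB : IsPseudoMetric B) (he : e ∈ IsManifold.maximalAtlas 𝓘(ℝ, E) ∞ M)
    {y : ℝ × ℝ → M} {p : ℝ × ℝ} (hy : ContMDiffAt 𝓘(ℝ, ℝ × ℝ) 𝓘(ℝ, E) 2 y p)
    (hp : y p ∈ e.source) :
    WaveAt B y p ↔ coordHess B e (e ∘ y) p (1, 1) (1, -1) = 0 := by
  have he0 : chartAt E (y p) ∈ IsManifold.maximalAtlas 𝓘(ℝ, E) ∞ M :=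
    IsManifold.chart_mem_maximalAtlas _
  have hs0 := mem_chart_source E (y p)
  unfold WaveAt
  constructor
  · intro h
    rw [coordHess_chart_comp hB he0 he hy hs0 hp, h, map_zero]
  · intro h
    rw [coordHess_chart_comp hB he he0 hy hp hs0, h, map_zero]

theorem WaveAt.congr {y y' : ℝ × ℝ → M} {p : ℝ × ℝ} (h : WaveAt B y p) (hyy : y =ᶠ[𝓝 p] y') :
    WaveAt B y' p := by
  unfold WaveAt at *
  rw [← hyy.self_of_nhds, ← h]
  refine coordHess_congr ?_ _ _
  filter_upwards [hyy] with q hq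
  simp [hq]

/-- The wave operator `∇_t ∂_t y - ∇_x ∂_x y` in coordinates. -/
theorem wave_operator_eq_zero_iff (hB : IsPseudoMetric B) {y : ℝ × ℝ → M} {t x : ℝ}
    (hy : ContMDiffAt 𝓘(ℝ, ℝ × ℝ) 𝓘(ℝ, E) ∞ y (t, x)) :
    covDeriv B (fun s ↦ y (s, x)) (velocity E fun s ↦ y (s, x)) t
        - covDeriv B (fun s ↦ y (t, s)) (velocity E fun s ↦ y (t, s)) x = 0 ↔
      WaveAt B y (t, x) := by
  set e := chartAt E (y (t, x)) with hedef
  have he : e ∈ IsManifold.maximalAtlas 𝓘(ℝ, E) ∞ M := IsManifold.chart_mem_maximalAtlas _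
  have hs : y (t, x) ∈ e.source := mem_chart_source E _
  have hy2 : ContMDiffAt 𝓘(ℝ, ℝ × ℝ) 𝓘(ℝ, E) 2 y (t, x) := hy.of_le ENat.LEInfty.out
  have hz : ContDiffAt ℝ 2 (e ∘ y) (t, x) := contDiffAt_chart_comp ENat.LEInfty.out he hy2 hs
  have hl1 : ContMDiffAt 𝓘(ℝ, ℝ) 𝓘(ℝ, ℝ × ℝ) 2 (fun s : ℝ => ((s, x) : ℝ × ℝ)) t :=
    contMDiffAt_iff_contDiffAt.2 (by fun_prop)
  have hl2 : ContMDiffAt 𝓘(ℝ, ℝ) 𝓘(ℝ, ℝ × ℝ) 2 (fun s : ℝ => ((t, s) : ℝ × ℝ)) x :=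
    contMDiffAt_iff_contDiffAt.2 (by fun_prop)
  have h1 : (toCoord e (y (t, x)) (covDeriv B (fun s ↦ y (s, x)) (velocity E fun s ↦ y (s, x)) t) : E)
      = coordHess B e (e ∘ y) (t, x) (1, 0) (1, 0) := by
    have h2 := toCoord_covDeriv_velocity (c := fun s => y (s, x)) hB he (hy2.comp t hl1) hs
    refine h2.trans ?_
    have := coordHess_comp_affine (B := B) (e := e) (z := e ∘ y) (ℓ := fun s : ℝ => ((s, x) : ℝ × ℝ))
      (L := ContinuousLinearMap.inl ℝ ℝ ℝ) (q := (0, x)) (fun s => by simp) (s := t) hz 1 1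
    exact this
  have h1' : (toCoord e (y (t, x)) (covDeriv B (fun s ↦ y (t, s)) (velocity E fun s ↦ y (t, s)) x) : E)
      = coordHess B e (e ∘ y) (t, x) (0, 1) (0, 1) := by
    have h2 := toCoord_covDeriv_velocity (c := fun s => y (t, s)) hB he (hy2.comp x hl2) hs
    refine h2.trans ?_
    have := coordHess_comp_affine (B := B) (e := e) (z := e ∘ y) (ℓ := fun s : ℝ => ((t, s) : ℝ × ℝ))
      (L := ContinuousLinearMap.inr ℝ ℝ ℝ) (q := (t, 0)) (fun s => by simp) (s := x) hz 1 1
    exact this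
  -- The mixed terms cancel because the Hessian is symmetric, the connection being torsion-free.
  have h3 : coordHess B e (e ∘ y) (t, x) (1, 1) (1, -1) =
      coordHess B e (e ∘ y) (t, x) (1, 0) (1, 0) - coordHess B e (e ∘ y) (t, x) (0, 1) (0, 1) := by
    have e1 : ((1, 1) : ℝ × ℝ) = (1, 0) + (0, 1) := by simp
    have e2 : ((1, -1) : ℝ × ℝ) = (1, 0) + -(0, 1) := by simp
    rw [e1, e2, coordHess_add_left, coordHess_add_right, coordHess_add_right, coordHess_neg_right,
      coordHess_neg_right, coordHess_symm hB he hz (e.map_source hs) (0, 1) (1, 0)]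
    abel
  unfold WaveAt
  rw [h3, ← h1, ← h1', sub_eq_zero, sub_eq_zero]
  exact ⟨fun h => congrArg (fun v : E => (toCoord e (y (t, x)) v : E)) h,
    fun h => toCoord_injective he hs h⟩

/-- A smooth map on `D` that satisfies the wave map equation in the interior of `D`. -/
def IsWave (B : FormField E M) (D : Set (ℝ × ℝ)) (y : ℝ × ℝ → M) : Prop :=
  ContMDiffOn 𝓘(ℝ, ℝ × ℝ) 𝓘(ℝ, E) ∞ y D ∧ ∀ p ∈ interior D, WaveAt B y p

theorem isWaveMapOn_iff (g : LorentzMetric E M) {D : Set (ℝ × ℝ)} {y : ℝ × ℝ → M} :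
    IsWaveMapOn g D y ↔ IsWave g.inner D y := by
  refine and_congr_right fun hy => ?_
  have h : ∀ p ∈ interior D, ContMDiffAt 𝓘(ℝ, ℝ × ℝ) 𝓘(ℝ, E) ∞ y p := fun p hp =>
    (hy p (interior_subset hp)).contMDiffAt (mem_interior_iff_mem_nhds.1 hp)
  constructor
  · rintro h1 ⟨t, x⟩ hp
    exact (wave_operator_eq_zero_iff g.isPseudoMetric (h _ hp)).1 (h1 t x hp)
  · intro h1 t x hp
    exact (wave_operator_eq_zero_iff g.isPseudoMetric (h _ hp)).2 (h1 _ hp)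

theorem IsWave.mono {D D' : Set (ℝ × ℝ)} {y : ℝ × ℝ → M} (h : IsWave B D y) (hD : D' ⊆ D) :
    IsWave B D' y := ⟨h.1.mono hD, fun p hp => h.2 p (interior_mono hD hp)⟩

theorem IsWave.contMDiffAt {D : Set (ℝ × ℝ)} {y : ℝ × ℝ → M} (h : IsWave B D y) {p : ℝ × ℝ}
    (hp : p ∈ interior D) : ContMDiffAt 𝓘(ℝ, ℝ × ℝ) 𝓘(ℝ, E) ∞ y p :=
  (h.1 p (interior_subset hp)).contMDiffAt (mem_interior_iff_mem_nhds.1 hp)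

/-- The time shift (`σ = 1`) or time reflection (`σ = -1`) `(t, x) ↦ (s₀ + σ t, x)`. -/
def timeMap (s₀ σ : ℝ) (p : ℝ × ℝ) : ℝ × ℝ := (s₀ + σ * p.1, p.2)

theorem contDiff_timeMap (s₀ σ : ℝ) {n : WithTop ℕ∞} : ContDiff ℝ n (timeMap s₀ σ) := by
  unfold timeMap; fun_prop

/-- The reflection exchanges the two characteristic directions up to sign, which is harmless since
the Hessian is bilinear and symmetric. -/
theorem waveAt_comp_timeMap (hB : IsPseudoMetric B) {s₀ σ : ℝ} (hσ : σ = 1 ∨ σ = -1)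
    {y : ℝ × ℝ → M} {p : ℝ × ℝ} (hy : ContMDiffAt 𝓘(ℝ, ℝ × ℝ) 𝓘(ℝ, E) ∞ y (timeMap s₀ σ p))
    (hw : WaveAt B y (timeMap s₀ σ p)) : WaveAt B (y ∘ timeMap s₀ σ) p := by
  set e := chartAt E (y (timeMap s₀ σ p)) with hedef
  have he : e ∈ IsManifold.maximalAtlas 𝓘(ℝ, E) ∞ M := IsManifold.chart_mem_maximalAtlas _
  have hs : y (timeMap s₀ σ p) ∈ e.source := mem_chart_source E _
  have hz : ContDiffAt ℝ 2 (e ∘ y) (timeMap s₀ σ p) :=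
    contDiffAt_chart_comp ENat.LEInfty.out he (hy.of_le ENat.LEInfty.out) hs
  have h1 := coordHess_comp_affine (B := B) (e := e) (z := e ∘ y) (ℓ := timeMap s₀ σ)
    (L := (σ • ContinuousLinearMap.fst ℝ ℝ ℝ).prod (ContinuousLinearMap.snd ℝ ℝ ℝ)) (q := (s₀, 0))
    (fun s => by simp [timeMap]) (s := p) hz (1, 1) (1, -1)
  unfold WaveAt at hw ⊢
  rw [← hedef] at hw
  change coordHess B e ((e ∘ y) ∘ timeMap s₀ σ) p (1, 1) (1, -1) = 0
  rw [h1]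
  rcases hσ with rfl | rfl
  · simpa using hw
  · have e1 : ((-1 : ℝ) • ContinuousLinearMap.fst ℝ ℝ ℝ).prod (ContinuousLinearMap.snd ℝ ℝ ℝ) (1, 1) =
      -(1, -1) := by simp
    have e2 : ((-1 : ℝ) • ContinuousLinearMap.fst ℝ ℝ ℝ).prod (ContinuousLinearMap.snd ℝ ℝ ℝ) (1, -1) =
      -(1, 1) := by simp
    rw [e1, e2, coordHess_neg_left, coordHess_neg_right, neg_neg,
      coordHess_symm hB he hz (e.map_source hs), hw]

theorem IsWave.comp_timeMap (hB : IsPseudoMetric B) {s₀ σ : ℝ} (hσ : σ = 1 ∨ σ = -1)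
    {D D' : Set (ℝ × ℝ)} (hD : MapsTo (timeMap s₀ σ) D' D) {y : ℝ × ℝ → M} (h : IsWave B D y) :
    IsWave B D' (y ∘ timeMap s₀ σ) := by
  have hinv : ∀ p, timeMap s₀ σ (timeMap (-(σ * s₀)) σ p) = p := by
    intro p
    rcases hσ with rfl | rfl <;> simp [timeMap]
  have hinv' : ∀ p, timeMap (-(σ * s₀)) σ (timeMap s₀ σ p) = p := by
    intro p
    rcases hσ with rfl | rfl <;> simp [timeMap]
  have hint : ∀ p ∈ interior D', timeMap s₀ σ p ∈ interior D := by
    intro p hp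
    rw [mem_interior_iff_mem_nhds] at hp ⊢
    have hc : ContinuousAt (timeMap (-(σ * s₀)) σ) (timeMap s₀ σ p) :=
      (contDiff_timeMap _ _ (n := 0)).continuous.continuousAt
    have h1 := hc.preimage_mem_nhds (by rw [hinv']; exact hp)
    filter_upwards [h1] with q hq
    have := hD hq
    rwa [hinv] at this
  refine ⟨h.1.comp (contMDiff_iff_contDiff.2 (contDiff_timeMap _ _)).contMDiffOn hD, fun p hp => ?_⟩
  exact waveAt_comp_timeMap hB hσ (h.contMDiffAt (hint p hp)) (h.2 _ (hint p hp))

end WaveEquation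

/-! ### Characteristic triangles. -/

section Triangles

/-- The closed characteristic triangle with vertex `(R, x₀)`, truncated at the height `τ`. -/
def fwdTriangle (τ x₀ R : ℝ) : Set (ℝ × ℝ) := {p | τ ≤ p.1 ∧ |p.2 - x₀| ≤ R - p.1}

/-- The interior of `fwdTriangle`. -/
def openTriangle (τ x₀ R : ℝ) : Set (ℝ × ℝ) := {p | τ < p.1 ∧ |p.2 - x₀| < R - p.1}

theorem isOpen_openTriangle (τ x₀ R : ℝ) : IsOpen (openTriangle τ x₀ R) :=
  (isOpen_lt continuous_const continuous_fst).inter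
    (isOpen_lt (f := fun p : ℝ × ℝ => |p.2 - x₀|) (g := fun p => R - p.1) (by fun_prop) (by fun_prop))

theorem isClosed_fwdTriangle (τ x₀ R : ℝ) : IsClosed (fwdTriangle τ x₀ R) :=
  (isClosed_le continuous_const continuous_fst).inter
    (isClosed_le (f := fun p : ℝ × ℝ => |p.2 - x₀|) (g := fun p => R - p.1) (by fun_prop) (by fun_prop))

theorem openTriangle_subset (τ x₀ R : ℝ) : openTriangle τ x₀ R ⊆ fwdTriangle τ x₀ R :=
  fun _ hp => ⟨hp.1.le, hp.2.le⟩

theorem openTriangle_subset_interior (τ x₀ R : ℝ) :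
    openTriangle τ x₀ R ⊆ interior (fwdTriangle τ x₀ R) :=
  interior_maximal (openTriangle_subset _ _ _) (isOpen_openTriangle _ _ _)

theorem isCompact_fwdTriangle (τ x₀ R : ℝ) : IsCompact (fwdTriangle τ x₀ R) := by
  refine IsCompact.of_isClosed_subset ((isCompact_Icc (a := τ) (b := R)).prod
    (isCompact_Icc (a := x₀ - (R - τ)) (b := x₀ + (R - τ)))) (isClosed_fwdTriangle _ _ _) ?_
  rintro ⟨s, x⟩ ⟨h1, h2⟩
  simp only at h1 h2
  have h3 := abs_nonneg (x - x₀)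
  have h4 := abs_le.1 h2
  refine ⟨⟨h1, by simp only; linarith⟩, ⟨?_, ?_⟩⟩ <;> simp only <;> linarith [h4.1, h4.2]

theorem convex_fwdTriangle (τ x₀ R : ℝ) : Convex ℝ (fwdTriangle τ x₀ R) := by
  intro p hp q hq a b ha hb hab
  obtain ⟨h1, h2⟩ := hp
  obtain ⟨h3, h4⟩ := hq
  rw [abs_le] at h2 h4
  have hb' : b = 1 - a := by linarith
  subst hb'
  refine ⟨?_, ?_⟩
  · simp only [Prod.fst_add, Prod.smul_fst, smul_eq_mul]; nlinarith
  · rw [abs_le]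
    simp only [Prod.fst_add, Prod.smul_fst, Prod.snd_add, Prod.smul_snd, smul_eq_mul]
    constructor <;> nlinarith [h2.1, h2.2, h4.1, h4.2]

theorem uniqueDiffOn_fwdTriangle {τ x₀ R : ℝ} (h : τ < R) : UniqueDiffOn ℝ (fwdTriangle τ x₀ R) := by
  refine uniqueDiffOn_convex (convex_fwdTriangle _ _ _) ⟨((τ + R) / 2, x₀), ?_⟩
  refine openTriangle_subset_interior _ _ _ ⟨?_, ?_⟩ <;> simp <;> linarith

/-- Points of the triangle are moved slightly towards the interior point `((τ + R) / 2, x₀)`. -/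
theorem fwdTriangle_subset_closure {τ x₀ R : ℝ} (h : τ < R) :
    fwdTriangle τ x₀ R ⊆ closure (openTriangle τ x₀ R) := by
  rintro ⟨s, x⟩ ⟨h1, h2⟩
  simp only at h1 h2
  have h3 : Tendsto (fun θ : ℝ => ((s + θ * ((τ + R) / 2 - s), x + θ * (x₀ - x)) : ℝ × ℝ)) (𝓝[>] 0)
      (𝓝 (s, x)) := by
    have : Continuous fun θ : ℝ => ((s + θ * ((τ + R) / 2 - s), x + θ * (x₀ - x)) : ℝ × ℝ) := by
      fun_prop
    have h4 := this.tendsto 0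
    simp only [zero_mul, add_zero] at h4
    exact h4.mono_left nhdsWithin_le_nhds
  refine mem_closure_of_tendsto h3 ?_
  filter_upwards [Ioo_mem_nhdsGT (zero_lt_one (α := ℝ))] with θ hθ
  refine ⟨?_, ?_⟩
  · simp only; nlinarith [hθ.1, hθ.2]
  · simp only
    have h5 : x + θ * (x₀ - x) - x₀ = (1 - θ) * (x - x₀) := by ring
    rw [h5, abs_mul, abs_of_pos (by linarith [hθ.2])]
    have := mul_le_mul_of_nonneg_left h2 (by linarith [hθ.2] : 0 ≤ 1 - θ)
    nlinarith [hθ.1]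

theorem charTriangle_eq_fwdTriangle {R x₀ : ℝ} (hR : 0 ≤ R) :
    charTriangle (R, x₀) = fwdTriangle 0 x₀ R := by
  ext ⟨s, x⟩
  simp only [charTriangle, fwdTriangle, mem_ofPred_eq, uIcc_of_le hR, abs_of_nonneg hR]
  constructor
  · rintro ⟨⟨h1, h2⟩, h3⟩
    rw [abs_of_nonneg h1] at h3
    exact ⟨h1, h3⟩
  · rintro ⟨h1, h2⟩
    rw [abs_of_nonneg h1]
    exact ⟨⟨h1, by linarith [abs_nonneg (x - x₀)]⟩, h2⟩

end Triangles

/-! ### Uniqueness in coordinates. -/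

section Uniqueness

/-- No derivative is asked for at `a`, because the equation is not available on the base of a
triangle. The comparison starts at `a' > a`, and `a'` tends to `a` by continuity of `g`. -/
theorem norm_le_of_norm_hasDerivAt_le {F : Type*} [NormedAddCommGroup F] [NormedSpace ℝ F]
    {g g' : ℝ → F} {φ φ' : ℝ → ℝ} {a b : ℝ} (hab : a ≤ b) (hg : ContinuousOn g (Icc a b))
    (hg' : ∀ x ∈ Ioc a b, HasDerivAt g (g' x) x) (ha : ‖g a‖ ≤ φ a)
    (hφ : ∀ x, HasDerivAt φ (φ' x) x) (bound : ∀ x ∈ Ioc a b, ‖g' x‖ ≤ φ' x) : ‖g b‖ ≤ φ b := by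
  rcases hab.eq_or_lt with rfl | hab
  · exact ha
  have h1 : ∀ a' ∈ Ioo a b, ‖g b‖ ≤ φ b + (‖g a'‖ - φ a') := by
    intro a' ha'
    have := image_norm_le_of_norm_deriv_right_le_deriv_boundary (f := g) (f' := g') (a := a') (b := b)
      (B := fun x => φ x + (‖g a'‖ - φ a')) (B' := φ') (hg.mono (Icc_subset_Icc_left ha'.1.le))
      (fun x hx => (hg' x ⟨ha'.1.trans_le hx.1, hx.2.le⟩).hasDerivWithinAt) (by simp)
      (fun x => (hφ x).add_const _) (fun x hx => bound x ⟨ha'.1.trans_le hx.1, hx.2.le⟩)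
    exact this ⟨ha'.2.le, le_rfl⟩
  have h2 : Tendsto (fun a' => φ b + (‖g a'‖ - φ a')) (𝓝[>] a) (𝓝 (φ b + (‖g a‖ - φ a))) := by
    have hga : Tendsto g (𝓝[>] a) (𝓝 (g a)) := by
      have := hg a ⟨le_rfl, hab.le⟩
      refine this.mono_left ?_
      rw [← nhdsWithin_Ioc_eq_nhdsGT hab]
      exact nhdsWithin_mono _ Ioc_subset_Icc_self
    exact tendsto_const_nhds.add (hga.norm.sub ((hφ a).continuousAt.tendsto.mono_left nhdsWithin_le_nhds))
  have h3 : ‖g b‖ ≤ φ b + (‖g a‖ - φ a) := by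
    refine ge_of_tendsto h2 ?_
    filter_upwards [Ioo_mem_nhdsGT hab] with a' ha' using h1 a' ha'
  linarith

variable {E : Type*} [NormedAddCommGroup E] [NormedSpace ℝ E] [FiniteDimensional ℝ E]

/-- The first-order unknowns `(z, ∂_ξ z, ∂_η z)` of a map on a set. -/
def waveJet (z : ℝ × ℝ → E) (D : Set (ℝ × ℝ)) (p : ℝ × ℝ) : Fin 3 → E :=
  ![z p, fderivWithin ℝ z D p (1, 1), fderivWithin ℝ z D p (1, -1)]

/-- Converse of `wave_first_order`. The jet is defined with `fderivWithin` so that it is continuous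
up to the boundary of a triangle, although the equation is only used in the interior. -/
theorem hasDerivAt_waveJet {Γ : E → E →L[ℝ] E →L[ℝ] E} {z : ℝ × ℝ → E} {D : Set (ℝ × ℝ)}
    (hz : ContDiffOn ℝ ∞ z D) {p : ℝ × ℝ} (hp : p ∈ interior D)
    (hw : fderiv ℝ (fderiv ℝ z) p (1, 1) (1, -1) + Γ (z p) (fderiv ℝ z p (1, 1))
      (fderiv ℝ z p (1, -1)) = 0) (i : Fin 3) :
    HasDerivAt (fun r : ℝ => waveJet z D (p.1 + r, p.2 + r • waveSpeed i) i)
      (waveNonlinearity Γ (waveJet z D p) i) 0 := by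
  have hc : ContDiffAt ℝ ∞ z p := hz.contDiffAt (mem_interior_iff_mem_nhds.1 hp)
  have hd : DifferentiableAt ℝ z p := hc.differentiableAt (by simp)
  have hdd : DifferentiableAt ℝ (fderiv ℝ z) p :=
    (hc.fderiv_right (m := ∞) (by simp)).differentiableAt (by simp)
  have hev : ∀ᶠ q in 𝓝 p, fderivWithin ℝ z D q = fderiv ℝ z q := by
    filter_upwards [isOpen_interior.mem_nhds hp] with q hq
    exact fderivWithin_of_mem_nhds (mem_interior_iff_mem_nhds.1 hq)
  have hline : HasDerivAt (fun r : ℝ => ((p.1 + r, p.2 + r • waveSpeed i) : ℝ × ℝ))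
      (1, waveSpeed i) 0 := by
    refine ((hasDerivAt_id (0 : ℝ)).const_add p.1).prodMk ?_
    simpa using ((hasDerivAt_id (0 : ℝ)).smul_const (waveSpeed i)).const_add p.2
  have hline0 : (fun r : ℝ => ((p.1 + r, p.2 + r • waveSpeed i) : ℝ × ℝ)) 0 = p := by simp
  have key : ∀ {g : ℝ × ℝ → E} {L : ℝ × ℝ →L[ℝ] E}, HasFDerivAt g L p →
      HasDerivAt (fun r : ℝ => g (p.1 + r, p.2 + r • waveSpeed i)) (L (1, waveSpeed i)) 0 := by
    intro g L hg
    rw [← hline0] at hg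
    exact hg.comp_hasDerivAt (0 : ℝ) hline
  have hdir : ∀ u : ℝ × ℝ, HasFDerivAt (fun q => fderivWithin ℝ z D q u)
      ((fderiv ℝ (fderiv ℝ z) p).flip u) p := by
    intro u
    have h1 : HasFDerivAt (fun q => fderiv ℝ z q u) ((fderiv ℝ (fderiv ℝ z) p).flip u) p := by
      simpa using hdd.hasFDerivAt.clm_apply (hasFDerivAt_const u p)
    refine h1.congr_of_eventuallyEq ?_
    filter_upwards [hev] with q hq
    rw [hq]
  have hjet : waveJet z D p = ![z p, fderiv ℝ z p (1, 1), fderiv ℝ z p (1, -1)] := by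
    simp [waveJet, hev.self_of_nhds]
  have hw' := eq_neg_of_add_eq_zero_left hw
  fin_cases i
  · refine (key hd.hasFDerivAt).congr_deriv ?_
    rw [hjet]
    simp only [waveNonlinearity, waveSpeed, Matrix.cons_val_zero, Matrix.cons_val_one, Matrix.cons_val,
      Fin.zero_eta]
    rw [← map_add, ← map_smul]
    congr 1
    ext <;> norm_num
  · refine (key (hdir (1, 1))).congr_deriv ?_
    rw [hjet]
    refine Eq.trans ?_ hw'
    exact fderiv_fderiv_symm (hc.of_le ENat.LEInfty.out) _ _
  · refine (key (hdir (1, -1))).congr_deriv ?_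
    rw [hjet]
    exact hw'

/-- Uniqueness for the coordinate wave map equation on a triangle. -/
theorem coordinate_wave_unique {Γ : E → E →L[ℝ] E →L[ℝ] E} {O : Set E} (hO : IsOpen O)
    (hΓ : ContDiffOn ℝ ∞ Γ O) {τ x₀ R : ℝ} (hR : τ < R) {z : Fin 2 → ℝ × ℝ → E}
    (hz : ∀ j, ContDiffOn ℝ ∞ (z j) (fwdTriangle τ x₀ R))
    (hzO : ∀ j, ∀ p ∈ fwdTriangle τ x₀ R, z j p ∈ O)
    (hw : ∀ j, ∀ p ∈ openTriangle τ x₀ R, fderiv ℝ (fderiv ℝ (z j)) p (1, 1) (1, -1) +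
      Γ (z j p) (fderiv ℝ (z j) p (1, 1)) (fderiv ℝ (z j) p (1, -1)) = 0)
    (hbase : ∀ p ∈ fwdTriangle τ x₀ R, p.1 = τ → waveJet (z 0) (fwdTriangle τ x₀ R) p =
      waveJet (z 1) (fwdTriangle τ x₀ R) p) :
    EqOn (z 0) (z 1) (fwdTriangle τ x₀ R) := by
  set Δ := fwdTriangle τ x₀ R with hΔ
  have hud := uniqueDiffOn_fwdTriangle (x₀ := x₀) hR
  have hcont : ∀ j, ContinuousOn (waveJet (z j) Δ) Δ := by
    intro j
    have h1 : ContinuousOn (fderivWithin ℝ (z j) Δ) Δ :=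
      (hz j).continuousOn_fderivWithin hud (by simp)
    rw [continuousOn_pi]
    intro i
    fin_cases i
    · exact (hz j).continuousOn
    · exact h1.clm_apply continuousOn_const
    · exact h1.clm_apply continuousOn_const
  have hΔc : IsCompact Δ := isCompact_fwdTriangle _ _ _
  have hKc : IsCompact (waveJet (z 0) Δ '' Δ ∪ waveJet (z 1) Δ '' Δ) :=
    (hΔc.image_of_continuousOn (hcont 0)).union (hΔc.image_of_continuousOn (hcont 1))
  have hKU : waveJet (z 0) Δ '' Δ ∪ waveJet (z 1) Δ '' Δ ⊆ {V : Fin 3 → E | V 0 ∈ O} := by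
    rintro V (⟨p, hp, rfl⟩ | ⟨p, hp, rfl⟩)
    exacts [hzO 0 p hp, hzO 1 p hp]
  -- Both jets have compact range, so the nonlinearity may be replaced by one of compact support,
  -- which is globally Lipschitz.
  obtain ⟨f, hf, hsupp, hfeq⟩ := exists_contDiff_eventuallyEq_nhdsSet
    (hO.preimage (continuous_apply 0)) hKc hKU (contDiffOn_waveNonlinearity hΓ)
  obtain ⟨L, hL⟩ := hf.lipschitzWith_of_hasCompactSupport hsupp (by simp)
  have hfj : ∀ j, ∀ p ∈ Δ, f (waveJet (z j) Δ p) = waveNonlinearity Γ (waveJet (z j) Δ p) := by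
    intro j p hp
    refine (hfeq.filter_mono (nhds_le_nhdsSet ?_)).self_of_nhds
    fin_cases j
    exacts [Or.inl ⟨p, hp, rfl⟩, Or.inr ⟨p, hp, rfl⟩]
  let d : ℝ × ℝ → Fin 3 → E := fun p => waveJet (z 0) Δ p - waveJet (z 1) Δ p
  have hdc : ContinuousOn d Δ := (hcont 0).sub (hcont 1)
  -- With a weight exponent larger than `L`, integrating `L * exp (lam * (σ - τ))` along a
  -- characteristic gains the factor `L / lam < 1`.
  set lam : ℝ := L + 1 with hlam
  have hlam0 : 0 < lam := by have := L.coe_nonneg; linarith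
  let φ : ℝ × ℝ → ℝ := fun p => Real.exp (-(lam * (p.1 - τ))) * ‖d p‖
  have hφc : ContinuousOn φ Δ := by
    refine ContinuousOn.mul ?_ hdc.norm
    fun_prop
  have hne : Δ.Nonempty := ⟨(τ, x₀), le_rfl, by simp only [sub_self, abs_zero]; linarith⟩
  obtain ⟨p₀, hp₀, hmax⟩ := hΔc.exists_isMaxOn hne hφc
  set m := φ p₀ with hm
  have hm0 : 0 ≤ m := mul_nonneg (Real.exp_pos _).le (norm_nonneg _)
  have hdle : ∀ p ∈ Δ, ‖d p‖ ≤ m * Real.exp (lam * (p.1 - τ)) := by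
    intro p hp
    have h1 : φ p ≤ m := hmax hp
    have h2 : ‖d p‖ = φ p * Real.exp (lam * (p.1 - τ)) := by
      simp only [φ]
      rw [mul_assoc, mul_comm (‖d p‖), ← mul_assoc, ← Real.exp_add]; simp
    rw [h2]
    exact mul_le_mul_of_nonneg_right h1 (Real.exp_pos _).le
  have hopen : ∀ p ∈ openTriangle τ x₀ R, φ p ≤ L / lam * m := by
    intro p hp
    have hi : ∀ i, ‖d p i‖ ≤ L / lam * m * Real.exp (lam * (p.1 - τ)) := by
      intro i
      have hpath : ∀ σ ∈ Icc τ p.1, ((σ, p.2 + (σ - p.1) • waveSpeed i) : ℝ × ℝ) ∈ Δ ∧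
          (τ < σ → ((σ, p.2 + (σ - p.1) • waveSpeed i) : ℝ × ℝ) ∈ openTriangle τ x₀ R) := by
        intro σ hσ
        have h1 : |p.2 + (σ - p.1) • waveSpeed i - x₀| < R - σ := by
          have h2 : |(σ - p.1) • waveSpeed i| ≤ p.1 - σ := by
            rw [smul_eq_mul, abs_mul, abs_of_nonpos (by linarith [hσ.2] : σ - p.1 ≤ 0)]
            have := norm_waveSpeed_le i
            rw [Real.norm_eq_abs] at this
            nlinarith [hσ.2, abs_nonneg (waveSpeed i)]
          have h3 : p.2 + (σ - p.1) • waveSpeed i - x₀ = (p.2 - x₀) + (σ - p.1) • waveSpeed i := by ring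
          rw [h3]
          have := abs_add_le (p.2 - x₀) ((σ - p.1) • waveSpeed i)
          have := hp.2
          linarith
        exact ⟨⟨hσ.1, h1.le⟩, fun h => ⟨h, h1⟩⟩
      have hder : ∀ σ ∈ Ioc τ p.1, HasDerivAt
          (fun σ => d (σ, p.2 + (σ - p.1) • waveSpeed i) i)
          ((f (waveJet (z 0) Δ (σ, p.2 + (σ - p.1) • waveSpeed i)) -
            f (waveJet (z 1) Δ (σ, p.2 + (σ - p.1) • waveSpeed i))) i) σ := by
        intro σ hσ
        obtain ⟨h1, h2⟩ := hpath σ ⟨hσ.1.le, hσ.2⟩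
        have hj : ∀ j, HasDerivAt (fun σ => waveJet (z j) Δ (σ, p.2 + (σ - p.1) • waveSpeed i) i)
            (f (waveJet (z j) Δ (σ, p.2 + (σ - p.1) • waveSpeed i)) i) σ := by
          intro j
          rw [hfj j _ h1]
          have h3 := hasDerivAt_waveJet (hz j) (openTriangle_subset_interior _ _ _ (h2 hσ.1))
            (hw j _ (h2 hσ.1)) i
          have h4 : HasDerivAt (fun r : ℝ => r - σ) 1 σ := (hasDerivAt_id σ).sub_const σ
          have h5 := HasDerivAt.scomp σ (h := fun r : ℝ => r - σ) (by simpa using h3) h4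
          rw [one_smul] at h5
          refine h5.congr_of_eventuallyEq (Eventually.of_forall fun r => ?_)
          simp only [Function.comp_apply, smul_eq_mul]
          have e1 : σ + (r - σ) = r := by ring
          have e2 : p.2 + (σ - p.1) * waveSpeed i + (r - σ) * waveSpeed i =
            p.2 + (r - p.1) * waveSpeed i := by ring
          rw [e1, e2]
        exact (hj 0).sub (hj 1)
      have hbd := norm_le_of_norm_hasDerivAt_le (g := fun σ => d (σ, p.2 + (σ - p.1) • waveSpeed i) i)
        (φ := fun σ => L / lam * m * Real.exp (lam * (σ - τ)))
        (φ' := fun σ => L * (m * Real.exp (lam * (σ - τ)))) hp.1.le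
        ((continuous_apply i).comp_continuousOn (hdc.comp (by fun_prop) fun σ hσ => (hpath σ hσ).1))
        hder ?_ ?_ ?_
      · simpa using hbd
      · have h1 : d (τ, p.2 + (τ - p.1) • waveSpeed i) = 0 :=
          sub_eq_zero.2 (hbase _ (hpath τ ⟨le_rfl, hp.1.le⟩).1 rfl)
        simp only [h1, Pi.zero_apply, norm_zero]
        have := L.coe_nonneg
        positivity
      · intro σ
        have h1 : HasDerivAt (fun σ => lam * (σ - τ)) lam σ := by
          simpa using ((hasDerivAt_id σ).sub_const τ).const_mul lam
        refine (h1.exp.const_mul (L / lam * m)).congr_deriv ?_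
        field_simp
      · intro σ hσ
        have h1 := (hpath σ ⟨hσ.1.le, hσ.2⟩).1
        refine (norm_le_pi_norm _ i).trans ?_
        have h2 := hL.dist_le_mul (waveJet (z 0) Δ (σ, p.2 + (σ - p.1) • waveSpeed i))
          (waveJet (z 1) Δ (σ, p.2 + (σ - p.1) • waveSpeed i))
        rw [dist_eq_norm, dist_eq_norm] at h2
        exact h2.trans (mul_le_mul_of_nonneg_left (hdle _ h1) L.coe_nonneg)
    have hnorm : ‖d p‖ ≤ L / lam * m * Real.exp (lam * (p.1 - τ)) :=
      (pi_norm_le_iff_of_nonneg (by have := L.coe_nonneg; positivity)).2 hi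
    calc φ p ≤ Real.exp (-(lam * (p.1 - τ))) * (L / lam * m * Real.exp (lam * (p.1 - τ))) :=
          mul_le_mul_of_nonneg_left hnorm (Real.exp_pos _).le
      _ = L / lam * m := by
          rw [mul_comm, mul_assoc, ← Real.exp_add]; simp
  -- The maximum may lie on the boundary; the open triangle is dense, so the estimate extends to it
  -- by continuity.
  have hmle : m ≤ L / lam * m := by
    have h1 : Δ ⊆ closure (openTriangle τ x₀ R) := fwdTriangle_subset_closure hR
    have h2 : ContinuousWithinAt φ (openTriangle τ x₀ R) p₀ :=
      (hφc p₀ hp₀).mono (openTriangle_subset _ _ _)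
    exact closure_minimal (s := φ '' openTriangle τ x₀ R) (t := Iic (L / lam * m))
      (by rintro _ ⟨p, hp, rfl⟩; exact hopen p hp) isClosed_Iic
      (h2.mem_closure_image (h1 hp₀))
  have hm00 : m = 0 := by
    rw [div_mul_eq_mul_div, le_div_iff₀ hlam0, hlam] at hmle
    nlinarith
  intro p hp
  have h1 := hdle p hp
  rw [hm00, zero_mul, norm_le_zero_iff] at h1
  exact sub_eq_zero.1 (congrFun h1 0)

end Uniqueness

/-! ### Uniqueness on a characteristic triangle, for maps into the manifold. -/

section ManifoldUniqueness

variable {E : Type*} [NormedAddCommGroup E] [NormedSpace ℝ E] [FiniteDimensional ℝ E]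
  {M : Type*} [TopologicalSpace M] [ChartedSpace E M] [IsManifold 𝓘(ℝ, E) ∞ M]
  {e : OpenPartialHomeomorph M E} {B : FormField E M}

theorem contDiffWithinAt_chart_comp (he : e ∈ IsManifold.maximalAtlas 𝓘(ℝ, E) ∞ M)
    {V : Type*} [NormedAddCommGroup V] [NormedSpace ℝ V] {y : V → M} {D : Set V} {p : V}
    (hy : ContMDiffWithinAt 𝓘(ℝ, V) 𝓘(ℝ, E) ∞ y D p) (hp : y p ∈ e.source) :
    ContDiffWithinAt ℝ ∞ (e ∘ y) D p := by
  rw [← contMDiffWithinAt_iff_contDiffWithinAt]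
  exact (contMDiffAt_chart he hp).comp_contMDiffWithinAt p hy

theorem toCoord_mfderivWithin (he : e ∈ IsManifold.maximalAtlas 𝓘(ℝ, E) ∞ M)
    {V : Type*} [NormedAddCommGroup V] [NormedSpace ℝ V] {y : V → M} {D : Set V} {p : V}
    (hy : MDifferentiableWithinAt 𝓘(ℝ, V) 𝓘(ℝ, E) y D p) (hD : UniqueDiffWithinAt ℝ D p)
    (hp : y p ∈ e.source) (u : V) :
    (toCoord e (y p) (mfderivWithin 𝓘(ℝ, V) 𝓘(ℝ, E) y D p u) : E)
      = fderivWithin ℝ (e ∘ y) D p u := by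
  have h1 := (contMDiffAt_chart he hp).mdifferentiableAt (by simp)
  have h4 := mfderiv_comp_mfderivWithin p h1 hy hD.uniqueMDiffWithinAt
  rw [mfderivWithin_eq_fderivWithin] at h4
  exact (congrArg (fun L : V →L[ℝ] E => L u) h4).symm

theorem wave_unique_chart (hB : IsPseudoMetric B)
    (he : e ∈ IsManifold.maximalAtlas 𝓘(ℝ, E) ∞ M) {τ x₀ R : ℝ} (hR : τ < R)
    {y : Fin 2 → ℝ × ℝ → M} (hy : ∀ j, IsWave B (fwdTriangle τ x₀ R) (y j))
    (hye : ∀ j, ∀ p ∈ fwdTriangle τ x₀ R, y j p ∈ e.source)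
    (hbase : ∀ p ∈ fwdTriangle τ x₀ R, p.1 = τ → y 0 p = y 1 p ∧
      fderivWithin ℝ (e ∘ y 0) (fwdTriangle τ x₀ R) p =
        fderivWithin ℝ (e ∘ y 1) (fwdTriangle τ x₀ R) p) :
    EqOn (y 0) (y 1) (fwdTriangle τ x₀ R) := by
  have hz := coordinate_wave_unique e.open_target (contDiffOn_christoffelL hB he) hR
    (z := fun j => e ∘ y j) (x₀ := x₀)
    (fun j p hp => contDiffWithinAt_chart_comp he ((hy j).1 p hp) (hye j p hp))
    (fun j p hp => e.map_source (hye j p hp)) ?_ ?_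
  · intro p hp
    exact e.injOn (hye 0 p hp) (hye 1 p hp) (hz hp)
  · intro j p hp
    have hpi := openTriangle_subset_interior _ _ _ hp
    exact (waveAt_iff hB he (((hy j).contMDiffAt hpi).of_le ENat.LEInfty.out)
      (hye j p (interior_subset hpi))).1 ((hy j).2 p hpi)
  · intro p hp hpτ
    obtain ⟨h1, h2⟩ := hbase p hp hpτ
    simp only [waveJet, h2, Function.comp_apply, h1]

theorem fwdTriangle_subset_of_mem {τ x₀ R : ℝ} {p : ℝ × ℝ} (hp : p ∈ fwdTriangle 0 x₀ R)
    (hτ : 0 ≤ τ) : fwdTriangle τ p.2 p.1 ⊆ fwdTriangle 0 x₀ R := by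
  rintro q ⟨h1, h2⟩
  refine ⟨hτ.trans h1, ?_⟩
  have h3 : q.2 - x₀ = (q.2 - p.2) + (p.2 - x₀) := by ring
  rw [h3]
  have := abs_add_le (q.2 - p.2) (p.2 - x₀)
  have := hp.2
  linarith

variable [T2Space M]

/-- If two wave maps on a triangle agree up to the height `τ`, with equal first derivatives at the
height `τ`, then they agree near each point at the height `τ`. -/
theorem wave_unique_near (hB : IsPseudoMetric B) {x₀ R : ℝ} (hR : 0 < R)
    {y : Fin 2 → ℝ × ℝ → M} (hy : ∀ j, IsWave B (fwdTriangle 0 x₀ R) (y j))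
    (hdata : ∀ x, ((0 : ℝ), x) ∈ fwdTriangle 0 x₀ R →
      (⟨y 0 (0, x), mfderivWithin 𝓘(ℝ, ℝ × ℝ) 𝓘(ℝ, E) (y 0) (fwdTriangle 0 x₀ R) (0, x)
        ((1, 0) : ℝ × ℝ)⟩ : TangentBundle 𝓘(ℝ, E) M) =
      ⟨y 1 (0, x), mfderivWithin 𝓘(ℝ, ℝ × ℝ) 𝓘(ℝ, E) (y 1) (fwdTriangle 0 x₀ R) (0, x)
        ((1, 0) : ℝ × ℝ)⟩) {τ : ℝ} (hτ : 0 ≤ τ)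
    (hag : ∀ p ∈ fwdTriangle 0 x₀ R, p.1 ≤ τ → y 0 p = y 1 p)
    {q : ℝ × ℝ} (hq : q ∈ fwdTriangle 0 x₀ R) (hqτ : q.1 = τ) :
    ∃ U : Set (ℝ × ℝ), IsOpen U ∧ q ∈ U ∧ ∀ p ∈ U ∩ fwdTriangle 0 x₀ R, y 0 p = y 1 p := by
  set T := fwdTriangle 0 x₀ R with hT
  have hTu : UniqueDiffOn ℝ T := uniqueDiffOn_fwdTriangle hR
  set e := chartAt E (y 0 q) with hedef
  have he : e ∈ IsManifold.maximalAtlas 𝓘(ℝ, E) ∞ M := IsManifold.chart_mem_maximalAtlas _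
  have hsrc : ∀ j, y j q ∈ e.source := by
    have h0 : y 0 q ∈ e.source := mem_chart_source E _
    intro j
    fin_cases j
    · exact h0
    · change y 1 q ∈ e.source
      rwa [← hag q hq hqτ.le]
  have hnear : ∀ j, ∀ᶠ p in 𝓝[T] q, y j p ∈ e.source := fun j =>
    ((hy j).1 q hq).continuousWithinAt.preimage_mem_nhdsWithin (e.open_source.mem_nhds (hsrc j))
  obtain ⟨δ, hδ, hball⟩ := Metric.mem_nhdsWithin_iff.1 ((hnear 0).and (hnear 1))
  refine ⟨Metric.ball q (δ / 2), Metric.isOpen_ball, Metric.mem_ball_self (by positivity), ?_⟩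
  rintro p ⟨hpq, hpT⟩
  rcases le_or_gt p.1 τ with hpτ | hpτ
  · exact hag p hpT hpτ
  have hsub : fwdTriangle τ p.2 p.1 ⊆ T := fwdTriangle_subset_of_mem hpT hτ
  -- Points of the triangle below `p` are displaced horizontally by at most `p.1 - τ < δ / 2`, so
  -- they are within `δ` of `q` and both maps send them into the chart.
  have hsubball : ∀ b ∈ fwdTriangle τ p.2 p.1, ∀ j, y j b ∈ e.source := by
    intro b hb
    have h1 : b ∈ Metric.ball q δ := by
      rw [Metric.mem_ball, Prod.dist_eq, max_lt_iff, Real.dist_eq, Real.dist_eq] at hpq ⊢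
      obtain ⟨h1, h2⟩ := hb
      have h3 : b.2 - q.2 = (b.2 - p.2) + (p.2 - q.2) := by ring
      have h4 := abs_add_le (b.2 - p.2) (p.2 - q.2)
      have h5 := (abs_lt.1 hpq.1).2
      have h6 := abs_nonneg (b.2 - p.2)
      refine ⟨?_, ?_⟩
      · rw [abs_lt]; constructor <;> linarith
      · rw [h3]; linarith [hpq.2]
    have := hball ⟨h1, hsub hb⟩
    intro j
    fin_cases j
    exacts [this.1, this.2]
  refine wave_unique_chart hB he hpτ (fun j => (hy j).mono hsub) (fun j b hb => hsubball b hb j) ?_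
    ⟨hpτ.le, by simp⟩
  intro b hb hbτ
  have hbT := hsub hb
  have hdiff : ∀ j, DifferentiableWithinAt ℝ (e ∘ y j) T b := fun j =>
    (contDiffWithinAt_chart_comp he ((hy j).1 b hbT) (hsubball b hb j)).differentiableWithinAt
      (by simp)
  have hΔu := uniqueDiffOn_fwdTriangle (x₀ := p.2) hpτ
  refine ⟨hag b hbT hbτ.le, ?_⟩
  -- For `τ > 0` the part of `T` up to the height `τ` is convex with interior, so agreement there
  -- determines the full derivative at `b`. For `τ = 0` it is only a segment: the time derivative
  -- comes from the data and the space derivative from agreement along the segment.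
  rcases hτ.eq_or_lt with hτ0 | hτ0
  · have hb0 : b = (0, b.2) := Prod.ext (by rw [hbτ, ← hτ0]) rfl
    have h10 : fderivWithin ℝ (e ∘ y 0) (fwdTriangle τ p.2 p.1) b (1, 0) =
        fderivWithin ℝ (e ∘ y 1) (fwdTriangle τ p.2 p.1) b (1, 0) := by
      rw [fderivWithin_subset hsub (hΔu b hb) (hdiff 0), fderivWithin_subset hsub (hΔu b hb) (hdiff 1)]
      have h1 : ∀ j, (toCoord e (y j b) (mfderivWithin 𝓘(ℝ, ℝ × ℝ) 𝓘(ℝ, E) (y j) T b (1, 0)) : E)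
          = fderivWithin ℝ (e ∘ y j) T b (1, 0) := fun j =>
        toCoord_mfderivWithin he (((hy j).1 b hbT).mdifferentiableWithinAt (by simp)) (hTu b hbT)
          (hsubball b hb j) _
      rw [← h1, ← h1]
      have h2 := hdata b.2 (by rw [← hb0]; exact hbT)
      rw [← hb0] at h2
      exact congrArg (fun v : TangentBundle 𝓘(ℝ, E) M => (toCoord e v.1 v.2 : E)) h2
    have h01 : fderivWithin ℝ (e ∘ y 0) (fwdTriangle τ p.2 p.1) b (0, 1) =
        fderivWithin ℝ (e ∘ y 1) (fwdTriangle τ p.2 p.1) b (0, 1) := by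
      have hmaps : MapsTo (fun x : ℝ => ((τ, x) : ℝ × ℝ)) (Icc (p.2 - (p.1 - τ)) (p.2 + (p.1 - τ)))
          (fwdTriangle τ p.2 p.1) := by
        intro x hx
        refine ⟨le_rfl, abs_le.2 ⟨?_, ?_⟩⟩ <;> simp only <;> linarith [hx.1, hx.2]
      have hbx : b.2 ∈ Icc (p.2 - (p.1 - τ)) (p.2 + (p.1 - τ)) := by
        have h1 := abs_le.1 hb.2
        rw [hbτ] at h1
        constructor <;> linarith [h1.1, h1.2]
      have hbτ' : (τ, b.2) = b := Prod.ext hbτ.symm rfl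
      have h1 : ∀ j, HasDerivWithinAt (fun x : ℝ => (e ∘ y j) (τ, x))
          (fderivWithin ℝ (e ∘ y j) (fwdTriangle τ p.2 p.1) b (0, 1))
          (Icc (p.2 - (p.1 - τ)) (p.2 + (p.1 - τ))) b.2 := by
        intro j
        have h2 := ((hdiff j).mono hsub).hasFDerivWithinAt
        have h3 : HasDerivWithinAt (fun x : ℝ => ((τ, x) : ℝ × ℝ)) (0, 1)
            (Icc (p.2 - (p.1 - τ)) (p.2 + (p.1 - τ))) b.2 :=
          ((hasDerivAt_const b.2 τ).prodMk (hasDerivAt_id b.2)).hasDerivWithinAt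
        rw [← hbτ'] at h2 ⊢
        exact h2.comp_hasDerivWithinAt b.2 h3 hmaps
      have h2 : UniqueDiffWithinAt ℝ (Icc (p.2 - (p.1 - τ)) (p.2 + (p.1 - τ))) b.2 :=
        uniqueDiffOn_Icc (by linarith) _ hbx
      refine h2.eq_deriv _ (h1 0) ((h1 1).congr ?_ ?_)
      · intro x hx
        simp only [Function.comp_apply]
        rw [hag _ (hsub (hmaps hx)) le_rfl]
      · simp only [Function.comp_apply]
        rw [hag _ (hsub (hmaps hbx)) le_rfl]
    refine ContinuousLinearMap.ext fun u => ?_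
    have hu : u = u.1 • ((1, 0) : ℝ × ℝ) + u.2 • (0, 1) := by ext <;> simp
    rw [hu, map_add, map_add, map_smul, map_smul, map_smul, map_smul, h10, h01]
  · set S : Set (ℝ × ℝ) := T ∩ {p | p.1 ≤ τ} with hS
    have hSu : UniqueDiffOn ℝ S := by
      refine uniqueDiffOn_convex ((convex_fwdTriangle _ _ _).inter
        (convex_halfSpace_le (f := fun p : ℝ × ℝ => p.1) ⟨fun _ _ => rfl, fun _ _ => rfl⟩ τ)) ?_
      rw [interior_inter]
      have hτR : τ < R := by
        have := hpT.2; have := abs_nonneg (p.2 - x₀); linarith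
      refine ⟨(τ / 2, x₀), openTriangle_subset_interior _ _ _ ⟨?_, ?_⟩, ?_⟩
      · simp only; linarith
      · simp only [sub_self, abs_zero]; linarith
      · refine mem_interior_iff_mem_nhds.2 (mem_of_superset ((isOpen_lt continuous_fst
          (continuous_const (y := τ))).mem_nhds (?_ : (τ / 2, x₀).1 < τ)) ?_)
        · simp only; linarith
        · intro p hp
          exact le_of_lt (show p.1 < τ from hp)
    have hbS : b ∈ S := ⟨hbT, hbτ.le⟩
    have h1 : ∀ j, fderivWithin ℝ (e ∘ y j) (fwdTriangle τ p.2 p.1) b =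
        fderivWithin ℝ (e ∘ y j) S b := by
      intro j
      rw [fderivWithin_subset hsub (hΔu b hb) (hdiff j),
        fderivWithin_subset inter_subset_left (hSu b hbS) (hdiff j)]
    rw [h1, h1]
    refine fderivWithin_congr (fun p hp => ?_) ?_
    · simp only [Function.comp_apply]
      rw [hag p hp.1 hp.2]
    · simp only [Function.comp_apply]
      rw [hag b hbT hbτ.le]

/-- Uniqueness of wave maps on a characteristic triangle. -/
theorem wave_unique_fwdTriangle (hB : IsPseudoMetric B) {x₀ R : ℝ} (hR : 0 < R)
    {y : Fin 2 → ℝ × ℝ → M} (hy : ∀ j, IsWave B (fwdTriangle 0 x₀ R) (y j))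
    (hdata : ∀ x, ((0 : ℝ), x) ∈ fwdTriangle 0 x₀ R →
      (⟨y 0 (0, x), mfderivWithin 𝓘(ℝ, ℝ × ℝ) 𝓘(ℝ, E) (y 0) (fwdTriangle 0 x₀ R) (0, x)
        ((1, 0) : ℝ × ℝ)⟩ : TangentBundle 𝓘(ℝ, E) M) =
      ⟨y 1 (0, x), mfderivWithin 𝓘(ℝ, ℝ × ℝ) 𝓘(ℝ, E) (y 1) (fwdTriangle 0 x₀ R) (0, x)
        ((1, 0) : ℝ × ℝ)⟩) : EqOn (y 0) (y 1) (fwdTriangle 0 x₀ R) := by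
  set T := fwdTriangle 0 x₀ R with hT
  -- The heights up to which the maps agree: closed, and extendable to the right below `R`.
  let s : Set ℝ := {τ | ∀ p ∈ T, p.1 ≤ τ → y 0 p = y 1 p}
  have h0 : (0 : ℝ) ∈ s := by
    rintro ⟨t, x⟩ hp ht
    have ht0 : t = 0 := le_antisymm ht hp.1
    subst ht0
    exact congrArg (fun v : TangentBundle 𝓘(ℝ, E) M => v.1) (hdata x hp)
  have hclosed : IsClosed s := by
    refine isClosed_of_closure_subset fun τ hτ p hp hpτ => ?_
    rcases hp.1.eq_or_lt with hp0 | hp0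
    · exact h0 p hp hp0.symm.le
    -- A point at a limiting height is approached from directly below, where agreement is known.
    have hin : ∀ ε ∈ Ioo 0 p.1, ((p.1 - ε, p.2) : ℝ × ℝ) ∈ T ∧ y 0 (p.1 - ε, p.2) = y 1 (p.1 - ε, p.2) := by
      intro ε hε
      have h1 : ((p.1 - ε, p.2) : ℝ × ℝ) ∈ T :=
        ⟨by simp only; linarith [hε.2], by simp only; linarith [hp.2, hε.1]⟩
      refine ⟨h1, ?_⟩
      obtain ⟨τ', hτ', hd⟩ := Metric.mem_closure_iff.1 hτ ε hε.1
      rw [Real.dist_eq, abs_lt] at hd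
      exact hτ' _ h1 (by simp only; linarith [hd.2])
    have htend : Tendsto (fun ε : ℝ => ((p.1 - ε, p.2) : ℝ × ℝ)) (𝓝[>] 0) (𝓝[T] p) := by
      refine tendsto_nhdsWithin_iff.2 ⟨?_, ?_⟩
      · have : Continuous fun ε : ℝ => ((p.1 - ε, p.2) : ℝ × ℝ) := by fun_prop
        have h4 := this.tendsto 0
        simp only [sub_zero] at h4
        exact h4.mono_left nhdsWithin_le_nhds
      · filter_upwards [Ioo_mem_nhdsGT hp0] with ε hε using (hin ε hε).1
    have hc : ∀ j, Tendsto (fun ε : ℝ => y j (p.1 - ε, p.2)) (𝓝[>] 0) (𝓝 (y j p)) := fun j =>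
      ((hy j).1 p hp).continuousWithinAt.tendsto.comp htend
    refine tendsto_nhds_unique ((hc 0).congr' ?_) (hc 1)
    filter_upwards [Ioo_mem_nhdsGT hp0] with ε hε using (hin ε hε).2
  have hstep : ∀ τ ∈ s ∩ Ico 0 R, ∀ τ' ∈ Ioi τ, (s ∩ Ioc τ τ').Nonempty := by
    rintro τ ⟨hτs, hτ⟩ τ' hτ'
    choose! U hUo hqU hU using fun (q : ℝ × ℝ) (hq : q ∈ T ∧ q.1 = τ) =>
      wave_unique_near hB hR hy hdata hτ.1 hτs hq.1 hq.2
    set O := ⋃ q ∈ {q | q ∈ T ∧ q.1 = τ}, U q with hO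
    have hOo : IsOpen O := isOpen_biUnion fun q hq => hUo q hq
    have hOeq : ∀ p ∈ O ∩ T, y 0 p = y 1 p := by
      rintro p ⟨hpO, hpT⟩
      obtain ⟨q, hq, hp⟩ := mem_iUnion₂.1 hpO
      exact hU q hq p ⟨hp, hpT⟩
    -- What is left above the height `τ` outside of the neighbourhood `O` of agreement is compact.
    -- Its lowest point `p₁` is strictly above `τ`, so agreement holds up to halfway between them.
    have hcomp : IsCompact ((T ∩ {p : ℝ × ℝ | τ ≤ p.1}) \ O) :=
      ((isCompact_fwdTriangle 0 x₀ R).inter_right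
        (isClosed_le continuous_const continuous_fst)).diff hOo
    rcases ((T ∩ {p : ℝ × ℝ | τ ≤ p.1}) \ O).eq_empty_or_nonempty with hempty | hne
    · refine ⟨τ', fun p hp _ => ?_, hτ', le_rfl⟩
      rcases le_or_gt p.1 τ with h | h
      · exact hτs p hp h
      · refine hOeq p ⟨?_, hp⟩
        by_contra hpO
        exact (hempty ▸ (⟨⟨hp, h.le⟩, hpO⟩ : p ∈ (T ∩ {p : ℝ × ℝ | τ ≤ p.1}) \ O) : p ∈ (∅ : Set (ℝ × ℝ)))
    · obtain ⟨p₁, hp₁, hmin⟩ := hcomp.exists_isMinOn hne continuous_fst.continuousOn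
      have hp₁τ : τ < p₁.1 := by
        rcases (show τ ≤ p₁.1 from hp₁.1.2).eq_or_lt with h | h
        · exact absurd (mem_iUnion₂.2 ⟨p₁, ⟨hp₁.1.1, h.symm⟩, hqU p₁ ⟨hp₁.1.1, h.symm⟩⟩) hp₁.2
        · exact h
      refine ⟨min τ' ((τ + p₁.1) / 2), fun p hp hple => ?_, lt_min hτ' (by linarith), min_le_left _ _⟩
      rcases le_or_gt p.1 τ with h | h
      · exact hτs p hp h
      · refine hOeq p ⟨?_, hp⟩
        by_contra hpO
        have h1 : p₁.1 ≤ p.1 := hmin (⟨⟨hp, h.le⟩, hpO⟩ : p ∈ (T ∩ {p : ℝ × ℝ | τ ≤ p.1}) \ O)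
        have h2 := hple.trans (min_le_right _ _)
        linarith
  have hall := (hclosed.inter isClosed_Icc).Icc_subset_of_forall_exists_gt h0 hstep
  intro p hp
  exact hall (right_mem_Icc.2 hR.le) p hp (by linarith [hp.2, abs_nonneg (p.2 - x₀)])

end ManifoldUniqueness

/-! ### Uniqueness on characteristically closed sets. -/

section CharClosed

variable {E : Type*} [NormedAddCommGroup E] [NormedSpace ℝ E] [FiniteDimensional ℝ E]
  {M : Type*} [TopologicalSpace M] [ChartedSpace E M] [IsManifold 𝓘(ℝ, E) ∞ M]
  {B : FormField E M}

/-- The initial data `(y, ∂_t y)` at a point, for a map on `D`. -/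
def cauchyData (D : Set (ℝ × ℝ)) (y : ℝ × ℝ → M) (q : ℝ × ℝ) : TangentBundle 𝓘(ℝ, E) M :=
  ⟨y q, mfderivWithin 𝓘(ℝ, ℝ × ℝ) 𝓘(ℝ, E) y D q ((1, 0) : ℝ × ℝ)⟩

/-- The fibrewise multiplication by a scalar. -/
def scaleVec (σ : ℝ) (v : TangentBundle 𝓘(ℝ, E) M) : TangentBundle 𝓘(ℝ, E) M := ⟨v.1, σ • v.2⟩

theorem cauchyData_comp_timeMap {D D' : Set (ℝ × ℝ)} {y : ℝ × ℝ → M} {s₀ σ : ℝ} {q : ℝ × ℝ}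
    (hD : MapsTo (timeMap s₀ σ) D' D) (hD' : UniqueDiffWithinAt ℝ D' q)
    (hy : MDifferentiableWithinAt 𝓘(ℝ, ℝ × ℝ) 𝓘(ℝ, E) y D (timeMap s₀ σ q)) :
    cauchyData (E := E) D' (y ∘ timeMap s₀ σ) q = scaleVec σ (cauchyData D y (timeMap s₀ σ q)) := by
  have h1 := hy.hasMFDerivWithinAt
  have h2 : HasFDerivAt (timeMap s₀ σ)
      ((σ • ContinuousLinearMap.fst ℝ ℝ ℝ).prod (ContinuousLinearMap.snd ℝ ℝ ℝ)) q := by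
    have h3 : HasFDerivAt (fun p : ℝ × ℝ => s₀ + σ * p.1) (σ • ContinuousLinearMap.fst ℝ ℝ ℝ) q :=
      (hasFDerivAt_fst.const_mul σ).const_add s₀
    exact h3.prodMk hasFDerivAt_snd
  have h3 := h1.comp q h2.hasFDerivWithinAt.hasMFDerivWithinAt hD
  have h4 := h3.mfderivWithin hD'.uniqueMDiffWithinAt
  unfold cauchyData scaleVec
  rw [h4]
  congr 1
  have h5 : ((σ, 0) : ℝ × ℝ) = σ • (1, 0) := by simp
  change mfderivWithin 𝓘(ℝ, ℝ × ℝ) 𝓘(ℝ, E) y D (timeMap s₀ σ q)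
    (((σ • ContinuousLinearMap.fst ℝ ℝ ℝ).prod (ContinuousLinearMap.snd ℝ ℝ ℝ)) (1, 0)) = _
  have h6 : ((σ • ContinuousLinearMap.fst ℝ ℝ ℝ).prod (ContinuousLinearMap.snd ℝ ℝ ℝ)) (1, 0)
    = σ • ((1, 0) : ℝ × ℝ) := by simp
  rw [h6]
  exact map_smul _ _ _

variable [T2Space M]

/-- Two wave maps with equal Cauchy data at the height `s₀` agree on the triangles with base at the
height `s₀`. -/
theorem wave_unique_timeMap (hB : IsPseudoMetric B) {s₀ σ : ℝ} (hσ : σ = 1 ∨ σ = -1) {x₀ R : ℝ}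
    (hR : 0 < R) {D : Fin 2 → Set (ℝ × ℝ)}
    (hD : ∀ j, MapsTo (timeMap s₀ σ) (fwdTriangle 0 x₀ R) (D j)) {y : Fin 2 → ℝ × ℝ → M}
    (hy : ∀ j, IsWave B (D j) (y j))
    (hdata : ∀ x, |x - x₀| ≤ R →
      cauchyData (E := E) (D 0) (y 0) (s₀, x) = cauchyData (D 1) (y 1) (s₀, x)) :
    ∀ p ∈ fwdTriangle 0 x₀ R, y 0 (timeMap s₀ σ p) = y 1 (timeMap s₀ σ p) := by
  refine wave_unique_fwdTriangle hB hR (y := fun j => y j ∘ timeMap s₀ σ)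
    (fun j => (hy j).comp_timeMap hB hσ (hD j)) fun x hx => ?_
  have hT := uniqueDiffOn_fwdTriangle (x₀ := x₀) hR (0, x) hx
  have h1 : ∀ j, cauchyData (E := E) (fwdTriangle 0 x₀ R) (y j ∘ timeMap s₀ σ) (0, x) =
      scaleVec σ (cauchyData (D j) (y j) (s₀, x)) := by
    intro j
    rw [cauchyData_comp_timeMap (hD j) hT
      (((hy j).1 _ (hD j hx)).mdifferentiableWithinAt (by simp))]
    simp [timeMap]
  refine (h1 0).trans (Eq.trans ?_ (h1 1).symm)
  rw [hdata x (by simpa using hx.2)]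

theorem IsCharClosed.mapsTo_timeMap {D : Set (ℝ × ℝ)} (hD : IsCharClosed D) {σ : ℝ}
    (hσ : σ = 1 ∨ σ = -1) {x₀ R : ℝ} (hR : 0 ≤ R) (hp : (σ * R, x₀) ∈ D) :
    MapsTo (timeMap 0 σ) (fwdTriangle 0 x₀ R) D := by
  rintro ⟨t, x⟩ ⟨h1, h2⟩
  simp only at h1 h2
  have h3 := abs_nonneg (x - x₀)
  refine hD _ hp ⟨?_, ?_⟩
  · rcases hσ with rfl | rfl
    · simp only [timeMap, one_mul, zero_add]
      rw [uIcc_of_le hR]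
      exact ⟨h1, by linarith⟩
    · simp only [timeMap, neg_mul, one_mul, zero_add]
      rw [uIcc_of_ge (by linarith)]
      exact ⟨by linarith, by linarith⟩
  · have hs : |σ| = 1 := by rcases hσ with rfl | rfl <;> simp
    simp only [timeMap, zero_add, abs_mul, hs, one_mul, abs_of_nonneg h1, abs_of_nonneg hR]
    exact h2

/-- Uniqueness of wave maps with given Cauchy data on the axis. -/
theorem wave_unique (hB : IsPseudoMetric B) {k : ℝ → TangentBundle 𝓘(ℝ, E) M} {D : Set (ℝ × ℝ)}
    (hD : IsCharClosed D) {y : Fin 2 → ℝ × ℝ → M} (hy : ∀ j, IsWave B D (y j))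
    (hk : ∀ j, HasData k D (y j)) : EqOn (y 0) (y 1) D := by
  -- The sign `σ` treats future and past together: the triangle of `(σ * R, x₀)` is the image of a
  -- forward triangle under `timeMap 0 σ`.
  have hpos : ∀ σ : ℝ, (σ = 1 ∨ σ = -1) → ∀ R x₀ : ℝ, 0 < R → (σ * R, x₀) ∈ D →
      y 0 (σ * R, x₀) = y 1 (σ * R, x₀) := by
    intro σ hσ R x₀ hR hp
    have hm := hD.mapsTo_timeMap hσ hR.le hp
    have h1 := wave_unique_timeMap hB hσ hR (D := fun _ => D) (fun _ => hm) hy (fun x hx => ?_)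
      (R, x₀) ⟨hR.le, by simp⟩
    · simpa [timeMap] using h1
    · have h0 : ((0 : ℝ), x) ∈ D := by
        have := hm (show (0, x) ∈ fwdTriangle 0 x₀ R from ⟨le_rfl, by simpa using hx⟩)
        simpa [timeMap] using this
      exact (hk 0 x h0).trans (hk 1 x h0).symm
  rintro ⟨t, x₀⟩ hp
  rcases lt_trichotomy t 0 with ht | rfl | ht
  · have := hpos (-1) (Or.inr rfl) (-t) x₀ (by linarith)
    simp only [neg_mul, one_mul, neg_neg] at this
    exact this hp
  · exact congrArg (fun v : TangentBundle 𝓘(ℝ, E) M => v.1) ((hk 0 x₀ hp).trans (hk 1 x₀ hp).symm)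
  · have := hpos 1 (Or.inl rfl) t x₀ ht
    simp only [one_mul] at this
    exact this hp

end CharClosed

/-! ### Local existence on the manifold, with a uniform size of the domain. -/

section LocalExistence

/-- A continuous curve stays in a closed subset `S` of an open set `W` if it cannot reach a point
outside of `S` without leaving `W` first. -/
theorem forall_mem_of_confined {X : Type*} [TopologicalSpace X] {S W : Set X} (hS : IsClosed S)
    (hW : IsOpen W) (hSW : S ⊆ W) {b : ℝ} {c : ℝ → X} (hc : ContinuousOn c (Icc 0 b))
    (h0 : c 0 ∈ W) (hstep : ∀ t ∈ Icc 0 b, (∀ s ∈ Icc 0 t, c s ∈ W) → c t ∈ S) :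
    ∀ t ∈ Icc 0 b, c t ∈ S := by
  suffices h : ∀ t ∈ Icc 0 b, c t ∈ W from
    fun t ht => hstep t ht fun s hs => h s ⟨hs.1, hs.2.trans ht.2⟩
  by_contra! hcon
  obtain ⟨t₁, ht₁, ht₁W⟩ := hcon
  have hbad : IsCompact (Icc 0 b ∩ c ⁻¹' Wᶜ) :=
    isCompact_Icc.of_isClosed_subset
      (hc.preimage_isClosed_of_isClosed isClosed_Icc hW.isClosed_compl) inter_subset_left
  -- The first exit time from `W`. Before it the curve is in `S`, and since `S` is closed it is
  -- still in `S ⊆ W` at the time `τ`, a contradiction.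
  obtain ⟨τ, hτ, hmin⟩ := hbad.exists_isMinOn ⟨t₁, ht₁, ht₁W⟩ continuousOn_id
  have hτ0 : 0 < τ := by
    rcases hτ.1.1.eq_or_lt with h | h
    · exact absurd (h ▸ h0) hτ.2
    · exact h
  have hbelow : ∀ s ∈ Ico 0 τ, c s ∈ W := by
    intro s hs
    by_contra hsW
    have : τ ≤ s := hmin (⟨⟨hs.1, hs.2.le.trans hτ.1.2⟩, hsW⟩ : s ∈ Icc 0 b ∩ c ⁻¹' Wᶜ)
    exact absurd hs.2 (not_lt.2 this)
  have hcl : IsClosed (Icc 0 b ∩ c ⁻¹' S) := hc.preimage_isClosed_of_isClosed isClosed_Icc hS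
  have hsub : Ico 0 τ ⊆ Icc 0 b ∩ c ⁻¹' S := fun s hs =>
    ⟨⟨hs.1, hs.2.le.trans hτ.1.2⟩, hstep s ⟨hs.1, hs.2.le.trans hτ.1.2⟩
      fun r hr => hbelow r ⟨hr.1, hr.2.trans_lt hs.2⟩⟩
  have h1 : τ ∈ closure (Ico 0 τ) := by
    rw [closure_Ico hτ0.ne]
    exact right_mem_Icc.2 hτ0.le
  exact hτ.2 (hSW (hcl.closure_subset_iff.2 hsub h1).2)

universe u

variable {E : Type u} [NormedAddCommGroup E] [NormedSpace ℝ E] [FiniteDimensional ℝ E]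
  {M : Type*} [TopologicalSpace M] [ChartedSpace E M] [IsManifold 𝓘(ℝ, E) ∞ M]
  {B : FormField E M} {e : OpenPartialHomeomorph M E}

theorem formField_eq_coordForm (B : FormField E M) (he : e ∈ IsManifold.maximalAtlas 𝓘(ℝ, E) ∞ M)
    {p : M} (hp : p ∈ e.source) (v w : TangentSpace 𝓘(ℝ, E) p) :
    B p v w = coordForm B e (e p) (toCoord e p v) (toCoord e p w) := by
  rw [coordForm_apply]
  have h1 := fromCoord_toCoord he hp v
  have h2 := fromCoord_toCoord he hp w
  have h3 := formField_congr B (e.left_inv hp) (fromCoord e (e p) (toCoord e p v))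
    (fromCoord e (e p) (toCoord e p w))
  refine Eq.trans ?_ h3.symm
  exact (congrArg₂ (fun a b : E => (B p : E →L[ℝ] E →L[ℝ] ℝ) a b) h1 h2).symm

theorem vnorm_eq_coordForm (h : RiemMetric E M) (he : e ∈ IsManifold.maximalAtlas 𝓘(ℝ, E) ∞ M)
    {p : M} (hp : p ∈ e.source) (v : TangentSpace 𝓘(ℝ, E) p) :
    vnorm h v = √(coordForm h.inner e (e p) (toCoord e p v) (toCoord e p v)) := by
  unfold vnorm
  rw [formField_eq_coordForm h.inner he hp]

theorem coordForm_pos (h : RiemMetric E M) (he : e ∈ IsManifold.maximalAtlas 𝓘(ℝ, E) ∞ M)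
    {z : E} (hz : z ∈ e.target) {w : E} (hw : w ≠ 0) : 0 < coordForm h.inner e z w w := by
  rw [coordForm_apply]
  refine h.pos _ _ fun h0 => hw ?_
  have h1 := toCoord_fromCoord he hz w
  rw [h0, map_zero] at h1
  exact h1.symm

theorem coordForm_nonneg (h : RiemMetric E M) (he : e ∈ IsManifold.maximalAtlas 𝓘(ℝ, E) ∞ M)
    {z : E} (hz : z ∈ e.target) (w : E) : 0 ≤ coordForm h.inner e z w w := by
  rcases eq_or_ne w 0 with rfl | hw
  · simp
  · exact (coordForm_pos h he hz hw).le

/-- The minimum over the compact product of `K` with the unit sphere is positive, and both sides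
scale alike. It turns bounds measured by `h` into bounds in the norm of `E`. -/
theorem exists_norm_le_of_pos {F : E → E →L[ℝ] E →L[ℝ] ℝ} {K : Set E} (hK : IsCompact K)
    (hF : ContinuousOn F K) (hpos : ∀ z ∈ K, ∀ w : E, w ≠ 0 → 0 < F z w w) :
    ∃ m > 0, ∀ z ∈ K, ∀ w : E, m * ‖w‖ ≤ √(F z w w) := by
  have : ProperSpace E := FiniteDimensional.proper ℝ E
  have hcont : ContinuousOn (fun q : E × E => √(F q.1 q.2 q.2)) (K ×ˢ Metric.sphere (0 : E) 1) := by
    refine Real.continuous_sqrt.comp_continuousOn ?_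
    have h1 : ContinuousOn (fun q : E × E => F q.1) (K ×ˢ Metric.sphere (0 : E) 1) :=
      hF.comp continuousOn_fst fun q hq => hq.1
    exact (h1.clm_apply continuousOn_snd).clm_apply continuousOn_snd
  have hsph : ∀ w : E, w ≠ 0 → ‖w‖⁻¹ • w ∈ Metric.sphere (0 : E) 1 := by
    intro w hw
    rw [mem_sphere_iff_norm, sub_zero, norm_smul, norm_inv, norm_norm]
    exact inv_mul_cancel₀ (norm_ne_zero_iff.2 hw)
  obtain ⟨m, hm, hmin⟩ : ∃ m > 0, ∀ q ∈ K ×ˢ Metric.sphere (0 : E) 1, m ≤ √(F q.1 q.2 q.2) := by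
    rcases (K ×ˢ Metric.sphere (0 : E) 1).eq_empty_or_nonempty with hemp | hne
    · rw [hemp]
      exact ⟨1, one_pos, fun q hq => absurd hq (notMem_empty q)⟩
    · obtain ⟨q, hq, hmin⟩ := (hK.prod (isCompact_sphere 0 1)).exists_isMinOn hne hcont
      have hq2 : q.2 ≠ 0 := by
        intro h0
        have := hq.2
        rw [h0] at this
        simp at this
      exact ⟨_, Real.sqrt_pos.2 (hpos q.1 hq.1 q.2 hq2), fun q' hq' => isMinOn_iff.1 hmin q' hq'⟩
  refine ⟨m, hm, fun z hz w => ?_⟩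
  rcases eq_or_ne w 0 with rfl | hw
  · simp
  have hn : 0 < ‖w‖ := norm_pos_iff.2 hw
  have h2 := hmin (z, ‖w‖⁻¹ • w) ⟨hz, hsph w hw⟩
  have h3 : √(F z (‖w‖⁻¹ • w) (‖w‖⁻¹ • w)) = ‖w‖⁻¹ * √(F z w w) := by
    rw [map_smul, map_smul, smul_apply, smul_eq_mul, smul_eq_mul, ← mul_assoc,
      Real.sqrt_mul (by positivity), Real.sqrt_mul_self (by positivity)]
  simp only [h3] at h2
  calc m * ‖w‖ ≤ (‖w‖⁻¹ * √(F z w w)) * ‖w‖ := by gcongr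
    _ = _ := by field_simp

theorem exists_norm_le_coordForm (h : RiemMetric E M)
    (he : e ∈ IsManifold.maximalAtlas 𝓘(ℝ, E) ∞ M) {K : Set E} (hK : IsCompact K)
    (hKt : K ⊆ e.target) :
    ∃ m > 0, ∀ z ∈ K, ∀ w : E, m * ‖w‖ ≤ √(coordForm h.inner e z w w) :=
  exists_norm_le_of_pos hK ((contDiffOn_coordForm h.isPseudoMetric he).continuousOn.mono hKt)
    fun _ hz _ hw => coordForm_pos h he (hKt hz) hw

theorem tangentBundle_ext (he : e ∈ IsManifold.maximalAtlas 𝓘(ℝ, E) ∞ M)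
    {v w : TangentBundle 𝓘(ℝ, E) M} (hv : v.1 ∈ e.source) (h1 : v.1 = w.1)
    (h2 : (toCoord e v.1 v.2 : E) = toCoord e w.1 w.2) : v = w := by
  obtain ⟨p, v⟩ := v
  obtain ⟨q, w⟩ := w
  simp only at h1
  subst h1
  have : v = w := toCoord_injective he hv h2
  rw [this]

theorem contDiffOn_toCoord_comp (he : e ∈ IsManifold.maximalAtlas 𝓘(ℝ, E) ∞ M)
    {κ : ℝ → TangentBundle 𝓘(ℝ, E) M} {J : Set ℝ}
    (hκ : ContMDiffOn 𝓘(ℝ, ℝ) 𝓘(ℝ, E).tangent ∞ κ J) (hJ : ∀ x ∈ J, (κ x).1 ∈ e.source) :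
    ContDiffOn ℝ ∞ (fun x => (toCoord e (κ x).1 (κ x).2 : E)) J := by
  have h1 := (contMDiffOn_chart he).contMDiffOn_tangentMapWithin (m := ∞) (by simp)
    e.open_source.uniqueMDiffOn
  have h2 := h1.comp hκ (fun x hx => hJ x hx)
  have h3 := (contMDiff_snd_tangentBundle_modelSpace E 𝓘(ℝ, E) (n := ∞)).comp_contMDiffOn h2
  refine (contMDiffOn_iff_contDiffOn.1 h3).congr fun x hx => ?_
  change mfderiv 𝓘(ℝ, E) 𝓘(ℝ, E) e (κ x).1 (κ x).2 =
    mfderivWithin 𝓘(ℝ, E) 𝓘(ℝ, E) e e.source (κ x).1 (κ x).2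
  rw [mfderivWithin_of_isOpen e.open_source (hJ x hx)]

variable [T2Space M]

/-- Local existence of wave maps, with a size of the domain that depends only on a bound for the
data and is locally uniform in the initial point. -/
theorem exists_local_wave (hB : IsPseudoMetric B) (h : RiemMetric E M) (q : M) (C : ℝ) :
    ∃ N ∈ 𝓝 q, ∃ ε > 0, ∀ (x₀ ρ : ℝ) (κ : ℝ → TangentBundle 𝓘(ℝ, E) M) (J : Set ℝ), 0 < ρ → ρ ≤ ε →
      IsOpen J → Icc (x₀ - ρ) (x₀ + ρ) ⊆ J → ContMDiffOn 𝓘(ℝ, ℝ) 𝓘(ℝ, E).tangent ∞ κ J →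
      (κ x₀).1 ∈ N → (∀ x ∈ Icc (x₀ - ρ) (x₀ + ρ), vnorm h (κ x).2 ≤ C ∧
        vnorm h (velocity E (fun x => (κ x).1) x) ≤ C) →
      ∃ y : ℝ × ℝ → M, IsWave B (diamond 0 x₀ ρ) y ∧
        ∀ x, |x - x₀| < ρ → cauchyData (diamond 0 x₀ ρ) y (0, x) = κ x := by
  have : ProperSpace E := FiniteDimensional.proper ℝ E
  set e := chartAt E q with hedef
  have he : e ∈ IsManifold.maximalAtlas 𝓘(ℝ, E) ∞ M := IsManifold.chart_mem_maximalAtlas _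
  have hq : q ∈ e.source := mem_chart_source E q
  have hz₀ : e q ∈ e.target := e.map_source hq
  obtain ⟨r₁, hr₁, hr₁t⟩ := Metric.nhds_basis_closedBall.mem_iff.1 (e.open_target.mem_nhds hz₀)
  obtain ⟨m, hm, hmle⟩ := exists_norm_le_coordForm h he (isCompact_closedBall _ _) hr₁t
  have hC' : 0 ≤ |C| / m := by positivity
  obtain ⟨r, hr, ε₀, hε₀, hsol⟩ := exists_coordinate_wave e.open_target
    (contDiffOn_christoffelL hB he) hz₀ hC'
  -- The base curve starts within `r₁ / 2` of `e q` in coordinates. Its coordinate speed is at most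
  -- `|C| / m`, so it moves by at most `r₁ / 4` and stays in the ball of radius `3 * r₁ / 4`. The
  -- absolute value is there because `C` has no assumed sign.
  refine ⟨e.source ∩ e ⁻¹' Metric.ball (e q) (min r (r₁ / 2)),
    (e.isOpen_inter_preimage Metric.isOpen_ball).mem_nhds
      ⟨hq, Metric.mem_ball_self (by positivity)⟩,
    min ε₀ (r₁ / (4 * (|C| / m + 1))), by positivity, ?_⟩
  intro x₀ ρ κ J hρ hρε hJ hIJ hκ hκN hκb
  have hc : ContMDiffOn 𝓘(ℝ, ℝ) 𝓘(ℝ, E) ∞ (fun x => (κ x).1) J :=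
    (Bundle.contMDiff_proj (TangentSpace 𝓘(ℝ, E) (M := M))).comp_contMDiffOn hκ
  set c : ℝ → M := fun x => (κ x).1 with hcdef
  have hcd : ∀ x ∈ J, ContMDiffAt 𝓘(ℝ, ℝ) 𝓘(ℝ, E) ∞ c x := fun x hx =>
    hc.contMDiffAt (hJ.mem_nhds hx)
  set W := e.source ∩ e ⁻¹' Metric.ball (e q) r₁ with hW
  have hWo : IsOpen W := e.isOpen_inter_preimage Metric.isOpen_ball
  have hx₀ρ : ∀ σ : ℝ, (σ = 1 ∨ σ = -1) → ∀ s ∈ Icc 0 ρ, x₀ + σ * s ∈ Icc (x₀ - ρ) (x₀ + ρ) := by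
    rintro σ (rfl | rfl) s ⟨h1, h2⟩ <;> constructor <;> linarith
  have hderiv : ∀ x ∈ Icc (x₀ - ρ) (x₀ + ρ), c x ∈ W → ‖deriv (e ∘ c) x‖ ≤ |C| / m := by
    intro x hx hxW
    rw [le_div_iff₀' hm, ← toCoord_velocity he ((hcd x (hIJ hx)).mdifferentiableAt (by simp)) hxW.1]
    refine (hmle _ (Metric.ball_subset_closedBall hxW.2) _).trans ?_
    refine (vnorm_eq_coordForm h he hxW.1 (velocity E c x)).symm.le.trans ?_
    exact (hκb x hx).2.trans (le_abs_self C)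
  -- The bound on the coordinate speed presupposes that the curve is in the chart, so
  -- `forall_mem_of_confined` is needed to avoid circularity. The sign `σ` covers both sides of
  -- `x₀`.
  have hstay : ∀ x ∈ Icc (x₀ - ρ) (x₀ + ρ), c x ∈ W := by
    have hS : IsCompact (e.symm '' Metric.closedBall (e q) (3 * r₁ / 4)) :=
      (isCompact_closedBall _ _).image_of_continuousOn (e.continuousOn_symm.mono
        ((Metric.closedBall_subset_closedBall (by linarith)).trans hr₁t))
    have hSW : e.symm '' Metric.closedBall (e q) (3 * r₁ / 4) ⊆ W := by
      rintro _ ⟨z, hz, rfl⟩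
      have hzt : z ∈ e.target := hr₁t (Metric.closedBall_subset_closedBall (by linarith) hz)
      refine ⟨e.map_target hzt, ?_⟩
      rw [mem_preimage, e.right_inv hzt]
      exact Metric.closedBall_subset_ball (by linarith) hz
    have key : ∀ σ : ℝ, (σ = 1 ∨ σ = -1) → ∀ s ∈ Icc 0 ρ, c (x₀ + σ * s) ∈ W := by
      intro σ hσ
      have hline : Continuous fun s : ℝ => x₀ + σ * s := by fun_prop
      have hmaps : MapsTo (fun s : ℝ => x₀ + σ * s) (Icc 0 ρ) J := fun s hs => hIJ (hx₀ρ σ hσ s hs)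
      have h0 : c (x₀ + σ * 0) ∈ W := by
        rw [mul_zero, add_zero]
        exact ⟨hκN.1, Metric.ball_subset_ball ((min_le_right _ _).trans (by linarith)) hκN.2⟩
      intro s hs
      refine hSW (forall_mem_of_confined hS.isClosed hWo hSW
        (c := fun s => c (x₀ + σ * s)) (hc.continuousOn.comp hline.continuousOn hmaps) h0 ?_ s hs)
      intro t ht hall
      have hd : ∀ s ∈ Icc 0 t, HasDerivWithinAt (fun s => (e ∘ c) (x₀ + σ * s))
          (σ • deriv (e ∘ c) (x₀ + σ * s)) (Icc 0 t) s := by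
        intro s hs
        have h1 : DifferentiableAt ℝ (e ∘ c) (x₀ + σ * s) :=
          (contDiffAt_chart_comp le_rfl he (hcd _ (hmaps ⟨hs.1, hs.2.trans ht.2⟩))
            (hall s hs).1).differentiableAt (by simp)
        have h2 : HasDerivAt (fun s : ℝ => x₀ + σ * s) σ s := by
          simpa using ((hasDerivAt_id s).const_mul σ).const_add x₀
        exact (HasDerivAt.scomp s h1.hasDerivAt h2).hasDerivWithinAt
      have hb : ∀ s ∈ Ico 0 t, ‖σ • deriv (e ∘ c) (x₀ + σ * s)‖ ≤ |C| / m := by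
        intro s hs
        have hσ1 : ‖σ‖ = 1 := by rcases hσ with rfl | rfl <;> simp
        rw [norm_smul, hσ1, one_mul]
        exact hderiv _ (hx₀ρ σ hσ s ⟨hs.1, hs.2.le.trans ht.2⟩) (hall s ⟨hs.1, hs.2.le⟩)
      have h3 := norm_image_sub_le_of_norm_deriv_le_segment' hd hb t ⟨ht.1, le_rfl⟩
      simp only [mul_zero, add_zero, sub_zero] at h3
      have h4 : ‖(e ∘ c) x₀ - e q‖ < r₁ / 2 := by
        have := hκN.2
        rw [mem_preimage, mem_ball_iff_norm] at this
        exact this.trans_le (min_le_right _ _)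
      have h5 : |C| / m * t ≤ r₁ / 4 := by
        have h6 : ρ ≤ r₁ / (4 * (|C| / m + 1)) := hρε.trans (min_le_right _ _)
        rw [le_div_iff₀ (by positivity)] at h6
        nlinarith [ht.1, ht.2]
      refine ⟨e (c (x₀ + σ * t)), ?_, e.left_inv (hall t ⟨ht.1, le_rfl⟩).1⟩
      rw [mem_closedBall_iff_norm]
      have h7 := norm_add_le ((e ∘ c) (x₀ + σ * t) - (e ∘ c) x₀) ((e ∘ c) x₀ - e q)
      rw [sub_add_sub_cancel] at h7
      simp only [Function.comp_apply] at h7 h3 h4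
      linarith
    intro x hx
    rcases le_total x₀ x with hxx | hxx
    · have := key 1 (Or.inl rfl) (x - x₀) ⟨by linarith, by linarith [hx.2]⟩
      simpa using this
    · have := key (-1) (Or.inr rfl) (x₀ - x) ⟨by linarith, by linarith [hx.1]⟩
      simpa using this
  have hJ' : IsOpen (J ∩ c ⁻¹' W) := hc.continuousOn.isOpen_inter_preimage hJ hWo
  obtain ⟨z, hz, hzO, hzeq, hzdata⟩ := hsol x₀ ρ (e ∘ c) (fun x => toCoord e (κ x).1 (κ x).2)
    (J ∩ c ⁻¹' W) (hρε.trans (min_le_left _ _)) hJ' (fun x hx => ⟨hIJ hx, hstay x hx⟩)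
    (fun x hx => (contDiffAt_chart_comp le_rfl he (hcd x hx.1) hx.2.1).contDiffWithinAt)
    (contDiffOn_toCoord_comp he (hκ.mono inter_subset_left) fun x hx => hx.2.1)
    (by
      have := hκN.2
      rw [mem_preimage, mem_ball_iff_norm] at this
      exact this.trans_le (min_le_left _ _))
    (fun x hx => ⟨hderiv x hx (hstay x hx), by
      rw [le_div_iff₀' hm]
      refine (hmle _ (Metric.ball_subset_closedBall (hstay x hx).2) _).trans ?_
      refine (vnorm_eq_coordForm h he (hstay x hx).1 (κ x).2).symm.le.trans ?_
      exact (hκb x hx).1.trans (le_abs_self C)⟩)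
  have hDo := isOpen_diamond 0 x₀ ρ
  have hy : ContMDiffOn 𝓘(ℝ, ℝ × ℝ) 𝓘(ℝ, E) ∞ (e.symm ∘ z) (diamond 0 x₀ ρ) :=
    (contMDiffOn_chart_symm he).comp (contMDiffOn_iff_contDiffOn.2 hz) hzO
  have heq : ∀ p ∈ diamond 0 x₀ ρ, e ∘ (e.symm ∘ z) =ᶠ[𝓝 p] z := by
    intro p hp
    filter_upwards [hDo.mem_nhds hp] with p' hp'
    exact e.right_inv (hzO p' hp')
  have hsrc : ∀ p ∈ diamond 0 x₀ ρ, (e.symm ∘ z) p ∈ e.source := fun p hp =>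
    e.map_target (hzO p hp)
  refine ⟨e.symm ∘ z, ⟨hy, fun p hp => ?_⟩, fun x hx => ?_⟩
  · have hp' := interior_subset hp
    refine (waveAt_iff hB he ((hy.contMDiffAt (hDo.mem_nhds hp')).of_le ENat.LEInfty.out)
      (hsrc p hp')).2 ?_
    rw [coordHess_congr (heq p hp')]
    exact hzeq p hp'
  · have hxD : ((0 : ℝ), x) ∈ diamond 0 x₀ ρ := by simpa [diamond] using hx
    have h1 : (cauchyData (E := E) (diamond 0 x₀ ρ) (e.symm ∘ z) (0, x)).1 = (κ x).1 := by
      change e.symm (z (0, x)) = (κ x).1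
      rw [(hzdata x hx).1]
      refine e.left_inv (hstay x ?_).1
      have := abs_lt.1 hx
      constructor <;> linarith [this.1, this.2]
    refine tangentBundle_ext he (hsrc _ hxD) h1 ?_
    refine (toCoord_mfderivWithin he ((hy _ hxD).mdifferentiableWithinAt (by simp))
      (hDo.uniqueDiffWithinAt hxD) (hsrc _ hxD) _).trans ?_
    rw [fderivWithin_of_isOpen hDo hxD, (heq _ hxD).fderiv_eq, (hzdata x hx).2]

end LocalExistence

/-! ### Geodesics and their uniqueness. -/

section Geodesics

universe u

variable {E : Type u} [NormedAddCommGroup E] [NormedSpace ℝ E] [FiniteDimensional ℝ E]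
  {M : Type*} [TopologicalSpace M] [ChartedSpace E M] [IsManifold 𝓘(ℝ, E) ∞ M]
  {B : FormField E M} {e : OpenPartialHomeomorph M E}

theorem covDeriv_velocity_eq_zero_iff (hB : IsPseudoMetric B)
    (he : e ∈ IsManifold.maximalAtlas 𝓘(ℝ, E) ∞ M) {γ : ℝ → M} {s : ℝ}
    (hγ : ContMDiffAt 𝓘(ℝ, ℝ) 𝓘(ℝ, E) ∞ γ s) (hs : γ s ∈ e.source) :
    covDeriv B γ (velocity E γ) s = 0 ↔ coordHess B e (e ∘ γ) s 1 1 = 0 := by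
  rw [← toCoord_covDeriv_velocity (c := γ) hB he (hγ.of_le ENat.LEInfty.out) hs]
  refine ⟨fun h => by rw [h]; exact map_zero _, fun h => toCoord_injective he hs ?_⟩
  rw [h]
  exact (map_zero (toCoord e (γ s))).symm

/-- A geodesic of `B`, defined on an open set of parameters. -/
structure IsGeodesic (B : FormField E M) (J : Set ℝ) (γ : ℝ → M) : Prop where
  isOpen : IsOpen J
  smooth : ContMDiffOn 𝓘(ℝ, ℝ) 𝓘(ℝ, E) ∞ γ J
  eq_zero : ∀ s ∈ J, covDeriv B γ (velocity E γ) s = 0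

theorem IsGeodesic.contMDiffAt {J : Set ℝ} {γ : ℝ → M} (h : IsGeodesic B J γ) {s : ℝ} (hs : s ∈ J) :
    ContMDiffAt 𝓘(ℝ, ℝ) 𝓘(ℝ, E) ∞ γ s := h.smooth.contMDiffAt (h.isOpen.mem_nhds hs)

theorem IsGeodesic.coordHess_eq_zero {J : Set ℝ} {γ : ℝ → M} (h : IsGeodesic B J γ)
    (hB : IsPseudoMetric B) (he : e ∈ IsManifold.maximalAtlas 𝓘(ℝ, E) ∞ M) {s : ℝ} (hs : s ∈ J)
    (hse : γ s ∈ e.source) : coordHess B e (e ∘ γ) s 1 1 = 0 :=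
  (covDeriv_velocity_eq_zero_iff hB he (h.contMDiffAt hs) hse).1 (h.eq_zero s hs)

/-- The initial position and velocity of a curve. -/
def initialVec (γ : ℝ → M) : TangentBundle 𝓘(ℝ, E) M := ⟨γ 0, velocity E γ 0⟩

/-- A wave map that does not depend on `x` is a geodesic in `t`. Thus uniqueness of geodesics is a
special case of uniqueness of wave maps. -/
theorem IsGeodesic.isWave {J : Set ℝ} {γ : ℝ → M} (h : IsGeodesic B J γ) (hB : IsPseudoMetric B) :
    IsWave B {p : ℝ × ℝ | p.1 ∈ J} (fun p => γ p.1) := by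
  have hs : ContMDiffOn 𝓘(ℝ, ℝ × ℝ) 𝓘(ℝ, E) ∞ (fun p : ℝ × ℝ => γ p.1) {p : ℝ × ℝ | p.1 ∈ J} :=
    h.smooth.comp contDiff_fst.contMDiff.contMDiffOn fun p hp => hp
  refine ⟨hs, fun p hp => ?_⟩
  have hp : p.1 ∈ J := (show p ∈ {p : ℝ × ℝ | p.1 ∈ J} from interior_subset hp)
  have he : chartAt E (γ p.1) ∈ IsManifold.maximalAtlas 𝓘(ℝ, E) ∞ M :=
    IsManifold.chart_mem_maximalAtlas _
  have h1 := coordHess_comp_affine (B := B) (e := chartAt E (γ p.1)) (z := chartAt E (γ p.1) ∘ γ)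
    (ℓ := fun p : ℝ × ℝ => p.1) (L := ContinuousLinearMap.fst ℝ ℝ ℝ) (q := 0) (fun s => by simp)
    (s := p) (contDiffAt_chart_comp ENat.LEInfty.out he
      ((h.contMDiffAt hp).of_le ENat.LEInfty.out) (mem_chart_source E _)) (1, 1) (1, -1)
  refine h1.trans ?_
  simpa using h.coordHess_eq_zero hB he hp (mem_chart_source E _)

/-- The triangle with apex `(1, 0)` contains the segment from `(0, 0)` to `(1, 0)`, on which the
associated wave maps are the geodesics. -/
theorem geodesic_unique [T2Space M] (hB : IsPseudoMetric B) {J : Fin 2 → Set ℝ}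
    {γ : Fin 2 → ℝ → M} (hγ : ∀ j, IsGeodesic B (J j) (γ j)) (hJ : ∀ j, Icc 0 1 ⊆ J j)
    (h0 : initialVec (E := E) (γ 0) = initialVec (γ 1)) : EqOn (γ 0) (γ 1) (Icc 0 1) := by
  have hdata : ∀ j x, cauchyData (E := E) {p : ℝ × ℝ | p.1 ∈ J j} (fun p => γ j p.1) (0, x) =
      initialVec (γ j) := by
    intro j x
    have h0J : (0 : ℝ) ∈ J j := hJ j (left_mem_Icc.2 zero_le_one)
    have hopen : IsOpen {p : ℝ × ℝ | p.1 ∈ J j} := (hγ j).isOpen.preimage continuous_fst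
    have h1 := (((hγ j).contMDiffAt h0J).mdifferentiableAt (by simp)).hasMFDerivAt.comp
      ((0 : ℝ), x) (hasFDerivAt_fst (𝕜 := ℝ) (p := ((0 : ℝ), x))).hasMFDerivAt
    have h2 := h1.hasMFDerivWithinAt.mfderivWithin
      (hopen.uniqueDiffWithinAt (𝕜 := ℝ) (x := ((0 : ℝ), x)) h0J).uniqueMDiffWithinAt
    unfold cauchyData initialVec
    refine congrArg (fun v : TangentSpace 𝓘(ℝ, E) (γ j 0) =>
      (⟨γ j 0, v⟩ : TangentBundle 𝓘(ℝ, E) M)) ?_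
    exact congrArg (fun L : ℝ × ℝ →L[ℝ] E => L (1, 0)) h2
  intro s hs
  have h1 := wave_unique_timeMap hB (s₀ := 0) (σ := 1) (Or.inl rfl) (x₀ := 0) (R := 1) one_pos
    (D := fun j => {p : ℝ × ℝ | p.1 ∈ J j}) (y := fun j p => γ j p.1) ?_
    (fun j => (hγ j).isWave hB) (fun x _ => by rw [hdata, hdata, h0]) (s, 0) ⟨hs.1, ?_⟩
  · simpa [timeMap] using h1
  · rintro j ⟨t, x⟩ ⟨ht1, ht2⟩
    have := abs_nonneg (x - 0)
    simp only at ht1 ht2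
    refine hJ j ?_
    simp only [timeMap, zero_add, one_mul]
    constructor <;> linarith
  · simp only [sub_zero, abs_zero]
    linarith [hs.2]

theorem IsGeodesic.comp_mul {J : Set ℝ} {γ : ℝ → M} (h : IsGeodesic B J γ) (hB : IsPseudoMetric B)
    (a : ℝ) : IsGeodesic B {s | a * s ∈ J} (fun s => γ (a * s)) := by
  have hl : ContDiff ℝ ∞ fun s : ℝ => a * s := by fun_prop
  refine ⟨h.isOpen.preimage hl.continuous,
    h.smooth.comp hl.contMDiff.contMDiffOn fun s hs => hs, fun s hs => ?_⟩
  have he : chartAt E (γ (a * s)) ∈ IsManifold.maximalAtlas 𝓘(ℝ, E) ∞ M :=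
    IsManifold.chart_mem_maximalAtlas _
  have hs' : γ (a * s) ∈ (chartAt E (γ (a * s))).source := mem_chart_source E _
  refine (covDeriv_velocity_eq_zero_iff (γ := fun s => γ (a * s)) hB he
    ((h.contMDiffAt hs).comp s hl.contMDiff.contMDiffAt) hs').2 ?_
  have h1 := coordHess_comp_affine (B := B) (e := chartAt E (γ (a * s)))
    (z := chartAt E (γ (a * s)) ∘ γ) (ℓ := fun s : ℝ => a * s)
    (L := a • ContinuousLinearMap.id ℝ ℝ) (q := 0) (fun s => by simp)
    (s := s) (contDiffAt_chart_comp ENat.LEInfty.out he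
      ((h.contMDiffAt hs).of_le ENat.LEInfty.out) hs') 1 1
  refine h1.trans ?_
  have h2 := h.coordHess_eq_zero hB he hs hs'
  have h3 : (a • ContinuousLinearMap.id ℝ ℝ) 1 = a • (1 : ℝ) := by simp
  unfold coordHess at h2 ⊢
  rw [h3]
  simp only [← christoffelL_apply] at h2 ⊢
  simp only [map_smul, smul_apply]
  rw [← smul_add, ← smul_add, h2, smul_zero, smul_zero]

theorem initialVec_comp_mul {γ : ℝ → M} (hγ : MDifferentiableAt 𝓘(ℝ, ℝ) 𝓘(ℝ, E) γ 0) (a : ℝ) :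
    initialVec (E := E) (fun s => γ (a * s)) = scaleVec a (initialVec γ) := by
  have hl : HasFDerivAt (fun s : ℝ => a * s) (a • ContinuousLinearMap.id ℝ ℝ) 0 :=
    (hasFDerivAt_id (0 : ℝ)).const_mul a
  have h0 : MDifferentiableAt 𝓘(ℝ, ℝ) 𝓘(ℝ, E) γ (a * 0) := by rwa [mul_zero]
  have h1 := (h0.hasMFDerivAt.comp (0 : ℝ) hl.hasMFDerivAt).mfderiv
  -- The fibres at `γ (a * 0)` and `γ 0` are identified by substitution.
  have h3 : ∀ r : ℝ, r = 0 → (⟨γ r, a • velocity E γ r⟩ : TangentBundle 𝓘(ℝ, E) M) =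
      scaleVec a (initialVec γ) := by
    rintro _ rfl
    rfl
  refine Eq.trans ?_ (h3 (a * 0) (mul_zero a))
  have h2 : mfderiv 𝓘(ℝ, ℝ) 𝓘(ℝ, E) (fun s => γ (a * s)) 0 (1 : ℝ) =
      a • (mfderiv 𝓘(ℝ, ℝ) 𝓘(ℝ, E) γ (a * 0) (1 : ℝ)) := by
    refine (congrArg (fun L : ℝ →L[ℝ] E => L 1) h1).trans ?_
    change mfderiv 𝓘(ℝ, ℝ) 𝓘(ℝ, E) γ (a * 0) ((a • ContinuousLinearMap.id ℝ ℝ) 1) = _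
    have h3 : (a • ContinuousLinearMap.id ℝ ℝ) 1 = a • (1 : ℝ) := by simp
    rw [h3]
    exact map_smul _ _ _
  exact congrArg (fun v : TangentSpace 𝓘(ℝ, E) (γ (a * 0)) =>
    (⟨γ (a * 0), v⟩ : TangentBundle 𝓘(ℝ, E) M)) h2

theorem isExp_iff (h : RiemMetric E M) (p : M) (v : TangentSpace 𝓘(ℝ, E) p) (q : M) :
    IsExp h p v q ↔ ∃ (γ : ℝ → M) (J : Set ℝ), IsGeodesic h.inner J γ ∧ Icc 0 1 ⊆ J ∧
      initialVec (E := E) γ = ⟨p, v⟩ ∧ γ 1 = q := by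
  constructor
  · rintro ⟨γ, J, h1, h2, h3, h4, h5, h6⟩
    exact ⟨γ, J, ⟨h1, h3, h4⟩, h2, h5, h6⟩
  · rintro ⟨γ, J, ⟨h1, h3, h4⟩, h2, h5, h6⟩
    exact ⟨γ, J, h1, h2, h3, h4, h5, h6⟩

theorem vnorm_smul (h : RiemMetric E M) {p : M} (a : ℝ) (v : TangentSpace 𝓘(ℝ, E) p) :
    vnorm h (a • v) = |a| * vnorm h v := by
  unfold vnorm
  rw [map_smul, map_smul, smul_apply, smul_eq_mul, smul_eq_mul, ← mul_assoc,
    Real.sqrt_mul (mul_self_nonneg a), Real.sqrt_mul_self_eq_abs]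

end Geodesics

/-! ### Normal charts and the Gauss lemma. -/

section NormalCharts

universe u

variable {E : Type u} [NormedAddCommGroup E] [NormedSpace ℝ E] [FiniteDimensional ℝ E]
  {M : Type*} [TopologicalSpace M] [ChartedSpace E M] [IsManifold 𝓘(ℝ, E) ∞ M]
  {e : OpenPartialHomeomorph M E} {h : RiemMetric E M} {p : M} {r : ℝ}

theorem IsNormalChart.mem_atlas (hn : IsNormalChart h p r e) :
    e ∈ IsManifold.maximalAtlas 𝓘(ℝ, E) ∞ M := hn.2.1

theorem IsNormalChart.mem_target (hn : IsNormalChart h p r e) {v : E} :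
    v ∈ e.target ↔ vnorm h (ofModel p v) < r := by
  rw [hn.2.2.1, mem_ofPred_eq]

theorem IsNormalChart.smul_mem_target (hn : IsNormalChart h p r e) {v : E} (hv : v ∈ e.target)
    {s : ℝ} (hs : |s| ≤ 1) : s • v ∈ e.target := by
  rw [hn.mem_target] at hv ⊢
  rw [map_smul, vnorm_smul]
  have h0 : 0 ≤ vnorm h (ofModel p v) := Real.sqrt_nonneg _
  nlinarith [abs_nonneg s]

theorem IsNormalChart.zero_mem_target (hn : IsNormalChart h p r e) : (0 : E) ∈ e.target := by
  rw [hn.mem_target, map_zero]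
  unfold vnorm
  rw [map_zero, Real.sqrt_zero]
  exact hn.1

theorem IsNormalChart.exists_smul_mem_target (hn : IsNormalChart h p r e) (v : E) :
    ∃ s : ℝ, 0 < s ∧ s • v ∈ e.target := by
  have h0 : 0 ≤ vnorm h (ofModel p v) := Real.sqrt_nonneg _
  have hr := hn.1
  refine ⟨r / (2 * (vnorm h (ofModel p v) + 1)), by positivity, ?_⟩
  rw [hn.mem_target, map_smul, vnorm_smul, abs_of_nonneg (by positivity), div_mul_eq_mul_div,
    div_lt_iff₀ (by positivity)]
  nlinarith

variable [T2Space M]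

/-- `IsExp` supplies a separate geodesic for each vector. By uniqueness the one for `s • v` is the
one for `v` run at speed `s`, so a single geodesic traces the ray. -/
theorem IsNormalChart.exists_geodesic (hn : IsNormalChart h p r e) {v : E} (hv : v ∈ e.target) :
    ∃ (γ : ℝ → M) (J : Set ℝ), IsGeodesic h.inner J γ ∧ Icc 0 1 ⊆ J ∧
      initialVec (E := E) γ = ⟨p, ofModel p v⟩ ∧ ∀ s ∈ Icc (0 : ℝ) 1, γ s = e.symm (s • v) := by
  obtain ⟨γ, J, hγ, hJ, h0, h1⟩ := (isExp_iff h p _ _).1 (hn.2.2.2 v hv)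
  refine ⟨γ, J, hγ, hJ, h0, fun s hs => ?_⟩
  have hsv := hn.smul_mem_target hv (s := s) (abs_le.2 ⟨by linarith [hs.1], hs.2⟩)
  obtain ⟨γ', J', hγ', hJ', h0', h1'⟩ := (isExp_iff h p _ _).1 (hn.2.2.2 _ hsv)
  have h0J : (0 : ℝ) ∈ J := hJ (left_mem_Icc.2 zero_le_one)
  have h2 := geodesic_unique h.isPseudoMetric (J := ![{σ | s * σ ∈ J}, J'])
    (γ := ![fun σ => γ (s * σ), γ']) ?_ ?_ ?_ (right_mem_Icc.2 zero_le_one)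
  · simp only [Matrix.cons_val_zero, mul_one, Matrix.cons_val_one] at h2
    rw [h2, h1']
  · intro j
    fin_cases j
    exacts [hγ.comp_mul h.isPseudoMetric s, hγ']
  · intro j
    fin_cases j
    · intro σ hσ
      exact hJ ⟨mul_nonneg hs.1 hσ.1, mul_le_one₀ hs.2 hσ.1 hσ.2⟩
    · exact hJ'
  · change initialVec (E := E) (fun σ => γ (s * σ)) = initialVec γ'
    rw [initialVec_comp_mul ((hγ.contMDiffAt h0J).mdifferentiableAt (by simp)), h0, h0', map_smul]
    rfl

theorem IsNormalChart.symm_zero (hn : IsNormalChart h p r e) : e.symm 0 = p := by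
  obtain ⟨γ, J, -, -, h0, h1⟩ := hn.exists_geodesic hn.zero_mem_target
  have h2 := h1 0 (left_mem_Icc.2 zero_le_one)
  rw [smul_zero] at h2
  rw [← h2]
  exact congrArg (fun v : TangentBundle 𝓘(ℝ, E) M => v.1) h0

theorem IsNormalChart.center_mem_source (hn : IsNormalChart h p r e) : p ∈ e.source := by
  have := e.map_target hn.zero_mem_target
  rwa [hn.symm_zero] at this

theorem IsNormalChart.apply_center (hn : IsNormalChart h p r e) : e p = 0 := by
  have := e.right_inv hn.zero_mem_target
  rwa [hn.symm_zero] at this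

/-- The exponential map has identity differential at the origin: the geodesic with initial velocity
`v` is `s • v` in the chart. Small `v` suffice by linearity. -/
theorem IsNormalChart.toCoord_center (hn : IsNormalChart h p r e) (v : E) :
    (toCoord e p (ofModel p v) : E) = v := by
  have key : ∀ v ∈ e.target, (toCoord e p (ofModel p v) : E) = v := by
    intro v hv
    obtain ⟨γ, J, hγ, hJ, h0, h1⟩ := hn.exists_geodesic hv
    have h0J : (0 : ℝ) ∈ J := hJ (left_mem_Icc.2 zero_le_one)
    have hγ0 : γ 0 = p := congrArg (fun v : TangentBundle 𝓘(ℝ, E) M => v.1) h0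
    have hs : γ 0 ∈ e.source := by rw [hγ0]; exact hn.center_mem_source
    have h2 : (toCoord e p (ofModel p v) : E) = deriv (e ∘ γ) 0 := by
      rw [← toCoord_velocity hn.mem_atlas ((hγ.contMDiffAt h0J).mdifferentiableAt (by simp)) hs]
      exact (congrArg (fun v : TangentBundle 𝓘(ℝ, E) M => (toCoord e v.1 v.2 : E)) h0).symm
    have h3 : DifferentiableAt ℝ (e ∘ γ) 0 :=
      (contDiffAt_chart_comp le_rfl hn.mem_atlas (hγ.contMDiffAt h0J) hs).differentiableAt (by simp)
    have h4 : HasDerivWithinAt (e ∘ γ) v (Icc 0 1) 0 := by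
      have h5 : HasDerivWithinAt (fun s : ℝ => s • v) v (Icc 0 1) 0 := by
        simpa using ((hasDerivAt_id (0 : ℝ)).smul_const v).hasDerivWithinAt
      refine h5.congr (fun s hs => ?_) ?_
      · rw [Function.comp_apply, h1 s hs]
        exact e.right_inv (hn.smul_mem_target hv (abs_le.2 ⟨by linarith [hs.1], hs.2⟩))
      · rw [Function.comp_apply, hγ0, zero_smul]
        exact hn.apply_center
    rw [h2]
    exact (uniqueDiffOn_Icc zero_lt_one 0 (left_mem_Icc.2 zero_le_one)).eq_deriv _
      h3.hasDerivAt.hasDerivWithinAt h4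
  obtain ⟨s, hs, hsv⟩ := hn.exists_smul_mem_target v
  have h1 := key _ hsv
  rw [map_smul] at h1
  have h2 : s • (toCoord e p (ofModel p v) : E) = s • v :=
    (map_smul (toCoord e p) s (ofModel p v)).symm.trans h1
  exact smul_right_injective E hs.ne' h2

theorem IsNormalChart.formField_center (hn : IsNormalChart h p r e) (B : FormField E M) (v w : E) :
    B p (ofModel p v) (ofModel p w) = coordForm B e 0 v w := by
  rw [formField_eq_coordForm B hn.mem_atlas hn.center_mem_source, hn.apply_center,
    hn.toCoord_center, hn.toCoord_center]

theorem IsNormalChart.mem_target_iff (hn : IsNormalChart h p r e) {v : E} :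
    v ∈ e.target ↔ √(coordForm h.inner e 0 v v) < r := by
  rw [hn.mem_target, vnorm, hn.formField_center]

/-- Rays through the centre are geodesics. -/
theorem IsNormalChart.christoffel_ray (hn : IsNormalChart h p r e) {v : E} (hv : v ∈ e.target)
    {s : ℝ} (hs : s ∈ Icc (0 : ℝ) 1) : christoffel h.inner e (s • v) v v = 0 := by
  have hmem : ∀ s ∈ Icc (0 : ℝ) 1, s • v ∈ e.target := fun s hs =>
    hn.smul_mem_target hv (abs_le.2 ⟨by linarith [hs.1], hs.2⟩)
  have key : Ioo (0 : ℝ) 1 ⊆ {s | christoffel h.inner e (s • v) v v = 0} := by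
    intro s hs
    obtain ⟨γ, J, hγ, hJ, h0, h1⟩ := hn.exists_geodesic hv
    have hsJ := hJ (Ioo_subset_Icc_self hs)
    have hsrc : γ s ∈ e.source := by
      rw [h1 s (Ioo_subset_Icc_self hs)]
      exact e.map_target (hmem s (Ioo_subset_Icc_self hs))
    have h2 := hγ.coordHess_eq_zero h.isPseudoMetric hn.mem_atlas hsJ hsrc
    have h3 : e ∘ γ =ᶠ[𝓝 s] (id : E → E) ∘ fun s : ℝ => s • v := by
      filter_upwards [isOpen_Ioo.mem_nhds hs] with σ hσ
      rw [Function.comp_apply, h1 σ (Ioo_subset_Icc_self hσ)]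
      exact e.right_inv (hmem σ (Ioo_subset_Icc_self hσ))
    rw [coordHess_congr h3, coordHess_comp_affine (L := ContinuousLinearMap.toSpanSingleton ℝ v)
      (q := 0) (fun s => by simp) contDiffAt_id] at h2
    have h4 : fderiv ℝ (id : E → E) = fun _ => ContinuousLinearMap.id ℝ E := by
      ext1 x; exact fderiv_id
    unfold coordHess at h2
    rw [h4] at h2
    simpa using h2
  -- The ray identity gives two-sided derivatives only for `0 < s < 1`; the endpoints follow by
  -- continuity.
  have hcont : ContinuousOn (fun s : ℝ => christoffelL h.inner e (s • v) v v) (Icc 0 1) := by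
    have h1 : ContinuousOn (fun s : ℝ => christoffelL h.inner e (s • v)) (Icc 0 1) :=
      (contDiffOn_christoffelL h.isPseudoMetric hn.mem_atlas).continuousOn.comp
        (by fun_prop) hmem
    exact (h1.clm_apply continuousOn_const).clm_apply continuousOn_const
  have hcl : IsClosed (Icc (0 : ℝ) 1 ∩ (fun s : ℝ => christoffelL h.inner e (s • v) v v) ⁻¹' {0}) :=
    hcont.preimage_isClosed_of_isClosed isClosed_Icc isClosed_singleton
  have h5 : closure (Ioo (0 : ℝ) 1) ⊆
      Icc (0 : ℝ) 1 ∩ (fun s : ℝ => christoffelL h.inner e (s • v) v v) ⁻¹' {0} :=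
    hcl.closure_subset_iff.2 fun s hs => ⟨Ioo_subset_Icc_self hs, key hs⟩
  rw [closure_Ioo zero_ne_one] at h5
  exact (h5 hs).2

/-- `christoffel_ray` at `s = 0` kills the quadratic form, and polarization with the symmetry in the
lower indices kills the bilinear one. -/
theorem IsNormalChart.christoffel_center (hn : IsNormalChart h p r e) (a b : E) :
    christoffel h.inner e 0 a b = 0 := by
  have hdiag : ∀ v : E, christoffelL h.inner e 0 v v = 0 := by
    intro v
    obtain ⟨s, hs, hsv⟩ := hn.exists_smul_mem_target v
    have h1 := hn.christoffel_ray hsv (left_mem_Icc.2 zero_le_one)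
    rw [zero_smul, ← christoffelL_apply, map_smul, map_smul, smul_apply, smul_smul] at h1
    exact (smul_eq_zero.1 h1).resolve_left (by positivity)
  have h1 := hdiag (a + b)
  simp only [map_add, add_apply, hdiag, zero_add, add_zero] at h1
  rw [christoffelL_apply, christoffelL_apply, christoffel_symm h.isPseudoMetric hn.mem_atlas
    hn.zero_mem_target b a, ← two_smul ℝ] at h1
  exact (smul_eq_zero.1 h1).resolve_left two_ne_zero

theorem christoffelLower_eq_zero {B : FormField E M} (hB : IsPseudoMetric B)
    (he : e ∈ IsManifold.maximalAtlas 𝓘(ℝ, E) ∞ M) {z : E} (hz : z ∈ e.target) {a b : E}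
    (hab : christoffel B e z a b = 0) (c : E) :
    fderiv ℝ (coordForm B e) z a b c + fderiv ℝ (coordForm B e) z b a c =
      fderiv ℝ (coordForm B e) z c a b := by
  have h1 := coordForm_christoffel hB he hz a b
  rw [hab, map_zero] at h1
  have h2 := christoffelLower_apply B e z a b c
  rw [← h1] at h2
  simp only [zero_apply] at h2
  linarith

/-- The Christoffel symbols of the first kind determine all first derivatives of the metric. -/
theorem IsNormalChart.fderiv_coordForm_center (hn : IsNormalChart h p r e) (a b c : E) :
    fderiv ℝ (coordForm h.inner e) 0 a b c = 0 := by
  have h1 := fun a b c => christoffelLower_eq_zero h.isPseudoMetric hn.mem_atlas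
    hn.zero_mem_target (hn.christoffel_center a b) c
  have h2 := fun a b c => fderiv_coordForm_symm h.isPseudoMetric hn.mem_atlas
    hn.zero_mem_target a b c
  linarith [h1 a b c, h1 a c b, h2 a b c, h2 b a c, h2 c a b]

theorem hasDerivAt_coordForm_ray {B : FormField E M} (hB : IsPseudoMetric B)
    (he : e ∈ IsManifold.maximalAtlas 𝓘(ℝ, E) ∞ M) {v : E} {s : ℝ} (hz : s • v ∈ e.target)
    (a b : E) : HasDerivAt (fun s : ℝ => coordForm B e (s • v) a b)
      (fderiv ℝ (coordForm B e) (s • v) v a b) s := by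
  have hd : DifferentiableAt ℝ (coordForm B e) (s • v) :=
    ((contDiffOn_coordForm hB he).contDiffAt (e.open_target.mem_nhds hz)).differentiableAt (by simp)
  have h1 : HasDerivAt (fun s : ℝ => s • v) v s := by
    simpa using (hasDerivAt_id s).smul_const v
  have h2 := hd.hasFDerivAt.comp_hasDerivAt s h1
  have h3 := (h2.clm_apply (hasDerivAt_const s a)).clm_apply (hasDerivAt_const s b)
  simpa using h3

/-- Geodesics have constant speed: along the ray, `Γ(z, z) = 0` makes the radial derivative of `h(z,
z)` vanish. -/
theorem IsNormalChart.coordForm_radial_self (hn : IsNormalChart h p r e) {z : E}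
    (hz : z ∈ e.target) : coordForm h.inner e z z z = coordForm h.inner e 0 z z := by
  have hmem : ∀ s ∈ Icc (0 : ℝ) 1, s • z ∈ e.target := fun s hs =>
    hn.smul_mem_target hz (abs_le.2 ⟨by linarith [hs.1], hs.2⟩)
  have hd : ∀ s ∈ Icc (0 : ℝ) 1, HasDerivAt (fun s : ℝ => coordForm h.inner e (s • z) z z) 0 s := by
    intro s hs
    have h1 := hasDerivAt_coordForm_ray h.isPseudoMetric hn.mem_atlas (hmem s hs) z z
    have h2 := christoffelLower_eq_zero h.isPseudoMetric hn.mem_atlas (hmem s hs)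
      (hn.christoffel_ray hz hs) z
    have h3 : fderiv ℝ (coordForm h.inner e) (s • z) z z z = 0 := by linarith
    rwa [h3] at h1
  have h1 := constant_of_has_deriv_right_zero (f := fun s : ℝ => coordForm h.inner e (s • z) z z)
    (fun s hs => (hd s hs).continuousAt.continuousWithinAt)
    (fun s hs => (hd s (Ico_subset_Icc_self hs)).hasDerivWithinAt) 1 (right_mem_Icc.2 zero_le_one)
  simpa using h1

/-- The Gauss lemma. -/
theorem IsNormalChart.gauss (hn : IsNormalChart h p r e) {z : E} (hz : z ∈ e.target) (w : E) :
    coordForm h.inner e z z w = coordForm h.inner e 0 z w := by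
  have hmem : ∀ s ∈ Icc (0 : ℝ) 1, s • z ∈ e.target := fun s hs =>
    hn.smul_mem_target hz (abs_le.2 ⟨by linarith [hs.1], hs.2⟩)
  have hsymm := coordForm_symm (e := e) h.isPseudoMetric
  -- The derivative in the direction `w` of the identity `h_ζ(ζ, ζ) = h_0(ζ, ζ)`.
  have hrad : ∀ ζ ∈ e.target, fderiv ℝ (coordForm h.inner e) ζ w ζ ζ +
      2 * coordForm h.inner e ζ ζ w = 2 * coordForm h.inner e 0 ζ w := by
    intro ζ hζ
    have hd : DifferentiableAt ℝ (coordForm h.inner e) ζ :=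
      ((contDiffOn_coordForm h.isPseudoMetric hn.mem_atlas).contDiffAt
        (e.open_target.mem_nhds hζ)).differentiableAt (by simp)
    have h1 := (hd.hasFDerivAt.clm_apply (hasFDerivAt_id ζ)).clm_apply (hasFDerivAt_id ζ)
    have h2 := ((hasFDerivAt_const (coordForm h.inner e 0) ζ).clm_apply
      (hasFDerivAt_id ζ)).clm_apply (hasFDerivAt_id ζ)
    have h3 : (fun z => coordForm h.inner e z (id z) (id z)) =ᶠ[𝓝 ζ]
        fun z => coordForm h.inner e 0 (id z) (id z) := by
      filter_upwards [e.open_target.mem_nhds hζ] with z hz using hn.coordForm_radial_self hz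
    have h4 := congrArg (fun L : E →L[ℝ] ℝ => L w) ((h1.congr_of_eventuallyEq h3.symm).unique h2)
    simp at h4
    rw [hsymm ζ w ζ, hsymm 0 w ζ] at h4
    linarith
  -- The factor `s` makes the function vanish at `s = 0`. Its derivative is zero by `hrad` combined
  -- with the geodesic equation paired with `w`.
  have hd : ∀ s ∈ Icc (0 : ℝ) 1, HasDerivAt
      (fun s : ℝ => s * (coordForm h.inner e (s • z) z w - coordForm h.inner e 0 z w)) 0 s := by
    intro s hs
    have h1 := hasDerivAt_coordForm_ray h.isPseudoMetric hn.mem_atlas (hmem s hs) z w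
    have h2 := christoffelLower_eq_zero h.isPseudoMetric hn.mem_atlas (hmem s hs)
      (hn.christoffel_ray hz hs) w
    have h3 := hrad _ (hmem s hs)
    simp only [map_smul, smul_apply, smul_eq_mul] at h3
    have h4 := (hasDerivAt_id s).mul (h1.sub_const (coordForm h.inner e 0 z w))
    refine h4.congr_deriv ?_
    simp only [id, one_mul]
    rcases hs.1.eq_or_lt with h0 | h0
    · rw [← h0, zero_smul]; ring
    · refine mul_left_cancel₀ h0.ne' ?_
      linear_combination (1 / 2) * h3 + s ^ 2 / 2 * h2
  have h1 := constant_of_has_deriv_right_zero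
    (f := fun s : ℝ => s * (coordForm h.inner e (s • z) z w - coordForm h.inner e 0 z w))
    (fun s hs => (hd s hs).continuousAt.continuousWithinAt)
    (fun s hs => (hd s (Ico_subset_Icc_self hs)).hasDerivWithinAt) 1 (right_mem_Icc.2 zero_le_one)
  simp only [one_mul, one_smul, zero_mul] at h1
  linarith

end NormalCharts

/-! ### Existence of normal charts with a locally uniform radius. -/

section ExponentialMap

universe u

variable {E : Type u} [NormedAddCommGroup E] [NormedSpace ℝ E] [FiniteDimensional ℝ E]
  {M : Type*} [TopologicalSpace M] [ChartedSpace E M] [IsManifold 𝓘(ℝ, E) ∞ M]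
  {e : OpenPartialHomeomorph M E} {B : FormField E M}

theorem coordHess_real {z : ℝ → E} {s : ℝ} (hz : ContDiffAt ℝ 2 z s) :
    coordHess B e z s 1 1 = deriv (deriv z) s + christoffel B e (z s) (deriv z s) (deriv z s) := by
  have h4 : DifferentiableAt ℝ (fderiv ℝ z) s :=
    (hz.fderiv_right (m := 1) (by norm_num)).differentiableAt (by simp)
  have h5 : deriv (deriv z) s = fderiv ℝ (fderiv ℝ z) s (1 : ℝ) 1 := by
    have : deriv z = fun r => fderiv ℝ z r 1 := by
      ext r; rw [fderiv_apply_one_eq_deriv]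
    rw [this, ← fderiv_apply_one_eq_deriv, fderiv_clm_apply h4 (differentiableAt_const _)]
    simp
  unfold coordHess
  rw [h5, fderiv_apply_one_eq_deriv (f := z)]

/-- Smooth dependence of geodesics on their initial vectors, near a given point. -/
theorem exists_local_geodesics (hB : IsPseudoMetric B)
    (he : e ∈ IsManifold.maximalAtlas 𝓘(ℝ, E) ∞ M) {z₀ : E} (hz₀ : z₀ ∈ e.target) :
    ∃ τ > 0, ∃ Ψ : ℝ → E × E → E, ContDiff ℝ ∞ (Ψ 1) ∧ ∀ z w, ‖z - z₀‖ ≤ τ → ‖w‖ ≤ τ →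
      IsGeodesic B (Ioo (-2) 2) (fun s => e.symm (Ψ s (z, w))) ∧
      (∀ s ∈ Ioo (-2 : ℝ) 2, Ψ s (z, w) ∈ e.target) ∧ Ψ 0 (z, w) = z ∧
      HasDerivAt (fun s => Ψ s (z, w)) w 0 := by
  have : ProperSpace E := FiniteDimensional.proper ℝ E
  obtain ⟨r, hr, hrt⟩ := Metric.nhds_basis_closedBall.mem_iff.1 (e.open_target.mem_nhds hz₀)
  let K : Fin 2 → Set E := ![Metric.closedBall z₀ r, Metric.closedBall 0 1]
  have hK : ∀ i, IsCompact (K i) := by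
    intro i
    fin_cases i <;> exact isCompact_closedBall _ _
  have hU : IsOpen {V : Fin 2 → E | V 0 ∈ e.target} := e.open_target.preimage (continuous_apply 0)
  have hKU : univ.pi K ⊆ {V : Fin 2 → E | V 0 ∈ e.target} := fun V hV => hrt (hV 0 (mem_univ _))
  let f : (Fin 2 → E) → Fin 2 → E := fun V => ![V 1, -christoffelL B e (V 0) (V 1) (V 1)]
  have hf : ContDiffOn ℝ ∞ f {V : Fin 2 → E | V 0 ∈ e.target} := by
    have h0 : ContDiffOn ℝ ∞ (fun V : Fin 2 → E => V 0) {V : Fin 2 → E | V 0 ∈ e.target} :=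
      (contDiff_apply ℝ E (0 : Fin 2)).contDiffOn
    have h1 : ContDiffOn ℝ ∞ (fun V : Fin 2 → E => V 1) {V : Fin 2 → E | V 0 ∈ e.target} :=
      (contDiff_apply ℝ E (1 : Fin 2)).contDiffOn
    rw [contDiffOn_pi]
    intro i
    fin_cases i
    · exact h1
    · exact (((contDiffOn_christoffelL hB he).comp h0 fun V hV => hV).clm_apply h1
        |>.clm_apply h1).neg
  -- With all speeds zero the transport system is the geodesic equation, with the initial vector in
  -- `E × E` as the space variable. Smooth dependence on the initial vector is then the smoothness
  -- of the solution.
  obtain ⟨ε, hε, hsol⟩ := exists_local_transport_solution.{u, u, 0} (X := E × E) (ι := Fin 2)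
    (c := fun _ => 0) (by simp) hU hf hK hKU
  obtain ⟨V, hV, hV0, hVeq⟩ := hsol (fun q => ![q.1, q.2]) (by
    rw [contDiff_pi]
    intro i
    fin_cases i
    exacts [contDiff_fst, contDiff_snd])
  -- Rescaling time by `σ` turns existence for `|t| < ε` with velocities of norm at most `1` into
  -- existence on `(-2, 2)` with velocities of norm at most `σ`.
  set σ := ε / 2 with hσ
  have hσ0 : 0 < σ := by positivity
  have hsε : ∀ s ∈ Ioo (-2 : ℝ) 2, |σ * s| < ε := by
    intro s hs
    rw [abs_mul, abs_of_pos hσ0]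
    have := abs_lt.2 hs
    nlinarith
  refine ⟨min r σ, by positivity, fun s q => V (σ * s, (q.1, σ⁻¹ • q.2)) 0, ?_, ?_⟩
  · rw [← contDiffOn_univ]
    have h1 : ContDiffOn ℝ ∞ (fun p : ℝ × E × E => V p 0) {p | |p.1| < ε} :=
      (contDiff_apply ℝ E (0 : Fin 2)).comp_contDiffOn hV
    refine h1.comp (g := fun p : ℝ × E × E => V p 0) (f := fun q : E × E => (σ * 1, (q.1, σ⁻¹ • q.2)))
      (by fun_prop) fun q _ => hsε 1 (by norm_num)
  intro z w hz hw
  set q : E × E := (z, σ⁻¹ • w) with hq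
  have hmem : ∀ t, |t| < ε → V (t, q) 0 ∈ e.target ∧
      ∀ i, HasDerivAt (fun t => V (t, q) i) (f (V (t, q)) i) t := by
    intro t ht
    obtain ⟨h1, h2⟩ := hVeq t q ht (fun i => by
      fin_cases i
      · simp only [smul_zero, sub_zero]
        change z ∈ Metric.closedBall z₀ r
        rw [mem_closedBall_iff_norm]
        exact hz.trans (min_le_left _ _)
      · simp only [smul_zero, sub_zero]
        change σ⁻¹ • w ∈ Metric.closedBall 0 1
        rw [mem_closedBall_iff_norm, sub_zero, norm_smul, norm_inv, Real.norm_of_nonneg hσ0.le,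
          inv_mul_le_iff₀ hσ0, mul_one]
        exact hw.trans (min_le_right _ _))
    refine ⟨h1, fun i => ?_⟩
    have h3 := h2 i
    simp only [smul_zero, add_zero] at h3
    have h4 := HasDerivAt.comp_sub_const (f := fun r => V (t + r, q) i) t t
      (by rwa [sub_self])
    simpa using h4
  have hd0 : ∀ s ∈ Ioo (-2 : ℝ) 2, HasDerivAt (fun s => V (σ * s, q) 0) (σ • V (σ * s, q) 1) s := by
    intro s hs
    have h2 : HasDerivAt (fun s : ℝ => σ * s) σ s := by
      simpa using (hasDerivAt_id s).const_mul σ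
    have h1 := (hmem _ (hsε s hs)).2 0
    have h3 := HasDerivAt.scomp (g₁ := fun t => V (t, q) 0) s h1 h2
    exact h3
  have hd1 : ∀ s ∈ Ioo (-2 : ℝ) 2, HasDerivAt (fun s => σ • V (σ * s, q) 1)
      (-christoffelL B e (V (σ * s, q) 0) (σ • V (σ * s, q) 1) (σ • V (σ * s, q) 1)) s := by
    intro s hs
    have h2 : HasDerivAt (fun s : ℝ => σ * s) σ s := by
      simpa using (hasDerivAt_id s).const_mul σ
    have h1 := (hmem _ (hsε s hs)).2 1
    have h3 := (HasDerivAt.scomp (g₁ := fun t => V (t, q) 1) s h1 h2).const_smul σ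
    refine h3.congr_deriv ?_
    simp only [map_smul, smul_apply, f, Matrix.cons_val_one, Matrix.cons_val_fin_one, smul_neg]
  have hmt : ∀ s ∈ Ioo (-2 : ℝ) 2, V (σ * s, q) 0 ∈ e.target := fun s hs => (hmem _ (hsε s hs)).1
  have hsm : ContDiffOn ℝ ∞ (fun s => V (σ * s, q) 0) (Ioo (-2) 2) := by
    have h1 : ContDiffOn ℝ ∞ (fun p : ℝ × E × E => V p 0) {p | |p.1| < ε} :=
      (contDiff_apply ℝ E (0 : Fin 2)).comp_contDiffOn hV
    exact h1.comp (g := fun p : ℝ × E × E => V p 0) (f := fun s : ℝ => (σ * s, q))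
      (by fun_prop) fun s hs => hsε s hs
  have hV00 : V (σ * 0, q) = ![z, σ⁻¹ • w] := by rw [mul_zero, hV0]
  refine ⟨⟨isOpen_Ioo, (contMDiffOn_chart_symm he).comp (contMDiffOn_iff_contDiffOn.2 hsm) hmt,
    fun s hs => ?_⟩, hmt, ?_, ?_⟩
  · have hg : ContMDiffOn 𝓘(ℝ, ℝ) 𝓘(ℝ, E) ∞ (fun s => e.symm (V (σ * s, q) 0)) (Ioo (-2) 2) :=
      (contMDiffOn_chart_symm he).comp (contMDiffOn_iff_contDiffOn.2 hsm) hmt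
    refine (covDeriv_velocity_eq_zero_iff (γ := fun s => e.symm (V (σ * s, q) 0)) hB he
      (hg.contMDiffAt (isOpen_Ioo.mem_nhds hs)) (e.map_target (hmt s hs))).2 ?_
    have h1 : e ∘ (fun s => e.symm (V (σ * s, q) 0)) =ᶠ[𝓝 s] fun s => V (σ * s, q) 0 := by
      filter_upwards [isOpen_Ioo.mem_nhds hs] with s hs using e.right_inv (hmt s hs)
    rw [coordHess_congr h1, coordHess_real ((hsm.contDiffAt (isOpen_Ioo.mem_nhds hs)).of_le
      ENat.LEInfty.out)]
    have h2 : deriv (fun s => V (σ * s, q) 0) =ᶠ[𝓝 s] fun s => σ • V (σ * s, q) 1 := by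
      filter_upwards [isOpen_Ioo.mem_nhds hs] with s hs using (hd0 s hs).deriv
    rw [h2.deriv_eq, (hd1 s hs).deriv, h2.self_of_nhds, christoffelL_apply, neg_add_cancel]
  · simp only
    rw [hV00]; rfl
  · have h1 := hd0 0 (by norm_num)
    rw [hV00] at h1
    simpa [smul_smul, mul_inv_cancel₀ hσ0.ne'] using h1

/-- A smooth injective map with invertible derivatives on an open set is a diffeomorphism onto its
open image. -/
theorem exists_openPartialHomeomorph {f : E → E} {T : Set E} (hT : IsOpen T)
    (hf : ContDiff ℝ ∞ f) (hinj : InjOn f T)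
    (hinv : ∀ v ∈ T, ∃ A : E ≃L[ℝ] E, (A : E →L[ℝ] E) = fderiv ℝ f v) :
    ∃ φ : OpenPartialHomeomorph E E, φ.source = T ∧ (∀ v, φ v = f v) ∧
      ContDiffOn ℝ ∞ φ.symm φ.target := by
  have : CompleteSpace E := FiniteDimensional.complete ℝ E
  have hopen : IsOpenMap (T.domRestrict f) := by
    rw [isOpenMap_iff_nhds_le]
    rintro ⟨v, hv⟩
    obtain ⟨A, hA⟩ := hinv v hv
    have h1 : HasStrictFDerivAt f (A : E →L[ℝ] E) v := by
      rw [hA]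
      exact hf.contDiffAt.hasStrictFDerivAt (by simp)
    have h2 := h1.map_nhds_eq_of_equiv
    have h3 : map (T.domRestrict f) (𝓝 ⟨v, hv⟩) = map f (𝓝 v) := by
      rw [show T.domRestrict f = f ∘ Subtype.val from rfl, ← Filter.map_map,
        hT.isOpenEmbedding_subtypeVal.map_nhds_eq]
    rw [h3, h2]
    rfl
  refine ⟨OpenPartialHomeomorph.ofContinuousOpenRestrict (hinj.toPartialEquiv f T)
    hf.continuous.continuousOn hopen hT, rfl, fun _ => rfl, fun y hy => ?_⟩
  set φ := OpenPartialHomeomorph.ofContinuousOpenRestrict (hinj.toPartialEquiv f T)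
    hf.continuous.continuousOn hopen hT with hφ
  obtain ⟨A, hA⟩ := hinv (φ.symm y) (φ.map_target hy)
  refine (φ.contDiffAt_symm (f₀' := A) hy ?_ hf.contDiffAt).contDiffWithinAt
  rw [hA]
  exact (hf.differentiable (by simp) _).hasFDerivAt

variable [T2Space M]

/-- Normal charts exist, with a locally uniform radius. -/
theorem exists_isNormalChart (h : RiemMetric E M) (p : M) :
    ∃ r > 0, ∀ᶠ q in 𝓝 p, ∃ e : OpenPartialHomeomorph M E, IsNormalChart h q r e := by
  have : ProperSpace E := FiniteDimensional.proper ℝ E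
  have : CompleteSpace E := FiniteDimensional.complete ℝ E
  have hB := h.isPseudoMetric
  set e₀ := chartAt E p with he₀def
  have he₀ : e₀ ∈ IsManifold.maximalAtlas 𝓘(ℝ, E) ∞ M := IsManifold.chart_mem_maximalAtlas _
  have hp : p ∈ e₀.source := mem_chart_source E p
  set z₀ := e₀ p with hz₀def
  have hz₀ : z₀ ∈ e₀.target := e₀.map_source hp
  obtain ⟨τ, hτ, Ψ, hΦ, hΨ⟩ := exists_local_geodesics hB he₀ hz₀
  have hI : Icc (0 : ℝ) 1 ⊆ Ioo (-2) 2 := fun s hs => ⟨by linarith [hs.1], by linarith [hs.2]⟩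
  have hvel : ∀ z w, ‖z - z₀‖ ≤ τ → ‖w‖ ≤ τ →
      (toCoord e₀ _ (initialVec (E := E) (fun s => e₀.symm (Ψ s (z, w)))).2 : E) = w := by
    intro z w hz hw
    obtain ⟨h1, h2, h3, h4⟩ := hΨ z w hz hw
    refine (toCoord_velocity he₀ ((h1.contMDiffAt (by norm_num)).mdifferentiableAt (by simp))
      (e₀.map_target (h2 0 (by norm_num)))).trans ?_
    have h5 : e₀ ∘ (fun s => e₀.symm (Ψ s (z, w))) =ᶠ[𝓝 0] fun s => Ψ s (z, w) := by
      filter_upwards [isOpen_Ioo.mem_nhds (show (0 : ℝ) ∈ Ioo (-2) 2 by norm_num)] with s hs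
      exact e₀.right_inv (h2 s hs)
    rw [h5.deriv_eq, h4.deriv]
  have hbase : ∀ z w, ‖z - z₀‖ ≤ τ → ‖w‖ ≤ τ →
      (initialVec (E := E) (fun s => e₀.symm (Ψ s (z, w)))).1 = e₀.symm z := by
    intro z w hz hw
    exact congrArg e₀.symm (hΨ z w hz hw).2.2.1
  have hztar : ∀ z, ‖z - z₀‖ ≤ τ → z ∈ e₀.target := by
    intro z hz
    obtain ⟨-, h2, h3, -⟩ := hΨ z 0 hz (by simpa using hτ.le)
    rw [← h3]
    exact h2 0 (by norm_num)
  -- Homogeneity of geodesics. At `s = 0` it gives `Ψ 1 (z, 0) = z`, and for small `s` the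
  -- derivative of `Ψ 1` in the velocity at the zero vector.
  have hhom : ∀ z w, ‖z - z₀‖ ≤ τ → ‖w‖ ≤ τ → ∀ s ∈ Icc (0 : ℝ) 1, Ψ 1 (z, s • w) = Ψ s (z, w) := by
    intro z w hz hw s hs
    have hsw : ‖s • w‖ ≤ τ := by
      rw [norm_smul, Real.norm_of_nonneg hs.1]
      nlinarith [hs.1, hs.2, norm_nonneg w]
    obtain ⟨h1, h2, h3, h4⟩ := hΨ z w hz hw
    obtain ⟨h1', h2', h3', h4'⟩ := hΨ z (s • w) hz hsw
    have h5 := geodesic_unique hB (J := ![Ioo (-2) 2, {σ | s * σ ∈ Ioo (-2 : ℝ) 2}])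
      (γ := ![fun σ => e₀.symm (Ψ σ (z, s • w)), fun σ => e₀.symm (Ψ (s * σ) (z, w))])
      ?_ ?_ ?_ (right_mem_Icc.2 zero_le_one)
    · simp only [Matrix.cons_val_zero, mul_one, Matrix.cons_val_one] at h5
      exact e₀.symm.injOn (h2' 1 (by norm_num)) (h2 s (hI hs)) h5
    · intro j
      fin_cases j
      exacts [h1', h1.comp_mul hB s]
    · intro j
      fin_cases j
      · exact hI
      · intro σ hσ
        exact hI ⟨mul_nonneg hs.1 hσ.1, mul_le_one₀ hs.2 hσ.1 hσ.2⟩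
    · change initialVec (E := E) (fun σ => e₀.symm (Ψ σ (z, s • w))) =
        initialVec (fun σ => (fun r => e₀.symm (Ψ r (z, w))) (s * σ))
      rw [initialVec_comp_mul (γ := fun r => e₀.symm (Ψ r (z, w)))
        ((h1.contMDiffAt (by norm_num)).mdifferentiableAt (by simp))]
      refine tangentBundle_ext he₀ ?_ ?_ ?_
      · rw [hbase z _ hz hsw]
        exact e₀.map_target (hztar z hz)
      · rw [hbase z _ hz hsw]
        exact (hbase z w hz hw).symm
      · rw [hvel z _ hz hsw]
        refine Eq.symm ((map_smul (toCoord e₀ (e₀.symm (Ψ 0 (z, w)))) s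
          (velocity E (fun r => e₀.symm (Ψ r (z, w))) 0)).trans ?_)
        exact congrArg (s • ·) (hvel z w hz hw)
  have hd1 : ∀ z', fderiv ℝ (Ψ 1) (z₀, 0) (z', 0) = z' := by
    intro z'
    have h1 := ((hΦ.differentiable (by simp)) (z₀, 0)).hasFDerivAt.comp z₀
      (hasFDerivAt_prodMk_left (𝕜 := ℝ) z₀ (0 : E))
    have h2 : (Ψ 1 ∘ fun z : E => (z, (0 : E))) =ᶠ[𝓝 z₀] id := by
      filter_upwards [Metric.closedBall_mem_nhds z₀ hτ] with z hz
      rw [mem_closedBall_iff_norm] at hz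
      have := hhom z 0 hz (by simpa using hτ.le) 0 (by norm_num)
      rw [smul_zero, (hΨ z 0 hz (by simpa using hτ.le)).2.2.1] at this
      exact this
    have h3 := (h1.congr_of_eventuallyEq h2.symm).unique (hasFDerivAt_id z₀)
    exact congrArg (fun L : E →L[ℝ] E => L z') h3
  have hd2 : ∀ w, fderiv ℝ (Ψ 1) (z₀, 0) (0, w) = w := by
    have key : ∀ w, ‖w‖ ≤ τ → fderiv ℝ (Ψ 1) (z₀, 0) (0, w) = w := by
      intro w hw
      have hzz : ‖z₀ - z₀‖ ≤ τ := by simpa using hτ.le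
      have h1 : HasDerivAt (fun s : ℝ => ((z₀, s • w) : E × E)) (0, w) 0 := by
        have := (hasDerivAt_const (0 : ℝ) z₀).prodMk ((hasDerivAt_id (0 : ℝ)).smul_const w)
        simpa using this
      have h2 : HasFDerivAt (Ψ 1) (fderiv ℝ (Ψ 1) (z₀, 0)) (z₀, (0 : ℝ) • w) := by
        rw [zero_smul]
        exact ((hΦ.differentiable (by simp)) (z₀, 0)).hasFDerivAt
      have h3 := h2.comp_hasDerivAt (0 : ℝ) h1
      have h4 := (hΨ z₀ w hzz hw).2.2.2.hasDerivWithinAt (s := Icc (0 : ℝ) 1)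
      refine (uniqueDiffOn_Icc zero_lt_one 0 (left_mem_Icc.2 zero_le_one)).eq_deriv _
        h3.hasDerivWithinAt (h4.congr (fun s hs => ?_) ?_)
      · exact hhom z₀ w hzz hw s hs
      · exact hhom z₀ w hzz hw 0 (by norm_num)
    intro w
    have hn : 0 < ‖w‖ + 1 := by positivity
    have h1 := key ((τ / (‖w‖ + 1)) • w) (by
      rw [norm_smul, Real.norm_of_nonneg (by positivity), div_mul_eq_mul_div, div_le_iff₀ hn]
      nlinarith)
    have h2 : ((0 : E), (τ / (‖w‖ + 1)) • w) = (τ / (‖w‖ + 1)) • ((0 : E), w) := by simp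
    rw [h2, map_smul] at h1
    exact smul_right_injective E (by positivity : τ / (‖w‖ + 1) ≠ 0) h1
  -- Keeping the base point as a coordinate makes the inverse function theorem uniform: one
  -- neighbourhood of `(z₀, 0)` on which `F` is injective with invertible derivatives serves all
  -- nearby base points.
  let F : E × E → E × E := fun q => (q.1, Ψ 1 q)
  have hF : ContDiff ℝ ∞ F := contDiff_fst.prodMk hΦ
  have hFd : ∀ q, fderiv ℝ F q = (ContinuousLinearMap.fst ℝ E E).prod (fderiv ℝ (Ψ 1) q) := fun q =>
    (hasFDerivAt_fst.prodMk ((hΦ.differentiable (by simp)) q).hasFDerivAt).fderiv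
  let A : (E × E) ≃L[ℝ] (E × E) := ContinuousLinearEquiv.equivOfInverse
    ((ContinuousLinearMap.fst ℝ E E).prod
      (ContinuousLinearMap.fst ℝ E E + ContinuousLinearMap.snd ℝ E E))
    ((ContinuousLinearMap.fst ℝ E E).prod
      (ContinuousLinearMap.snd ℝ E E - ContinuousLinearMap.fst ℝ E E))
    (fun q => by simp) (fun q => by simp)
  have hA : fderiv ℝ F (z₀, 0) = A := by
    rw [hFd]
    ext q
    · rfl
    · refine (hd1 q).trans ?_
      simp [A]
    · rfl
    · refine (hd2 q).trans ?_
      simp [A]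
  have hFs : HasStrictFDerivAt F (A : E × E →L[ℝ] E × E) (z₀, 0) := by
    rw [← hA]
    exact hF.contDiffAt.hasStrictFDerivAt (by simp)
  set P := hFs.toOpenPartialHomeomorph F with hP
  have hG : P.source ∩ fderiv ℝ F ⁻¹' (range ((↑) : ((E × E) ≃L[ℝ] (E × E)) → _)) ∈ 𝓝 (z₀, (0 : E)) := by
    refine inter_mem (P.open_source.mem_nhds hFs.mem_toOpenPartialHomeomorph_source) ?_
    refine (hF.continuous_fderiv (by simp)).continuousAt.preimage_mem_nhds
      (ContinuousLinearEquiv.isOpen.mem_nhds ⟨A, hA.symm⟩)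
  obtain ⟨a, ha, haG⟩ := Metric.mem_nhds_iff.1 hG
  obtain ⟨r₁, hr₁, hr₁t⟩ := Metric.nhds_basis_closedBall.mem_iff.1 (e₀.open_target.mem_nhds hz₀)
  obtain ⟨m, hm, hmle⟩ := exists_norm_le_coordForm h he₀ (isCompact_closedBall _ _) hr₁t
  -- By the choice of `m`, vectors of `h`-norm below this radius have coordinate norm below `min a
  -- τ`: `a` ensures injectivity and `τ` the existence of the geodesics.
  refine ⟨m * min a τ, by positivity, ?_⟩
  filter_upwards [(e₀.isOpen_inter_preimage (Metric.isOpen_ball (x := z₀)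
    (ε := min a (min r₁ τ)))).mem_nhds ⟨hp, Metric.mem_ball_self (by positivity)⟩] with q hq
  set z := e₀ q with hzdef
  have hqz : e₀.symm z = q := e₀.left_inv hq.1
  have hzlt : ‖z - z₀‖ < min a (min r₁ τ) := by
    have := hq.2
    rwa [mem_preimage, mem_ball_iff_norm] at this
  have hza : ‖z - z₀‖ < a := hzlt.trans_le (min_le_left _ _)
  have hzr : ‖z - z₀‖ < r₁ := hzlt.trans_le ((min_le_right _ _).trans (min_le_left _ _))
  have hzτ : ‖z - z₀‖ ≤ τ := (hzlt.trans_le ((min_le_right _ _).trans (min_le_right _ _))).le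
  obtain ⟨L, hL⟩ : ∃ L : E ≃L[ℝ] E, (L : E →L[ℝ] E) = toCoord e₀ q :=
    toCoord_isInvertible he₀ hq.1
  have hLv : ∀ v : E, (toCoord e₀ q (ofModel q v) : E) = L v := fun v =>
    (congrArg (fun L : E →L[ℝ] E => L v) hL).symm
  have hvn : ∀ v : E, vnorm h (ofModel q v) = √(coordForm h.inner e₀ z (L v) (L v)) := by
    intro v
    rw [vnorm_eq_coordForm h he₀ hq.1, hLv]
  set T : Set E := {v | vnorm h (ofModel q v) < m * min a τ} with hT
  have hTo : IsOpen T := by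
    have hc : Continuous fun v : E => √(coordForm h.inner e₀ z (L v) (L v)) :=
      Real.continuous_sqrt.comp
        (((coordForm h.inner e₀ z).continuous.comp L.continuous).clm_apply L.continuous)
    have : T = {v | √(coordForm h.inner e₀ z (L v) (L v)) < m * min a τ} := by
      ext v
      rw [hT, mem_ofPred_eq, mem_ofPred_eq, hvn]
    rw [this]
    exact isOpen_lt hc continuous_const
  have hTL : ∀ v ∈ T, ‖L v‖ < min a τ := by
    intro v hv
    have h1 : vnorm h (ofModel q v) < m * min a τ := hv
    rw [hvn] at h1
    have h2 := hmle z (by rw [mem_closedBall_iff_norm]; exact hzr.le) (L v)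
    exact lt_of_mul_lt_mul_left (h2.trans_lt h1) hm.le
  have hzG : ∀ v ∈ T, (z, L v) ∈ P.source ∩
      fderiv ℝ F ⁻¹' (range ((↑) : ((E × E) ≃L[ℝ] (E × E)) → _)) := by
    intro v hv
    refine haG ?_
    rw [mem_ball_iff_norm, Prod.norm_def]
    refine max_lt hza ?_
    simpa using (hTL v hv).trans_le (min_le_left _ _)
  have hfe : ContDiff ℝ ∞ fun v => Ψ 1 (z, L v) := hΦ.comp (contDiff_const.prodMk L.contDiff)
  obtain ⟨φ, hφs, hφ, hφsm⟩ := exists_openPartialHomeomorph hTo hfe (fun v hv w hw hvw => by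
      have h1 : P (z, L v) = P (z, L w) := Prod.ext rfl hvw
      have h2 := P.injOn (hzG v hv).1 (hzG w hw).1 h1
      exact L.injective (congrArg Prod.snd h2)) (fun v hv => by
      obtain ⟨A', hA'⟩ := (hzG v hv).2
      have h1 : HasFDerivAt (fun v => Ψ 1 (z, L v)) ((fderiv ℝ (Ψ 1) (z, L v)).comp
          ((0 : E →L[ℝ] E).prod (L : E →L[ℝ] E))) v :=
        ((hΦ.differentiable (by simp)) (z, L v)).hasFDerivAt.comp v
          ((hasFDerivAt_const z v).prodMk L.hasFDerivAt)
      -- The derivative of `F` preserves the base component, so on vertical vectors its injectivity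
      -- is that of the derivative of the exponential map.
      have hinj : Function.Injective (((fderiv ℝ (Ψ 1) (z, L v)).comp
          ((0 : E →L[ℝ] E).prod (L : E →L[ℝ] E)) : E →L[ℝ] E) : E →ₗ[ℝ] E) := by
        rw [injective_iff_map_eq_zero]
        intro w hw
        have h2 : A' (0, L w) = 0 := by
          have h3 : (A' : E × E →L[ℝ] E × E) (0, L w) = fderiv ℝ F (z, L v) (0, L w) := by rw [hA']
          rw [hFd] at h3
          exact h3.trans (Prod.ext rfl hw)
        have h3 := A'.injective (h2.trans (map_zero A').symm)
        exact L.injective ((congrArg Prod.snd h3).trans (map_zero L).symm)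
      refine ⟨(LinearEquiv.ofInjectiveOfFinrankEq _ hinj rfl).toContinuousLinearEquiv, ?_⟩
      rw [h1.fderiv]
      rfl)
  have hφt : ∀ v ∈ T, φ v ∈ e₀.target := by
    intro v hv
    rw [hφ]
    exact (hΨ z (L v) hzτ ((hTL v hv).le.trans (min_le_right _ _))).2.1 1 (by norm_num)
  have htar : (e₀.trans φ.symm).target = T := by
    rw [OpenPartialHomeomorph.trans_target]
    simp only [OpenPartialHomeomorph.symm_target, OpenPartialHomeomorph.symm_symm, hφs]
    exact inter_eq_left.2 hφt
  refine ⟨e₀.trans φ.symm, by positivity, ?_, htar, fun v hv => ?_⟩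
  · refine OpenPartialHomeomorph.mem_maximalAtlas_of_contMDiffOn _ ?_ ?_
    · rw [OpenPartialHomeomorph.trans_source]
      exact (contMDiffOn_iff_contDiffOn.2 hφsm).comp ((contMDiffOn_chart he₀).mono inter_subset_left)
        fun x hx => hx.2
    · rw [htar]
      have h1 : ContMDiffOn 𝓘(ℝ, E) 𝓘(ℝ, E) ∞ φ T :=
        (contMDiff_iff_contDiff.2 hfe).contMDiffOn.congr fun v _ => hφ v
      exact (contMDiffOn_chart_symm he₀).comp h1 hφt
  · rw [htar] at hv
    have hLτ : ‖L v‖ ≤ τ := (hTL v hv).le.trans (min_le_right _ _)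
    refine (isExp_iff h q _ _).2 ⟨fun s => e₀.symm (Ψ s (z, L v)), _, (hΨ z _ hzτ hLτ).1, hI, ?_, ?_⟩
    · refine tangentBundle_ext he₀ ?_ ?_ ?_
      · rw [hbase z _ hzτ hLτ, hqz]
        exact hq.1
      · rw [hbase z _ hzτ hLτ, hqz]
      · rw [hvel z _ hzτ hLτ]
        exact (hLv v).symm
    · change e₀.symm (Ψ 1 (z, L v)) = e₀.symm (φ v)
      rw [hφ]

end ExponentialMap

/-! ### Energy densities in the characteristic directions. -/

section Energy

universe u

/-- Cauchy–Schwarz, from positivity at the vector `b w w • u - b u w • w`. -/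
theorem sq_apply_le_of_posDef {F : Type*} [NormedAddCommGroup F] [NormedSpace ℝ F]
    {b : F →L[ℝ] F →L[ℝ] ℝ} (hs : ∀ u w, b u w = b w u) (hpos : ∀ w, w ≠ 0 → 0 < b w w) (u w : F) :
    b u w ^ 2 ≤ b u u * b w w := by
  rcases eq_or_ne w 0 with rfl | hw
  · simp
  have h1 := hpos w hw
  have h2 : 0 ≤ b (b w w • u - b u w • w) (b w w • u - b u w • w) := by
    rcases eq_or_ne (b w w • u - b u w • w) 0 with h0 | h0
    · simp [h0]
    · exact (hpos _ h0).le
  simp only [map_sub, map_smul, sub_apply, smul_apply, smul_eq_mul, hs w u] at h2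
  have h3 : 0 ≤ b w w * (b u u * b w w - b u w ^ 2) := by linarith
  have h4 := nonneg_of_mul_nonneg_right h3 h1
  linarith

variable {E : Type u} [NormedAddCommGroup E] [NormedSpace ℝ E] [FiniteDimensional ℝ E]
  {M : Type*} [TopologicalSpace M] [ChartedSpace E M] [IsManifold 𝓘(ℝ, E) ∞ M]
  {e : OpenPartialHomeomorph M E} {B : FormField E M} {h : RiemMetric E M}

theorem vnorm_nonneg (h : RiemMetric E M) {p : M} (v : TangentSpace 𝓘(ℝ, E) p) : 0 ≤ vnorm h v :=
  Real.sqrt_nonneg _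

theorem RiemMetric.inner_self_nonneg (h : RiemMetric E M) {p : M} (v : TangentSpace 𝓘(ℝ, E) p) :
    0 ≤ h.inner p v v := by
  by_cases hv : v = 0
  · rw [hv, map_zero]
  · exact (h.pos p v hv).le

theorem sq_vnorm (h : RiemMetric E M) {p : M} (v : TangentSpace 𝓘(ℝ, E) p) :
    vnorm h v ^ 2 = h.inner p v v := Real.sq_sqrt (RiemMetric.inner_self_nonneg h v)

theorem abs_coordForm_le (h : RiemMetric E M) (he : e ∈ IsManifold.maximalAtlas 𝓘(ℝ, E) ∞ M)
    {z : E} (hz : z ∈ e.target) (u w : E) :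
    |coordForm h.inner e z u w| ≤
      √(coordForm h.inner e z u u) * √(coordForm h.inner e z w w) := by
  rw [← Real.sqrt_mul (coordForm_nonneg h he hz u)]
  refine Real.abs_le_sqrt ?_
  exact sq_apply_le_of_posDef (coordForm_symm h.isPseudoMetric z)
    (fun w hw => coordForm_pos h he hz hw) u w

theorem vnorm_add_le (h : RiemMetric E M) {p : M} (v w : TangentSpace 𝓘(ℝ, E) p) :
    vnorm h (v + w) ≤ vnorm h v + vnorm h w := by
  have he : chartAt E p ∈ IsManifold.maximalAtlas 𝓘(ℝ, E) ∞ M := IsManifold.chart_mem_maximalAtlas _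
  have hp := mem_chart_source E p
  have h1 := abs_coordForm_le h he (mem_chart_source E p |> (chartAt E p).map_source)
    (toCoord (chartAt E p) p v) (toCoord (chartAt E p) p w)
  rw [← formField_eq_coordForm h.inner he hp, ← vnorm_eq_coordForm h he hp,
    ← vnorm_eq_coordForm h he hp] at h1
  refine abs_le_of_sq_le_sq' ?_ (by linarith [vnorm_nonneg h v, vnorm_nonneg h w]) |>.2
  have h2 : vnorm h (v + w) ^ 2 = vnorm h v ^ 2 + 2 * h.inner p v w + vnorm h w ^ 2 := by
    rw [sq_vnorm, sq_vnorm, sq_vnorm, map_add, map_add]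
    have h3 : (h.inner p v + h.inner p w) v = h.inner p v v + h.inner p w v := add_apply _ _ _
    have h4 : (h.inner p v + h.inner p w) w = h.inner p v w + h.inner p w w := add_apply _ _ _
    rw [h3, h4, h.symm p w v]
    ring
  rw [h2]
  nlinarith [le_abs_self (h.inner p v w)]

/-- The bound on the Christoffel symbols at the centre of a normal chart. -/
theorem IsNormalChart.christoffel_center_le [T2Space M] {p : M} {r : ℝ}
    (hn : IsNormalChart h p r e)
    {G : ℝ≥0} (hG : christoffelBound h B p ≤ G) (a b : E) :
    √(coordForm h.inner e 0 (christoffel B e 0 a b) (christoffel B e 0 a b)) ≤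
      G * √(coordForm h.inner e 0 a a) * √(coordForm h.inner e 0 b b) := by
  set N : E → ℝ := fun a => √(coordForm h.inner e 0 a a) with hN
  have hsm : ∀ (s : ℝ) (a : E), N (s • a) = |s| * N a := by
    intro s a
    simp only [hN, map_smul, smul_apply, smul_eq_mul]
    rw [← mul_assoc, Real.sqrt_mul (mul_self_nonneg s), Real.sqrt_mul_self_eq_abs]
  have hunit : ∀ a b, N a ≤ 1 → N b ≤ 1 → N (christoffel B e 0 a b) ≤ G := by
    intro a b ha hb
    have h1 : ENNReal.ofReal (N (christoffel B e 0 a b)) ≤ christoffelNorm h B e 0 :=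
      le_iSup_of_le a (le_iSup_of_le b (le_iSup_of_le ha (le_iSup_of_le hb le_rfl)))
    -- Of the supremum over all normal charts and their points only the centre of `e` is used.
    have h2 : christoffelNorm h B e 0 ≤ christoffelBound h B p :=
      le_iSup_of_le r (le_iSup_of_le e (le_iSup_of_le hn (le_iSup_of_le 0
        (le_iSup_of_le hn.zero_mem_target le_rfl))))
    have h3 := h1.trans (h2.trans hG)
    rw [← ENNReal.ofReal_coe_nnreal] at h3
    exact (ENNReal.ofReal_le_ofReal_iff G.coe_nonneg).1 h3
  have hzero : ∀ a, a ≠ 0 → 0 < N a := fun a ha =>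
    Real.sqrt_pos.2 (coordForm_pos h hn.mem_atlas hn.zero_mem_target ha)
  change N (christoffel B e 0 a b) ≤ G * N a * N b
  rcases eq_or_ne a 0 with rfl | ha
  · rw [← christoffelL_apply]; simp [hN]
  rcases eq_or_ne b 0 with rfl | hb
  · rw [← christoffelL_apply]; simp [hN]
  have ha' := hzero a ha
  have hb' := hzero b hb
  have h1 := hunit ((N a)⁻¹ • a) ((N b)⁻¹ • b)
    (by rw [hsm, abs_of_pos (inv_pos.2 ha'), inv_mul_cancel₀ ha'.ne'])
    (by rw [hsm, abs_of_pos (inv_pos.2 hb'), inv_mul_cancel₀ hb'.ne'])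
  rw [← christoffelL_apply, map_smul, map_smul, smul_apply, hsm, hsm, abs_of_pos (inv_pos.2 ha'),
    abs_of_pos (inv_pos.2 hb'), christoffelL_apply] at h1
  calc N (christoffel B e 0 a b)
      = ((N b)⁻¹ * ((N a)⁻¹ * N (christoffel B e 0 a b))) * (N a * N b) := by field_simp
    _ ≤ G * (N a * N b) := by gcongr
    _ = G * N a * N b := by ring

/-- The energy density `|dy(a)|²`. -/
def energy (h : RiemMetric E M) (y : ℝ × ℝ → M) (a : ℝ × ℝ) (q : ℝ × ℝ) : ℝ :=
  vnorm h (mfderiv 𝓘(ℝ, ℝ × ℝ) 𝓘(ℝ, E) y q a) ^ 2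

theorem energy_eq (he : e ∈ IsManifold.maximalAtlas 𝓘(ℝ, E) ∞ M) {y : ℝ × ℝ → M} {q : ℝ × ℝ}
    (hy : MDifferentiableAt 𝓘(ℝ, ℝ × ℝ) 𝓘(ℝ, E) y q) (hq : y q ∈ e.source) (a : ℝ × ℝ) :
    energy h y a q =
      coordForm h.inner e (e (y q)) (fderiv ℝ (e ∘ y) q a) (fderiv ℝ (e ∘ y) q a) := by
  unfold energy
  rw [sq_vnorm, formField_eq_coordForm h.inner he hq, toCoord_mfderiv he hy hq]

variable [T2Space M]

/-- In a normal chart centred at `y q` the first derivatives of `h` vanish, so differentiating the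
energy only involves second coordinate derivatives of the map, which the wave equation controls. -/
theorem hasFDerivAt_energy {r : ℝ} {y : ℝ × ℝ → M} {q : ℝ × ℝ}
    (hn : IsNormalChart h (y q) r e) (hy : ContMDiffAt 𝓘(ℝ, ℝ × ℝ) 𝓘(ℝ, E) ∞ y q) (a : ℝ × ℝ) :
    ∃ L : ℝ × ℝ →L[ℝ] ℝ, HasFDerivAt (energy h y a) L q ∧ ∀ d, L d =
      2 * coordForm h.inner e 0 (fderiv ℝ (fderiv ℝ (e ∘ y)) q d a) (fderiv ℝ (e ∘ y) q a) := by
  have he := hn.mem_atlas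
  have hs := hn.center_mem_source
  have hz : ContDiffAt ℝ ∞ (e ∘ y) q := contDiffAt_chart_comp le_rfl he hy hs
  have hd1 : DifferentiableAt ℝ (e ∘ y) q := hz.differentiableAt (by simp)
  have hd2 : DifferentiableAt ℝ (fderiv ℝ (e ∘ y)) q :=
    (hz.fderiv_right (m := 1) (by norm_cast)).differentiableAt (by simp)
  have h0 : (e ∘ y) q = 0 := hn.apply_center
  have hF : DifferentiableAt ℝ (coordForm h.inner e) ((e ∘ y) q) := by
    rw [h0]
    exact ((contDiffOn_coordForm h.isPseudoMetric he).contDiffAt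
      (e.open_target.mem_nhds hn.zero_mem_target)).differentiableAt (by simp)
  have h1 : HasFDerivAt (fun p => fderiv ℝ (e ∘ y) p a) _ q :=
    hd2.hasFDerivAt.clm_apply (hasFDerivAt_const a q)
  have h2 : HasFDerivAt (fun p => coordForm h.inner e ((e ∘ y) p)) _ q :=
    hF.hasFDerivAt.comp q hd1.hasFDerivAt
  have h3 := (h2.clm_apply h1).clm_apply h1
  have h4 : energy h y a =ᶠ[𝓝 q] fun p => coordForm h.inner e ((e ∘ y) p)
      (fderiv ℝ (e ∘ y) p a) (fderiv ℝ (e ∘ y) p a) := by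
    filter_upwards [hy.continuousAt.preimage_mem_nhds (e.open_source.mem_nhds hs),
      ((contMDiffAt_iff_contMDiffAt_nhds (n := 1) (by simp)).1 (hy.of_le (by simp)))] with p hp hp'
    exact energy_eq he (hp'.mdifferentiableAt (by simp)) hp a
  refine ⟨_, h3.congr_of_eventuallyEq h4, fun d => ?_⟩
  have h5 := fun v b c => hn.fderiv_coordForm_center v b c
  rw [h0]
  simp [h5]
  rw [coordForm_symm h.isPseudoMetric 0 (fderiv ℝ (e ∘ y) q a)]
  ring

theorem continuousAt_energy (h : RiemMetric E M) {y : ℝ × ℝ → M} {q : ℝ × ℝ}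
    (hy : ContMDiffAt 𝓘(ℝ, ℝ × ℝ) 𝓘(ℝ, E) ∞ y q) (a : ℝ × ℝ) :
    ContinuousAt (energy h y a) q := by
  obtain ⟨r, -, hr⟩ := exists_isNormalChart h (y q)
  obtain ⟨e, hn⟩ := hr.self_of_nhds
  obtain ⟨L, hL, -⟩ := hasFDerivAt_energy hn hy a
  exact hL.continuousAt

/-- The energy density along one characteristic direction changes slowly in the other one. -/
theorem exists_hasFDerivAt_energy (hB : IsPseudoMetric B) {y : ℝ × ℝ → M} {q : ℝ × ℝ}
    (hy : ContMDiffAt 𝓘(ℝ, ℝ × ℝ) 𝓘(ℝ, E) ∞ y q) (hw : WaveAt B y q) {G : ℝ≥0}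
    (hG : christoffelBound h B (y q) ≤ G) {σ : ℝ} (hσ : σ = 1 ∨ σ = -1) :
    ∃ L : ℝ × ℝ →L[ℝ] ℝ, HasFDerivAt (energy h y (1, σ)) L q ∧
      |L (1, -σ)| ≤ 2 * G * (energy h y (1, σ) q * √(energy h y (1, -σ) q)) := by
  obtain ⟨r, -, hr⟩ := exists_isNormalChart h (y q)
  obtain ⟨e, hn⟩ := hr.self_of_nhds
  have he := hn.mem_atlas
  have hs := hn.center_mem_source
  obtain ⟨L, hL, hLd⟩ := hasFDerivAt_energy hn hy (1, σ)
  refine ⟨L, hL, ?_⟩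
  have hy1 : MDifferentiableAt 𝓘(ℝ, ℝ × ℝ) 𝓘(ℝ, E) y q := hy.mdifferentiableAt (by simp)
  have hz : ContDiffAt ℝ 2 (e ∘ y) q :=
    contDiffAt_chart_comp ENat.LEInfty.out he (hy.of_le ENat.LEInfty.out) hs
  have hw1 := (waveAt_iff hB he (hy.of_le ENat.LEInfty.out) hs).1 hw
  -- By symmetry of the Hessian the equation holds in either order of the two characteristic
  -- directions.
  have hw2 : coordHess B e (e ∘ y) q (1, -σ) (1, σ) = 0 := by
    rcases hσ with rfl | rfl
    · rw [coordHess_symm hB he hz (e.map_source hs), hw1]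
    · simpa using hw1
  have h0 : (e ∘ y) q = 0 := hn.apply_center
  unfold coordHess at hw2
  rw [h0] at hw2
  have h1 : fderiv ℝ (fderiv ℝ (e ∘ y)) q (1, -σ) (1, σ) =
      -christoffel B e 0 (fderiv ℝ (e ∘ y) q (1, -σ)) (fderiv ℝ (e ∘ y) q (1, σ)) :=
    eq_neg_of_add_eq_zero_left hw2
  rw [hLd, h1, energy_eq he hy1 hs, energy_eq he hy1 hs, hn.apply_center, map_neg, neg_apply,
    mul_neg, abs_neg, abs_mul, abs_two]
  set a := fderiv ℝ (e ∘ y) q (1, σ)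
  set b := fderiv ℝ (e ∘ y) q (1, -σ)
  have h2 := abs_coordForm_le h he hn.zero_mem_target (christoffel B e 0 b a) a
  have h3 := hn.christoffel_center_le (B := B) hG b a
  have h4 : coordForm h.inner e 0 a a = √(coordForm h.inner e 0 a a) * √(coordForm h.inner e 0 a a) :=
    (Real.mul_self_sqrt (coordForm_nonneg h he hn.zero_mem_target a)).symm
  calc 2 * |coordForm h.inner e 0 (christoffel B e 0 b a) a|
      ≤ 2 * ((G * √(coordForm h.inner e 0 b b) * √(coordForm h.inner e 0 a a)) *
          √(coordForm h.inner e 0 a a)) := by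
        refine mul_le_mul_of_nonneg_left (h2.trans ?_) zero_le_two
        exact mul_le_mul_of_nonneg_right h3 (Real.sqrt_nonneg _)
    _ = 2 * G * ((√(coordForm h.inner e 0 a a) * √(coordForm h.inner e 0 a a)) *
          √(coordForm h.inner e 0 b b)) := by ring
    _ = _ := by rw [← h4]

end Energy

/-! ### A priori bounds: confinement of curves and of energies. -/

section APriori

universe u

variable {E : Type u} [NormedAddCommGroup E] [NormedSpace ℝ E] [FiniteDimensional ℝ E]
  {M : Type*} [TopologicalSpace M] [ChartedSpace E M] [IsManifold 𝓘(ℝ, E) ∞ M]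
  {e : OpenPartialHomeomorph M E} {B : FormField E M} {h : RiemMetric E M}

-- Used with `c = y(·, x)` to keep a solution in the `δ`-neighbourhood of the initial curve, where
-- the bound `G` is available.
open scoped Bundle in
theorem hdist_le_of_vnorm_le (h : RiemMetric E M) {c : ℝ → M} {t C : ℝ} (ht : 0 ≤ t)
    (hc : ContMDiffOn 𝓘(ℝ, ℝ) 𝓘(ℝ, E) 1 c (Icc 0 t))
    (hC : ∀ s ∈ Ioo 0 t, vnorm h (velocity E c s) ≤ C) :
    hdist h (c 0) (c t) ≤ ENNReal.ofReal C * ENNReal.ofReal t := by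
  unfold hdist
  let : Bundle.RiemannianBundle (fun p : M ↦ TangentSpace 𝓘(ℝ, E) p) := ⟨h.toRiemannianMetric⟩
  refine (riemannianEDist_le_pathELength hc rfl rfl ht).trans ?_
  rw [pathELength_eq_lintegral_mfderiv_Ioo]
  calc ∫⁻ s in Ioo 0 t, ‖mfderiv 𝓘(ℝ, ℝ) 𝓘(ℝ, E) c s (1 : ℝ)‖ₑ
      ≤ ∫⁻ _ in Ioo 0 t, ENNReal.ofReal C := by
        refine MeasureTheory.setLIntegral_mono measurable_const fun s hs => ?_
        rw [← ofReal_norm]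
        refine ENNReal.ofReal_le_ofReal (le_trans (le_of_eq ?_) (hC s hs))
        rw [norm_eq_sqrt_real_inner]
        rfl
    _ = _ := by simp

/-- This compactness takes the place of completeness: a solution that is confined to such a ball has
cluster points. -/
theorem IsNormalChart.isCompact_ball [T2Space M] {p : M} {r r' : ℝ} (hn : IsNormalChart h p r e)
    (hr : r' < r) :
    IsCompact (e.symm '' {z | √(coordForm h.inner e 0 z z) ≤ r'}) ∧
      {z | √(coordForm h.inner e 0 z z) ≤ r'} ⊆ e.target := by
  have : ProperSpace E := FiniteDimensional.proper ℝ E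
  have hsub : {z | √(coordForm h.inner e 0 z z) ≤ r'} ⊆ e.target := fun z hz =>
    hn.mem_target_iff.2 (lt_of_le_of_lt hz hr)
  have hc : Continuous fun z : E => √(coordForm h.inner e 0 z z) :=
    Real.continuous_sqrt.comp ((coordForm h.inner e 0).continuous.clm_apply continuous_id)
  obtain ⟨m, hm, hmle⟩ := exists_norm_le_coordForm h hn.mem_atlas (isCompact_singleton (x := (0 : E)))
    (singleton_subset_iff.2 hn.zero_mem_target)
  have hcomp : IsCompact {z | √(coordForm h.inner e 0 z z) ≤ r'} := by
    refine (isCompact_closedBall (0 : E) (r' / m)).of_isClosed_subset (isClosed_le hc continuous_const)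
      fun z hz => ?_
    rw [mem_closedBall_zero_iff, le_div_iff₀' hm]
    exact (hmle 0 rfl z).trans hz
  exact ⟨hcomp.image_of_continuousOn (e.continuousOn_symm.mono hsub), hsub⟩

/-- A curve of length at most `r'` from the centre of a normal chart stays in the ball of radius
`r'`. -/
theorem IsNormalChart.mem_ball_of_vnorm_le [T2Space M] {p : M} {r r' : ℝ}
    (hn : IsNormalChart h p r e) (hr : r' < r) {c : ℝ → M} {t C : ℝ} (hC : 0 ≤ C)
    (hc : ∀ s ∈ Icc 0 t, ContMDiffAt 𝓘(ℝ, ℝ) 𝓘(ℝ, E) 1 c s) (h0 : c 0 = p)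
    (hcC : ∀ s ∈ Icc 0 t, vnorm h (velocity E c s) ≤ C) (hCr : C * t < r') :
    ∀ s ∈ Icc 0 t, c s ∈ e.symm '' {z | √(coordForm h.inner e 0 z z) ≤ r'} := by
  obtain ⟨hcomp, hsub⟩ := hn.isCompact_ball hr
  have he := hn.mem_atlas
  refine forall_mem_of_confined hcomp.isClosed e.open_source ?_
    (fun s hs => (hc s hs).continuousAt.continuousWithinAt) (h0 ▸ hn.center_mem_source) ?_
  · rintro _ ⟨z, hz, rfl⟩
    exact e.map_target (hsub hz)
  intro τ hτ hsrc
  set z := e ∘ c with hzdef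
  have hIcc : ∀ s ∈ Icc 0 τ, s ∈ Icc 0 t := fun s hs => ⟨hs.1, hs.2.trans hτ.2⟩
  have hzd : ∀ s ∈ Icc 0 τ, HasDerivAt z (deriv z s) s := fun s hs =>
    ((contDiffAt_chart_comp (by simp) he (hc s (hIcc s hs)) (hsrc s hs)).differentiableAt
      (by simp)).hasDerivAt
  have hzt : ∀ s ∈ Icc 0 τ, z s ∈ e.target := fun s hs => e.map_source (hsrc s hs)
  -- The slack left at time `τ`. It regularizes the square root at `0`: `√(N + ε²)` starts at `ε`
  -- and grows at a rate of at most `C`, so it ends below `r'`.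
  set ε := r' - C * τ with hε
  have hε0 : 0 < ε := by
    have : C * τ ≤ C * t := mul_le_mul_of_nonneg_left hτ.2 hC
    linarith
  set N : ℝ → ℝ := fun s => coordForm h.inner e 0 (z s) (z s) with hN
  have hN0 : ∀ s, 0 ≤ N s := fun s => coordForm_nonneg h he hn.zero_mem_target _
  have hNd : ∀ s ∈ Icc 0 τ, HasDerivAt N (2 * coordForm h.inner e 0 (z s) (deriv z s)) s := by
    intro s hs
    have h1 := ((hasDerivAt_const s (coordForm h.inner e 0)).clm_apply (hzd s hs)).clm_apply
      (hzd s hs)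
    refine h1.congr_deriv ?_
    simp only [zero_apply, zero_add]
    rw [coordForm_symm h.isPseudoMetric 0 (deriv z s)]
    ring
  -- The Gauss lemma replaces `h` at the centre by `h` at `z s` in the pairing with the radial
  -- vector, where the speed of the curve is known.
  have hNb : ∀ s ∈ Icc 0 τ, |coordForm h.inner e 0 (z s) (deriv z s)| ≤ √(N s) * C := by
    intro s hs
    rw [← hn.gauss (hzt s hs)]
    have h1 := abs_coordForm_le h he (hzt s hs) (z s) (deriv z s)
    rw [hn.coordForm_radial_self (hzt s hs)] at h1
    refine h1.trans (mul_le_mul_of_nonneg_left ?_ (Real.sqrt_nonneg _))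
    have h2 := hcC s (hIcc s hs)
    rw [vnorm_eq_coordForm h he (hsrc s hs),
      toCoord_velocity he ((hc s (hIcc s hs)).mdifferentiableAt (by simp)) (hsrc s hs)] at h2
    exact h2
  have hpos : ∀ s, 0 < N s + ε ^ 2 := fun s => by have := hN0 s; positivity
  have hfd : ∀ s ∈ Icc 0 τ, HasDerivAt (fun s => √(N s + ε ^ 2))
      (2 * coordForm h.inner e 0 (z s) (deriv z s) / (2 * √(N s + ε ^ 2))) s := fun s hs =>
    ((hNd s hs).add_const (ε ^ 2)).sqrt (hpos s).ne'
  have h1 := norm_image_sub_le_of_norm_deriv_le_segment' (C := C)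
    (fun s hs => (hfd s hs).hasDerivWithinAt) (fun s hs => ?_) τ ⟨hτ.1, le_rfl⟩
  · have hz0 : z 0 = 0 := by
      rw [hzdef, Function.comp_apply, h0]
      exact hn.apply_center
    have hN00 : N 0 = 0 := by simp [hN, hz0]
    rw [hN00, zero_add, Real.sqrt_sq hε0.le, sub_zero, Real.norm_eq_abs] at h1
    have h2 := (le_abs_self _).trans h1
    refine ⟨z τ, ?_, e.left_inv (hsrc τ ⟨hτ.1, le_rfl⟩)⟩
    have h3 : √(N τ) ≤ √(N τ + ε ^ 2) := Real.sqrt_le_sqrt (by nlinarith)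
    change √(N τ) ≤ r'
    linarith
  · have hs' : s ∈ Icc 0 τ := ⟨hs.1, hs.2.le⟩
    have h3 : 0 < √(N s + ε ^ 2) := Real.sqrt_pos.2 (hpos s)
    have h4 : √(N s) ≤ √(N s + ε ^ 2) := Real.sqrt_le_sqrt (by nlinarith)
    rw [Real.norm_eq_abs, mul_div_mul_left _ _ two_ne_zero, abs_div, abs_of_pos h3, div_le_iff₀ h3]
    refine (hNb s hs').trans ?_
    rw [mul_comm C]
    exact mul_le_mul_of_nonneg_right h4 hC

variable {y : ℝ × ℝ → M}

theorem velocity_comp_line {q d : ℝ × ℝ} {ℓ : ℝ → ℝ × ℝ} {s : ℝ} (hℓ : HasDerivAt ℓ d s)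
    (hq : ℓ s = q) (hy : MDifferentiableAt 𝓘(ℝ, ℝ × ℝ) 𝓘(ℝ, E) y q) :
    vnorm h (velocity E (fun s => y (ℓ s)) s) = vnorm h (mfderiv 𝓘(ℝ, ℝ × ℝ) 𝓘(ℝ, E) y q d) := by
  subst hq
  have h1 := (hy.hasMFDerivAt.comp s hℓ.hasFDerivAt.hasMFDerivAt).mfderiv
  unfold velocity
  refine congrArg (vnorm h) ((congrArg (fun L : ℝ →L[ℝ] E => L 1) h1).trans ?_)
  change mfderiv 𝓘(ℝ, ℝ × ℝ) 𝓘(ℝ, E) y (ℓ s) (((1 : ℝ) • d : ℝ × ℝ)) = _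
  rw [one_smul]

/-- For `σ = 1` the vector `d` is `(1, 0)` and for `σ = -1` it is `(0, 1)`: both are half the sum or
difference of the characteristic directions, so their images have norm at most the average. -/
theorem vnorm_dt_le {q : ℝ × ℝ} {C : ℝ} (hC : 0 ≤ C) (h1 : energy h y (1, 1) q ≤ C ^ 2)
    (h2 : energy h y (1, -1) q ≤ C ^ 2) (σ : ℝ) (hσ : σ = 1 ∨ σ = -1) (d : ℝ × ℝ)
    (hd : d = (1 / 2 : ℝ) • ((1, 1) : ℝ × ℝ) + (σ / 2) • ((1, -1) : ℝ × ℝ)) :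
    vnorm h (mfderiv 𝓘(ℝ, ℝ × ℝ) 𝓘(ℝ, E) y q d) ≤ C := by
  have h3 := abs_le_of_sq_le_sq h1 hC
  have h4 := abs_le_of_sq_le_sq h2 hC
  have h5 := (le_abs_self _).trans h3
  have h6 := (le_abs_self _).trans h4
  let A : ℝ × ℝ →L[ℝ] E := mfderiv 𝓘(ℝ, ℝ × ℝ) 𝓘(ℝ, E) y q
  have h9 : A d = (1 / 2 : ℝ) • A (1, 1) + (σ / 2) • A (1, -1) := by
    rw [hd, map_add, map_smul, map_smul]
  refine (congrArg (vnorm h (p := y q)) h9).le.trans ((vnorm_add_le h _ _).trans ?_)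
  refine (congrArg₂ (· + ·) (vnorm_smul h (p := y q) _ _) (vnorm_smul h (p := y q) _ _)).le.trans ?_
  change |1 / 2| * vnorm h (mfderiv 𝓘(ℝ, ℝ × ℝ) 𝓘(ℝ, E) y q ((1, 1) : ℝ × ℝ)) +
    |σ / 2| * vnorm h (mfderiv 𝓘(ℝ, ℝ × ℝ) 𝓘(ℝ, E) y q ((1, -1) : ℝ × ℝ)) ≤ C
  have h7 : |σ / 2| = 1 / 2 := by rcases hσ with rfl | rfl <;> norm_num [abs_div]
  have h8 : |(1 / 2 : ℝ)| = 1 / 2 := by norm_num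
  rw [h7, h8]
  linarith

/-- The a priori bound for the first derivatives of a wave map on a triangle. -/
theorem energy_le_of_wave [T2Space M] (hB : IsPseudoMetric B) {D : Set (ℝ × ℝ)} (hD : IsOpen D)
    (hy : IsWave B D y) {x₀ R : ℝ} (hTD : fwdTriangle 0 x₀ R ⊆ D) {C δ : ℝ} {G : ℝ≥0} (hC : 0 < C)
    (hG : ∀ x, |x - x₀| ≤ R → ∀ p, hdist h (y (0, x)) p < ENNReal.ofReal δ →
      christoffelBound h B p ≤ G)
    (hδ : 2 * C * R < δ) (hCG : 8 * (C * R * G) ≤ 1)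
    (h0 : ∀ x, |x - x₀| ≤ R → ∀ σ : ℝ, (σ = 1 ∨ σ = -1) → energy h y (1, σ) (0, x) ≤ C ^ 2) :
    ∀ q ∈ fwdTriangle 0 x₀ R, ∀ σ : ℝ, (σ = 1 ∨ σ = -1) → energy h y (1, σ) q ≤ (2 * C) ^ 2 := by
  have hys : ∀ q ∈ fwdTriangle 0 x₀ R, ContMDiffAt 𝓘(ℝ, ℝ × ℝ) 𝓘(ℝ, E) ∞ y q := fun q hq =>
    hy.contMDiffAt (by rw [hD.interior_eq]; exact hTD hq)
  have hw : ∀ q ∈ fwdTriangle 0 x₀ R, WaveAt B y q := fun q hq =>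
    hy.2 q (by rw [hD.interior_eq]; exact hTD hq)
  set m : ℝ × ℝ → ℝ := fun q => max (energy h y (1, 1) q) (energy h y (1, -1) q) with hm
  have hmc : ContinuousOn m (fwdTriangle 0 x₀ R) := fun q hq =>
    (show ContinuousAt m q from (continuousAt_energy h (hys q hq) _).max
      (continuousAt_energy h (hys q hq) _)).continuousWithinAt
  have hmσ : ∀ q (σ : ℝ), (σ = 1 ∨ σ = -1) → energy h y (1, σ) q ≤ m q := by
    rintro q σ (rfl | rfl)
    exacts [le_max_left _ _, le_max_right _ _]
  suffices hsuf : ∀ q ∈ fwdTriangle 0 x₀ R, m q < (2 * C) ^ 2 from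
    fun q hq σ hσ => (hmσ q σ hσ).trans (hsuf q hq).le
  by_contra! hcon
  obtain ⟨q₁, hq₁, hq₁m⟩ := hcon
  have hbad : IsCompact (fwdTriangle 0 x₀ R ∩ m ⁻¹' Ici ((2 * C) ^ 2)) :=
    (isCompact_fwdTriangle 0 x₀ R).of_isClosed_subset
      (hmc.preimage_isClosed_of_isClosed (isClosed_fwdTriangle _ _ _) isClosed_Ici) inter_subset_left
  -- A lowest point at which one of the energies reaches `(2 * C) ^ 2`; strictly below it the bound
  -- holds.
  obtain ⟨q, hq, hmin⟩ := hbad.exists_isMinOn ⟨q₁, hq₁, hq₁m⟩ continuous_fst.continuousOn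
  obtain ⟨t, x⟩ := q
  obtain ⟨⟨ht0, htx⟩, hqm⟩ := hq
  simp only at ht0 htx
  have hbelow : ∀ q' ∈ fwdTriangle 0 x₀ R, q'.1 < t → m q' < (2 * C) ^ 2 := by
    intro q' hq' hlt
    by_contra! hge
    have : t ≤ q'.1 := hmin (⟨hq', hge⟩ : q' ∈ fwdTriangle 0 x₀ R ∩ m ⁻¹' Ici ((2 * C) ^ 2))
    linarith
  -- Strictly below the height `t` the curves `y(·, x')` have speed at most `2 * C`, so they stay
  -- within `2 * C * R < δ` of the initial curve.
  have hGq : ∀ q' ∈ fwdTriangle 0 x₀ R, q'.1 < t → christoffelBound h B (y q') ≤ G := by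
    rintro ⟨s, x'⟩ hq' hlt
    obtain ⟨hs0, hsx⟩ := hq'
    simp only at hs0 hsx hlt
    have hmem : ∀ σ ∈ Icc 0 s, ((σ, x') : ℝ × ℝ) ∈ fwdTriangle 0 x₀ R := fun σ hσ =>
      ⟨hσ.1, by simp only; linarith [hσ.2]⟩
    refine hG x' (by linarith) _ (lt_of_le_of_lt (hdist_le_of_vnorm_le h (C := 2 * C)
      (c := fun σ => y (σ, x')) hs0 (fun σ hσ => ?_) fun σ hσ => ?_) ?_)
    · exact (((hys _ (hmem σ hσ)).of_le (by simp)).comp σ (contMDiffAt_iff_contDiffAt.2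
        (by fun_prop : ContDiffAt ℝ 1 (fun σ : ℝ => ((σ, x') : ℝ × ℝ)) σ))).contMDiffWithinAt
    · have hσ' : σ ∈ Icc 0 s := Ioo_subset_Icc_self hσ
      have hd : HasDerivAt (fun σ : ℝ => ((σ, x') : ℝ × ℝ)) (1, 0) σ :=
        (hasDerivAt_id σ).prodMk (hasDerivAt_const σ x')
      refine (velocity_comp_line hd rfl ((hys _ (hmem σ hσ')).mdifferentiableAt (by simp))).le.trans ?_
      have h1 := (hbelow _ (hmem σ hσ') (hσ.2.trans hlt)).le
      exact vnorm_dt_le (by positivity) ((hmσ _ 1 (Or.inl rfl)).trans h1)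
        ((hmσ _ (-1) (Or.inr rfl)).trans h1) 1 (Or.inl rfl) _ (by norm_num)
    · rw [← ENNReal.ofReal_mul (by positivity), ENNReal.ofReal_lt_ofReal_iff_of_nonneg (by positivity)]
      have : s ≤ R := by linarith [abs_nonneg (x' - x₀)]
      refine lt_of_le_of_lt ?_ hδ
      gcongr
  have htR : t ≤ R := by linarith [abs_nonneg (x - x₀)]
  have hG0 : (0 : ℝ) ≤ G := G.coe_nonneg
  have hfin : ∀ σ : ℝ, (σ = 1 ∨ σ = -1) → energy h y (1, σ) (t, x) < (2 * C) ^ 2 := by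
    intro σ hσ
    have hσ1 : |σ| = 1 := by rcases hσ with rfl | rfl <;> simp
    have hσn : -σ = 1 ∨ -σ = -1 := by rcases hσ with rfl | rfl <;> simp
    -- The characteristic through `(t, x)` with direction `(1, -σ)`, along which the energy for `(1,
    -- σ)` is controlled.
    set ℓ : ℝ → ℝ × ℝ := fun s => (s, x + σ * (t - s)) with hℓ
    have hmem : ∀ s ∈ Icc 0 t, ℓ s ∈ fwdTriangle 0 x₀ R := by
      intro s hs
      refine ⟨hs.1, ?_⟩
      have h1 : x + σ * (t - s) - x₀ = (x - x₀) + σ * (t - s) := by ring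
      have h2 := abs_add_le (x - x₀) (σ * (t - s))
      rw [abs_mul, hσ1, one_mul, abs_of_nonneg (sub_nonneg.2 hs.2)] at h2
      simp only [hℓ]
      rw [h1]
      linarith
    have hℓd : ∀ s, HasDerivAt ℓ (1, -σ) s := by
      intro s
      have h1 : HasDerivAt (fun s : ℝ => x + σ * (t - s)) (-σ) s := by
        simpa using (((hasDerivAt_id s).const_sub t).const_mul σ).const_add x
      exact (hasDerivAt_id s).prodMk h1
    have hcont : ContinuousOn (fun s => energy h y (1, σ) (ℓ s)) (Icc 0 t) := fun s hs =>
      ((continuousAt_energy h (hys _ (hmem s hs)) (1, σ)).comp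
        (hℓd s).continuousAt).continuousWithinAt
    choose! L hL hLb using fun s (hs : s ∈ Ico 0 t) =>
      exists_hasFDerivAt_energy (h := h) hB (hys _ (hmem s (Ico_subset_Icc_self hs)))
        (hw _ (hmem s (Ico_subset_Icc_self hs)))
        (hGq _ (hmem s (Ico_subset_Icc_self hs)) (show (ℓ s).1 < t from hs.2)) hσ
    have hderiv : ∀ s ∈ Ico 0 t, HasDerivWithinAt (fun s => energy h y (1, σ) (ℓ s))
        (L s (1, -σ)) (Ici s) s := fun s hs =>
      ((hL s hs).comp_hasDerivAt s (hℓd s)).hasDerivWithinAt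
    have hbound : ∀ s ∈ Ico 0 t, ‖L s (1, -σ)‖ ≤ 16 * G * C ^ 3 := by
      intro s hs
      have h1 := (hbelow _ (hmem s (Ico_subset_Icc_self hs)) (show (ℓ s).1 < t from hs.2)).le
      have h2 := (hmσ _ σ hσ).trans h1
      have h3 : √(energy h y (1, -σ) (ℓ s)) ≤ 2 * C :=
        Real.sqrt_le_iff.2 ⟨by positivity, (hmσ _ (-σ) hσn).trans h1⟩
      have h4 : 0 ≤ energy h y (1, σ) (ℓ s) := sq_nonneg _
      refine (hLb s hs).trans ?_
      calc 2 * G * (energy h y (1, σ) (ℓ s) * √(energy h y (1, -σ) (ℓ s)))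
          ≤ 2 * G * ((2 * C) ^ 2 * (2 * C)) := by gcongr
        _ = 16 * G * C ^ 3 := by ring
    have h1 := norm_image_sub_le_of_norm_deriv_right_le_segment hcont hderiv hbound t
      ⟨ht0, le_rfl⟩
    have hℓt : ℓ t = (t, x) := by simp [hℓ]
    have h2 := h0 (ℓ 0).2 ((hmem 0 ⟨le_rfl, ht0⟩).2.trans_eq (sub_zero R)) σ hσ
    have hℓ0 : ((0 : ℝ), (ℓ 0).2) = ℓ 0 := rfl
    rw [hℓ0] at h2
    rw [hℓt, sub_zero, Real.norm_eq_abs] at h1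
    have h3 := (le_abs_self _).trans h1
    -- The energy starts at no more than `C ^ 2` and gains at most `2 * C ^ 2`, so it ends at no
    -- more than `3 * C ^ 2 < (2 * C) ^ 2`.
    have h4 : 16 * G * C ^ 3 * t ≤ 2 * C ^ 2 := by
      have h5 : C ^ 2 * (8 * (C * t * G)) ≤ C ^ 2 * 1 := by
        refine mul_le_mul_of_nonneg_left (le_trans ?_ hCG) (sq_nonneg C)
        gcongr
      nlinarith
    nlinarith [sq_pos_of_pos hC]
  have : m (t, x) < (2 * C) ^ 2 := max_lt (hfin 1 (Or.inl rfl)) (hfin (-1) (Or.inr rfl))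
  exact absurd hqm (not_le.2 this)

end APriori

/-! ### Gluing, the maximal solution and its extension property. -/

section MaximalSolution

universe u

variable {E : Type u} [NormedAddCommGroup E] [NormedSpace ℝ E] [FiniteDimensional ℝ E]
  {M : Type*} [TopologicalSpace M] [ChartedSpace E M] [IsManifold 𝓘(ℝ, E) ∞ M]
  {B : FormField E M} {h : RiemMetric E M} {k : ℝ → TangentBundle 𝓘(ℝ, E) M}
  {y y' : ℝ × ℝ → M} {D D' : Set (ℝ × ℝ)} {q : ℝ × ℝ}

theorem cauchyData_of_isOpen (hD : IsOpen D) (hq : q ∈ D) :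
    cauchyData (E := E) D y q = cauchyData univ y q := by
  unfold cauchyData
  rw [mfderivWithin_of_isOpen hD hq, mfderivWithin_univ]

theorem cauchyData_congr (hy : y =ᶠ[𝓝 q] y') :
    cauchyData (E := E) univ y q = cauchyData univ y' q := by
  have h1 : mfderiv 𝓘(ℝ, ℝ × ℝ) 𝓘(ℝ, E) y q ((1, 0) : ℝ × ℝ) =
      (mfderiv 𝓘(ℝ, ℝ × ℝ) 𝓘(ℝ, E) y' q ((1, 0) : ℝ × ℝ) : E) :=
    congrArg (fun L : ℝ × ℝ →L[ℝ] E => L (1, 0)) hy.mfderiv_eq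
  unfold cauchyData
  rw [mfderivWithin_univ, mfderivWithin_univ]
  have key : ∀ (a b : M) (v w : E), a = b → v = w →
      (⟨a, v⟩ : TangentBundle 𝓘(ℝ, E) M) = ⟨b, w⟩ := by
    rintro a _ v _ rfl rfl
    rfl
  exact key _ _ _ _ hy.self_of_nhds h1

theorem isWave_of_local
    (hloc : ∀ p ∈ D, ∃ (D' : Set (ℝ × ℝ)) (y' : ℝ × ℝ → M), IsOpen D' ∧ p ∈ D' ∧ IsWave B D' y' ∧
      y' =ᶠ[𝓝 p] y) : IsWave B D y := by
  refine ⟨fun p hp => ?_, fun p hp => ?_⟩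
  · obtain ⟨D', y', hD', hpD', hy', heq⟩ := hloc p hp
    exact ((hy'.contMDiffAt (by rwa [hD'.interior_eq])).congr_of_eventuallyEq
      heq.symm).contMDiffWithinAt
  · obtain ⟨D', y', hD', hpD', hy', heq⟩ := hloc p (interior_subset hp)
    exact (hy'.2 p (by rwa [hD'.interior_eq])).congr heq

/-- A wave map with Cauchy data `k` on an open characteristically closed set. -/
structure IsSolution (B : FormField E M) (k : ℝ → TangentBundle 𝓘(ℝ, E) M) (D : Set (ℝ × ℝ))
    (y : ℝ × ℝ → M) : Prop where
  isOpen : IsOpen D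
  isCharClosed : IsCharClosed D
  isWave : IsWave B D y
  hasData : HasData k D y

theorem IsSolution.cauchyData_eq (hy : IsSolution B k D y) {x : ℝ} (hx : (0, x) ∈ D) :
    cauchyData univ y (0, x) = k x := by
  rw [← cauchyData_of_isOpen hy.isOpen hx]
  exact hy.hasData x hx

theorem IsSolution.mono (hy : IsSolution B k D y) (hD' : IsOpen D') (hc : IsCharClosed D')
    (hsub : D' ⊆ D) : IsSolution B k D' y := by
  refine ⟨hD', hc, hy.isWave.mono hsub, fun x hx => ?_⟩
  refine (cauchyData_of_isOpen hD' hx).trans (hy.cauchyData_eq (hsub hx))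

theorem IsCharClosed.inter (hD : IsCharClosed D) (hD' : IsCharClosed D') : IsCharClosed (D ∩ D') :=
  fun p hp => subset_inter (hD p hp.1) (hD' p hp.2)

variable [T2Space M]

theorem IsSolution.eqOn_inter (hB : IsPseudoMetric B) (hy : IsSolution B k D y)
    (hy' : IsSolution B k D' y') : EqOn y y' (D ∩ D') := by
  have hc := hy.isCharClosed.inter hy'.isCharClosed
  have ho := hy.isOpen.inter hy'.isOpen
  have h1 := hy.mono ho hc inter_subset_left
  have h2 := hy'.mono ho hc inter_subset_right
  refine wave_unique hB hc (y := ![y, y']) (k := k) (fun j => ?_) (fun j => ?_)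
  · fin_cases j
    exacts [h1.isWave, h2.isWave]
  · fin_cases j
    exacts [h1.hasData, h2.hasData]

/-- There is a solution with the largest domain. -/
theorem exists_maximal_solution (hB : IsPseudoMetric B) (k : ℝ → TangentBundle 𝓘(ℝ, E) M) :
    ∃ (U : Set (ℝ × ℝ)) (Y : ℝ × ℝ → M), IsSolution B k U Y ∧
      ∀ D y, IsSolution B k D y → D ⊆ U := by
  classical
  set U : Set (ℝ × ℝ) := {p | ∃ (D : Set (ℝ × ℝ)) (y : ℝ × ℝ → M), IsSolution B k D y ∧ p ∈ D}
    with hU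
  have : Nonempty M := ⟨(k 0).1⟩
  choose! D y hsol hmem using fun p (hp : p ∈ U) => hp
  have hDU : ∀ p ∈ U, D p ⊆ U := fun p hp q hq => ⟨D p, y p, hsol p hp, hq⟩
  -- The chosen solutions agree on overlaps, because an intersection of characteristically closed
  -- sets is characteristically closed and uniqueness applies there. So evaluating each at its own
  -- point gives a solution.
  set Y : ℝ × ℝ → M := fun p => y p p with hY
  have heq : ∀ p ∈ U, EqOn (y p) Y (D p) := fun p hp q hq =>
    (hsol p hp).eqOn_inter hB (hsol q (hDU p hp hq)) ⟨hq, hmem q (hDU p hp hq)⟩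
  have heq' : ∀ p ∈ U, y p =ᶠ[𝓝 p] Y := fun p hp =>
    (heq p hp).eventuallyEq_of_mem ((hsol p hp).isOpen.mem_nhds (hmem p hp))
  have hUo : IsOpen U := isOpen_iff_mem_nhds.2 fun p hp =>
    mem_of_superset ((hsol p hp).isOpen.mem_nhds (hmem p hp)) (hDU p hp)
  refine ⟨U, Y, ⟨hUo, fun p hp => ?_, isWave_of_local fun p hp => ?_, fun x hx => ?_⟩,
    fun D y hy p hp => ⟨D, y, hy, hp⟩⟩
  · exact ((hsol p hp).isCharClosed p (hmem p hp)).trans (hDU p hp)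
  · exact ⟨D p, y p, (hsol p hp).isOpen, hmem p hp, (hsol p hp).isWave, heq' p hp⟩
  · refine (cauchyData_of_isOpen hUo hx).trans ?_
    rw [← cauchyData_congr (heq' _ hx)]
    exact (hsol _ hx).cauchyData_eq (hmem _ hx)

theorem isCharClosed_diamond (x₀ ρ : ℝ) : IsCharClosed (diamond 0 x₀ ρ) := by
  intro p hp q hq
  have h1 : |p.1 - 0| + |p.2 - x₀| < ρ := hp
  have h2 := hq.2
  have h3 := abs_sub_le q.2 p.2 x₀
  change |q.1 - 0| + |q.2 - x₀| < ρ
  rw [sub_zero] at *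
  linarith

theorem scaleVec_one (v : TangentBundle 𝓘(ℝ, E) M) : scaleVec 1 v = v := by
  unfold scaleVec
  rw [one_smul]

/-- A maximal solution contains the forward domain of dependence of each interval on which it is
defined and above which a local solution exists. -/
theorem IsSolution.extend (hB : IsPseudoMetric B) (hy : IsSolution B k D y)
    (hmax : ∀ D' y', IsSolution B k D' y' → D' ⊆ D) {s₀ x₀ ρ : ℝ} (hs₀ : 0 ≤ s₀)
    (hbase : ∀ x, |x - x₀| < ρ → (s₀, x) ∈ D) {z : ℝ × ℝ → M} (hz : IsWave B (diamond 0 x₀ ρ) z)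
    (hdata : ∀ x, |x - x₀| < ρ →
      cauchyData (E := E) (diamond 0 x₀ ρ) z (0, x) = cauchyData D y (s₀, x)) :
    openTriangle s₀ x₀ (s₀ + ρ) ⊆ D := by
  classical
  have hDo := hy.isOpen
  set Δ : Set (ℝ × ℝ) := timeMap (-s₀) 1 ⁻¹' diamond 0 x₀ ρ with hΔ
  have hΔo : IsOpen Δ := (isOpen_diamond 0 x₀ ρ).preimage
    (contDiff_timeMap (-s₀) 1 (n := 0)).continuous
  have hΔmem : ∀ p : ℝ × ℝ, p ∈ Δ ↔ |p.1 - s₀| + |p.2 - x₀| < ρ := by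
    intro p
    have h1 : -s₀ + 1 * p.1 - 0 = p.1 - s₀ := by ring
    change |(-s₀ + 1 * p.1) - 0| + |p.2 - x₀| < ρ ↔ _
    rw [h1]
  have hzΔ : IsWave B Δ (z ∘ timeMap (-s₀) 1) :=
    hz.comp_timeMap hB (Or.inl rfl) fun p hp => hp
  set Tr := openTriangle s₀ x₀ (s₀ + ρ) with hTr
  have hTro : IsOpen Tr := isOpen_openTriangle _ _ _
  have hTrΔ : Tr ⊆ Δ := by
    rintro p ⟨h1, h2⟩
    rw [hΔmem, abs_of_pos (sub_pos.2 h1)]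
    linarith
  have hzdata : ∀ x, |x - x₀| < ρ →
      cauchyData (E := E) Δ (z ∘ timeMap (-s₀) 1) (s₀, x) = cauchyData D y (s₀, x) := by
    intro x hx
    have hmem : (s₀, x) ∈ Δ := by rw [hΔmem]; simpa using hx
    have h0 : timeMap (-s₀) 1 (s₀, x) = (0, x) := by simp [timeMap]
    have h1 : timeMap (-s₀) 1 (s₀, x) ∈ diamond 0 x₀ ρ := hmem
    have h2 : MapsTo (timeMap (-s₀) 1) Δ (diamond 0 x₀ ρ) := fun p hp => hp
    rw [cauchyData_comp_timeMap h2
      (hΔo.uniqueDiffWithinAt hmem) ((hz.1 _ h1).mdifferentiableWithinAt (by simp)), scaleVec_one, h0,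
      hdata x hx]
  -- Uniqueness on the triangle with apex `p` and base at the height `s₀`, which lies in both
  -- domains.
  have hagree : ∀ p ∈ D ∩ Tr, y p = (z ∘ timeMap (-s₀) 1) p := by
    rintro p ⟨hpD, hpT⟩
    have hR : 0 < p.1 - s₀ := sub_pos.2 hpT.1
    have hp1 : 0 ≤ p.1 := hs₀.trans (le_of_lt hpT.1)
    have hpT2 : |p.2 - x₀| < s₀ + ρ - p.1 := hpT.2
    have h1 := wave_unique_timeMap hB (s₀ := s₀) (σ := 1) (Or.inl rfl) (x₀ := p.2) hR
      (D := ![D, Δ]) (y := ![y, z ∘ timeMap (-s₀) 1]) ?_ ?_ ?_ (p.1 - s₀, p.2) ⟨hR.le, by simp⟩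
    · have h2 : timeMap s₀ 1 (p.1 - s₀, p.2) = p := by simp [timeMap]
      rw [h2] at h1
      exact h1
    · intro j
      rintro ⟨t, x⟩ ⟨ht, hx⟩
      simp only at ht hx
      have h3 := abs_nonneg (x - p.2)
      fin_cases j
      · refine hy.isCharClosed p hpD ⟨?_, ?_⟩
        · rw [uIcc_of_le hp1]
          simp only [timeMap, one_mul]
          constructor <;> linarith
        · simp only [timeMap, one_mul]
          rw [abs_of_nonneg hp1, abs_of_nonneg (by linarith : 0 ≤ s₀ + t)]
          linarith
      · refine (hΔmem _).2 ?_
        have h4 := abs_sub_le x p.2 x₀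
        simp only [timeMap, one_mul, add_sub_cancel_left]
        rw [abs_of_nonneg ht]
        linarith
    · intro j
      fin_cases j
      exacts [hy.isWave, hzΔ]
    · intro x hx
      refine (hzdata x ?_).symm
      have h4 := abs_sub_le x p.2 x₀
      linarith
  set y₁ : ℝ × ℝ → M := fun p => if p ∈ D then y p else (z ∘ timeMap (-s₀) 1) p with hy₁
  have hyD : EqOn y y₁ D := fun p hp => by simp only [hy₁, if_pos hp]
  have hyT : EqOn (z ∘ timeMap (-s₀) 1) y₁ Tr := by
    intro p hp
    by_cases hpD : p ∈ D
    · simp only [hy₁, if_pos hpD]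
      exact (hagree p ⟨hpD, hp⟩).symm
    · simp only [hy₁, if_neg hpD]
  refine subset_union_right.trans (hmax (D ∪ Tr) y₁ ⟨hDo.union hTro, ?_, ?_, ?_⟩)
  · rintro p (hp | hp) q hq
    · exact Or.inl (hy.isCharClosed p hp hq)
    · obtain ⟨hp1, hp2⟩ := hp
      obtain ⟨hq1, hq2⟩ := hq
      have hp0 : 0 ≤ p.1 := hs₀.trans hp1.le
      rw [uIcc_of_le hp0] at hq1
      rw [abs_of_nonneg hp0, abs_of_nonneg hq1.1] at hq2
      have h4 := abs_sub_le q.2 p.2 x₀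
      rcases lt_or_ge s₀ q.1 with hs | hs
      · exact Or.inr ⟨hs, by linarith⟩
      -- The shadow of `p` at the height `s₀` and the set of points at that height whose triangles
      -- contain `q` are intervals. They meet since `|q.2 - p.2| ≤ p.1 - q.1`; the witness is the
      -- larger of the left endpoints.
      · obtain ⟨x', hx', hxx'⟩ : ∃ x', |x' - p.2| ≤ p.1 - s₀ ∧ |q.2 - x'| ≤ s₀ - q.1 := by
          have h5 := abs_le.1 hq2
          refine ⟨max (p.2 - (p.1 - s₀)) (q.2 - (s₀ - q.1)), abs_le.2 ⟨?_, ?_⟩, abs_le.2 ⟨?_, ?_⟩⟩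
          · linarith [le_max_left (p.2 - (p.1 - s₀)) (q.2 - (s₀ - q.1))]
          · have : max (p.2 - (p.1 - s₀)) (q.2 - (s₀ - q.1)) ≤ p.2 + (p.1 - s₀) :=
              max_le (by linarith) (by linarith)
            linarith
          · have : max (p.2 - (p.1 - s₀)) (q.2 - (s₀ - q.1)) ≤ q.2 + (s₀ - q.1) :=
              max_le (by linarith) (by linarith)
            linarith
          · linarith [le_max_right (p.2 - (p.1 - s₀)) (q.2 - (s₀ - q.1))]
        have h6 := abs_sub_le x' p.2 x₀
        refine Or.inl (hy.isCharClosed (s₀, x') (hbase x' (by linarith)) ⟨?_, ?_⟩)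
        · rw [uIcc_of_le hs₀]
          exact ⟨hq1.1, hs⟩
        · simp only
          rw [abs_of_nonneg hs₀, abs_of_nonneg hq1.1]
          exact hxx'
  · refine isWave_of_local ?_
    rintro p (hp | hp)
    · exact ⟨D, y, hDo, hp, hy.isWave, hyD.eventuallyEq_of_mem (hDo.mem_nhds hp)⟩
    · exact ⟨Tr, _, hTro, hp, hzΔ.mono hTrΔ, hyT.eventuallyEq_of_mem (hTro.mem_nhds hp)⟩
  · intro x hx
    have hxD : ((0 : ℝ), x) ∈ D := by
      rcases hx with hx | hx
      · exact hx
      · exact absurd hx.1 (not_lt.2 hs₀)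
    refine (cauchyData_of_isOpen (hDo.union hTro) hx).trans ?_
    rw [← cauchyData_congr (hyD.eventuallyEq_of_mem (hDo.mem_nhds hxD))]
    exact hy.cauchyData_eq hxD

theorem contMDiffOn_cauchyData (hD : IsOpen D) (hy : IsWave B D y) (s₀ : ℝ) :
    ContMDiffOn 𝓘(ℝ, ℝ) 𝓘(ℝ, E).tangent ∞ (fun x => cauchyData (E := E) D y (s₀, x))
      {x | (s₀, x) ∈ D} := by
  have h1 := hy.1.contMDiffOn_tangentMapWithin (m := ∞) (by simp) hD.uniqueMDiffOn
  have h2 : ContMDiff 𝓘(ℝ, ℝ × ℝ) 𝓘(ℝ, ℝ × ℝ).tangent ∞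
      (fun p : ℝ × ℝ => (⟨p, ((1, 0) : ℝ × ℝ)⟩ : TangentBundle 𝓘(ℝ, ℝ × ℝ) (ℝ × ℝ))) := by
    have hV : ContDiff ℝ ∞ (fun _ : ℝ × ℝ => ((1, 0) : ℝ × ℝ)) := contDiff_const
    exact contMDiff_vectorSpace_iff_contDiff
      (V := fun p => (((1, 0) : ℝ × ℝ) : TangentSpace 𝓘(ℝ, ℝ × ℝ) p)) |>.2 hV
  have h3 : ContMDiff 𝓘(ℝ, ℝ) 𝓘(ℝ, ℝ × ℝ) ∞ (fun x : ℝ => (s₀, x)) :=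
    contMDiff_iff_contDiff.2 (by fun_prop)
  exact h1.comp (h2.comp h3).contMDiffOn fun x hx => hx

end MaximalSolution

/-! ### The maximal solution fills the triangles that the a priori bounds allow. -/

section Strip

universe u

variable {E : Type u} [NormedAddCommGroup E] [NormedSpace ℝ E] [FiniteDimensional ℝ E]
  {M : Type*} [TopologicalSpace M] [ChartedSpace E M] [IsManifold 𝓘(ℝ, E) ∞ M]
  {B : FormField E M} {h : RiemMetric E M} {k : ℝ → TangentBundle 𝓘(ℝ, E) M}
  {y : ℝ × ℝ → M} {D : Set (ℝ × ℝ)}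

/-- On the axis `y` is `k₀`, so its differential sends `(1, 0)` to `k₁` and `(0, 1)` to the velocity
of `k₀`. -/
theorem energy_axis (hy : IsSolution B k D y) (hax : ∀ x, ((0 : ℝ), x) ∈ D) (x : ℝ) :
    energy h y (1, 1) (0, x) = vnorm h (dataU k x) ^ 2 ∧
      energy h y (1, -1) (0, x) = vnorm h (dataV k x) ^ 2 := by
  have hk : k = fun x => cauchyData univ y (0, x) := funext fun x => (hy.cauchyData_eq (hax x)).symm
  have hys : MDifferentiableAt 𝓘(ℝ, ℝ × ℝ) 𝓘(ℝ, E) y (0, x) :=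
    (hy.isWave.contMDiffAt (by rw [hy.isOpen.interior_eq]; exact hax x)).mdifferentiableAt (by simp)
  clear hy
  subst hk
  have hℓ : HasDerivAt (fun s : ℝ => ((0 : ℝ), s)) (0, 1) x :=
    (hasDerivAt_const x (0 : ℝ)).prodMk (hasDerivAt_id x)
  let A : ℝ × ℝ →L[ℝ] E := mfderiv 𝓘(ℝ, ℝ × ℝ) 𝓘(ℝ, E) y (0, x)
  have h1 := (HasMFDerivAt.comp x hys.hasMFDerivAt hℓ.hasFDerivAt.hasMFDerivAt).mfderiv
  have h2 : (velocity E (fun s => y (0, s)) x : E) = A (0, 1) := by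
    refine (congrArg (fun L : ℝ →L[ℝ] E => L 1) h1).trans ?_
    change A ((1 : ℝ) • ((0, 1) : ℝ × ℝ)) = _
    rw [one_smul]
  have h3 : (k₁ (fun x => cauchyData (E := E) univ y (0, x)) x : E) = A (1, 0) :=
    congrArg (fun L : ℝ × ℝ →L[ℝ] E => L (1, 0)) (congrFun (mfderivWithin_univ (f := y)) (0, x))
  have h4 : (dataU (fun x => cauchyData (E := E) univ y (0, x)) x : E) = A (1, 1) := by
    have : ((1, 1) : ℝ × ℝ) = (1, 0) + (0, 1) := by simp
    rw [this, map_add]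
    exact congrArg₂ (· + ·) h3 h2
  have h5 : (dataV (fun x => cauchyData (E := E) univ y (0, x)) x : E) = A (1, -1) := by
    have : ((1, -1) : ℝ × ℝ) = (1, 0) - (0, 1) := by simp
    rw [this, map_sub]
    exact congrArg₂ (· - ·) h3 h2
  exact ⟨congrArg (fun v : E => vnorm h (p := y (0, x)) v ^ 2) h4.symm,
    congrArg (fun v : E => vnorm h (p := y (0, x)) v ^ 2) h5.symm⟩

variable [T2Space M]

/-- Around each point of the axis a local solution on a diamond exists, and the maximal domain
contains it. -/
theorem axis_subset (hB : IsPseudoMetric B) (h : RiemMetric E M)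
    (hmax : ∀ D' y', IsSolution B k D' y' → D' ⊆ D)
    (hk : ContMDiff 𝓘(ℝ, ℝ) 𝓘(ℝ, E).tangent ∞ k) {C : ℝ} (hk₁ : ∀ x, vnorm h (k₁ k x) ≤ C)
    (hk₀ : ∀ x, vnorm h (velocity E (k₀ k) x) ≤ C) (x : ℝ) : ((0 : ℝ), x) ∈ D := by
  obtain ⟨N, hN, ε, hε, hloc⟩ := exists_local_wave hB h (k₀ k x) C
  obtain ⟨y, hy, hyk⟩ := hloc x ε k univ hε le_rfl isOpen_univ (subset_univ _) hk.contMDiffOn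
    (mem_of_mem_nhds hN) fun x' _ => ⟨hk₁ x', hk₀ x'⟩
  refine hmax (diamond 0 x ε) y ⟨isOpen_diamond 0 x ε, isCharClosed_diamond x ε, hy, fun x' hx' =>
    hyk x' ?_⟩ ?_
  · simpa [diamond] using hx'
  · simpa [diamond] using hε

/-- A priori bounds: a maximal solution is defined on each triangle on which the initial energy
density, the height, the Christoffel symbols and the injectivity radius control it. -/
theorem IsSolution.fwdTriangle_subset (hB : IsPseudoMetric B) (hy : IsSolution B k D y)
    (hmax : ∀ D' y', IsSolution B k D' y' → D' ⊆ D) (hax : ∀ x, ((0 : ℝ), x) ∈ D)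
    {T C δ : ℝ} {G : ℝ≥0} (hC : 0 < C)
    (hG : ∀ p : M, (∃ x, hdist h (k₀ k x) p < ENNReal.ofReal δ) → christoffelBound h B p ≤ G)
    (hδ : 2 * C * T < δ) (hCG : 8 * (C * T * G) ≤ 1) (hU : ∀ x, vnorm h (dataU k x) ≤ C)
    (hV : ∀ x, vnorm h (dataV k x) ≤ C)
    (hR : ∀ x, ∃ r, 2 * C * T < r ∧ ∃ e, IsNormalChart h (k₀ k x) r e) (x₀ : ℝ) :
    fwdTriangle 0 x₀ T ⊆ D := by
  have hDo := hy.isOpen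
  have hys : ∀ q ∈ D, ContMDiffAt 𝓘(ℝ, ℝ × ℝ) 𝓘(ℝ, E) ∞ y q := fun q hq =>
    hy.isWave.contMDiffAt (by rwa [hDo.interior_eq])
  have hk₀ : ∀ x, y (0, x) = k₀ k x := fun x =>
    congrArg Bundle.TotalSpace.proj (hy.cauchyData_eq (hax x))
  have hen : ∀ q ∈ D, 0 ≤ q.1 → q.1 ≤ T → ∀ σ : ℝ, (σ = 1 ∨ σ = -1) →
      energy h y (1, σ) q ≤ (2 * C) ^ 2 := by
    intro q hq h0 hT
    have hG0 : (0 : ℝ) ≤ G := G.2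
    -- The estimate is applied on the characteristic triangle of `q`, which is known to lie in `D`,
    -- unlike the full triangle of height `T`.
    refine energy_le_of_wave hB hDo hy.isWave (x₀ := q.2) (R := q.1) (δ := δ) (G := G) ?_ hC ?_ ?_ ?_
      ?_ q ⟨h0, by simp⟩
    · have := hy.isCharClosed q hq
      rwa [charTriangle_eq_fwdTriangle h0] at this
    · intro x _ p hp
      exact hG p ⟨x, by rwa [← hk₀]⟩
    · nlinarith
    · refine le_trans ?_ hCG
      gcongr
    · rintro x - σ (rfl | rfl)
      · rw [(energy_axis hy hax x).1]
        exact pow_le_pow_left₀ (vnorm_nonneg h _) (hU x) 2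
      · rw [(energy_axis hy hax x).2]
        exact pow_le_pow_left₀ (vnorm_nonneg h _) (hV x) 2
  have hdt : ∀ q ∈ D, 0 ≤ q.1 → q.1 ≤ T →
      vnorm h (mfderiv 𝓘(ℝ, ℝ × ℝ) 𝓘(ℝ, E) y q ((1, 0) : ℝ × ℝ)) ≤ 2 * C := fun q hq h0 hT =>
    vnorm_dt_le (by positivity) (hen q hq h0 hT 1 (Or.inl rfl)) (hen q hq h0 hT (-1) (Or.inr rfl)) 1
      (Or.inl rfl) _ (by ext <;> norm_num)
  have hdx : ∀ q ∈ D, 0 ≤ q.1 → q.1 ≤ T →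
      vnorm h (mfderiv 𝓘(ℝ, ℝ × ℝ) 𝓘(ℝ, E) y q ((0, 1) : ℝ × ℝ)) ≤ 2 * C := fun q hq h0 hT =>
    vnorm_dt_le (by positivity) (hen q hq h0 hT 1 (Or.inl rfl)) (hen q hq h0 hT (-1) (Or.inr rfl))
      (-1) (Or.inr rfl) _ (by ext <;> norm_num)
  by_contra hne
  -- A lowest point of the triangle outside of `D`; everything strictly below it in its own triangle
  -- belongs to `D`.
  obtain ⟨⟨s, x⟩, ⟨hsx, hsxD⟩, hmin⟩ := ((isCompact_fwdTriangle 0 x₀ T).diff hDo).exists_isMinOn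
    (Set.sdiff_nonempty.2 hne) continuous_fst.continuousOn
  have hs0 : 0 ≤ s := hsx.1
  have hsxT : |x - x₀| ≤ T - s := hsx.2
  have hsT : s ≤ T := by linarith [abs_nonneg (x - x₀)]
  have hs : 0 < s := hs0.lt_of_ne fun hs => hsxD (by rw [← hs]; exact hax x)
  have hbelow : ∀ σ x', 0 ≤ σ → σ < s → |x' - x| ≤ s - σ → (σ, x') ∈ D := by
    intro σ x' h0 hσ hx'
    by_contra hn
    have h1 : (σ, x') ∈ fwdTriangle 0 x₀ T := by
      refine ⟨h0, ?_⟩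
      change |x' - x₀| ≤ T - σ
      linarith [abs_sub_le x' x x₀]
    exact absurd (isMinOn_iff.1 hmin (σ, x') ⟨h1, hn⟩) (not_le.2 hσ)
  obtain ⟨r, hr, e, hn⟩ := hR x
  have hline : ∀ t, HasDerivAt (fun σ : ℝ => (σ, x)) (1, 0) t := fun t =>
    (hasDerivAt_id t).prodMk (hasDerivAt_const t x)
  have hmem : ∀ t, 0 ≤ t → t < s → (t, x) ∈ D := fun t h0 h1 => hbelow t x h0 h1 (by simpa using h1.le)
  have hcomp := (hn.isCompact_ball hr).1
  have hball : ∀ t, 0 ≤ t → t < s →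
      y (t, x) ∈ e.symm '' {z | √(coordForm h.inner e 0 z z) ≤ 2 * C * T} := by
    intro t h0 hts
    refine hn.mem_ball_of_vnorm_le hr (c := fun σ => y (σ, x)) (t := t) (C := 2 * C) (by positivity)
      ?_ (hk₀ x) ?_ ?_ t ⟨h0, le_rfl⟩
    · intro σ hσ
      have h1 : ContDiffAt ℝ ∞ (fun σ : ℝ => (σ, x)) σ := by fun_prop
      exact ((hys _ (hmem σ hσ.1 (hσ.2.trans_lt hts))).comp σ h1.contMDiffAt).of_le (by simp)
    · intro σ hσ
      have hD := hmem σ hσ.1 (hσ.2.trans_lt hts)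
      rw [velocity_comp_line (hline σ) rfl ((hys _ hD).mdifferentiableAt (by simp))]
      exact hdt _ hD hσ.1 ((hσ.2.trans hts.le).trans hsT)
    · have : t < T := hts.trans_le hsT
      gcongr
  have hev : ∀ᶠ t in 𝓝[<] s, 0 < t ∧ t < s :=
    Ioo_mem_nhdsLT hs
  -- As `t` increases to `s`, the points `y (t, x)` stay in a compact ball and cluster at some `q`.
  -- Local existence near `q` has a size `ε` that does not depend on `t`, so some restart height `s₀
  -- > s - ε` works.
  obtain ⟨q, -, hq⟩ := hcomp (f := map (fun t => y (t, x)) (𝓝[<] s))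
    (by
      rw [le_principal_iff, mem_map]
      filter_upwards [hev] with t ht using hball t ht.1.le ht.2)
  obtain ⟨N, hN, ε, hε, hloc⟩ := exists_local_wave hB h q (2 * C)
  have hfr : ∃ᶠ t in 𝓝[<] s, y (t, x) ∈ N := (mapClusterPt_iff_frequently.1 hq) N hN
  have hnear : ∀ᶠ t in 𝓝[<] s, s - ε < t :=
    mem_nhdsWithin_of_mem_nhds (lt_mem_nhds (by linarith))
  obtain ⟨s₀, hs₀N, ⟨hs₀, hs₀s⟩, hs₀ε⟩ := (hfr.and_eventually (hev.and hnear)).exists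
  set J : Set ℝ := {x' | (s₀, x') ∈ D} with hJ
  have hJo : IsOpen J := hDo.preimage (by fun_prop)
  obtain ⟨η₁, hη₁, hb₁⟩ := Metric.isOpen_iff.1 hJo (x - (s - s₀))
    (hbelow s₀ _ hs₀.le hs₀s (by rw [abs_le]; constructor <;> linarith))
  obtain ⟨η₂, hη₂, hb₂⟩ := Metric.isOpen_iff.1 hJo (x + (s - s₀))
    (hbelow s₀ _ hs₀.le hs₀s (by rw [abs_le]; constructor <;> linarith))
  -- `ρ > s - s₀` puts `(s, x)` inside the open triangle of the restarted solution. The base exceeds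
  -- the shadow of `(s, x)` slightly, which is possible because `D` is open at the two corners.
  obtain ⟨ρ, hρ1, hρ2⟩ : ∃ ρ, s - s₀ < ρ ∧ ρ < min ε (min (s - s₀ + η₁) (s - s₀ + η₂)) :=
    exists_between (by simp only [lt_min_iff]; refine ⟨?_, ?_, ?_⟩ <;> linarith)
  simp only [lt_min_iff] at hρ2
  obtain ⟨hρε, hρη₁, hρη₂⟩ := hρ2
  have hρJ : Icc (x - ρ) (x + ρ) ⊆ J := by
    intro x' hx'
    by_cases h1 : x' < x - (s - s₀)
    · refine hb₁ ?_
      rw [Metric.mem_ball, Real.dist_eq, abs_lt]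
      constructor <;> linarith [hx'.1]
    by_cases h2 : x + (s - s₀) < x'
    · refine hb₂ ?_
      rw [Metric.mem_ball, Real.dist_eq, abs_lt]
      constructor <;> linarith [hx'.2]
    · refine hbelow s₀ x' hs₀.le hs₀s ?_
      rw [abs_le]
      constructor <;> linarith
  have hs₀T : s₀ ≤ T := hs₀s.le.trans hsT
  obtain ⟨z, hz, hzk⟩ := hloc x ρ (fun x' => cauchyData D y (s₀, x')) J (by linarith) hρε.le hJo hρJ
    (contMDiffOn_cauchyData hDo hy.isWave s₀) hs₀N (by
      intro x' hx'
      have hD : (s₀, x') ∈ D := hρJ hx'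
      constructor
      · have h1 : (mfderivWithin 𝓘(ℝ, ℝ × ℝ) 𝓘(ℝ, E) y D (s₀, x') ((1, 0) : ℝ × ℝ) : E) =
            mfderiv 𝓘(ℝ, ℝ × ℝ) 𝓘(ℝ, E) y (s₀, x') ((1, 0) : ℝ × ℝ) :=
          congrArg (fun L : ℝ × ℝ →L[ℝ] E => L (1, 0)) (mfderivWithin_of_isOpen hDo hD)
        exact (congrArg (fun v : E => vnorm h (p := y (s₀, x')) v) h1).le.trans
          (hdt _ hD hs₀.le hs₀T)
      · have hline' : HasDerivAt (fun σ : ℝ => (s₀, σ)) (0, 1) x' :=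
          (hasDerivAt_const x' s₀).prodMk (hasDerivAt_id x')
        refine (velocity_comp_line (h := h) hline' rfl
          ((hys _ hD).mdifferentiableAt (by simp))).le.trans (hdx _ hD hs₀.le hs₀T))
  refine hsxD (hy.extend hB hmax hs₀.le (fun x' hx' => hρJ ?_) hz hzk ⟨hs₀s, ?_⟩)
  · rw [abs_lt] at hx'
    constructor <;> linarith
  · change |x - x| < s₀ + ρ - s
    rw [sub_self, abs_zero]
    linarith

end Strip

/-! ### Norms of the data and the constants in the strip length. -/

section InitialData

universe u

variable {E : Type u} [NormedAddCommGroup E] [NormedSpace ℝ E] [FiniteDimensional ℝ E]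
  {M : Type*} [TopologicalSpace M] [ChartedSpace E M] [IsManifold 𝓘(ℝ, E) ∞ M]
  {B : FormField E M} {h : RiemMetric E M} {k : ℝ → TangentBundle 𝓘(ℝ, E) M}

theorem covDeriv_add_smul (B : FormField E M) {c : ℝ → M}
    {V W : ∀ s, TangentSpace 𝓘(ℝ, E) (c s)} {x : ℝ}
    (hV : DifferentiableAt ℝ (fun r => (toCoord (chartAt E (c x)) (c r) (V r) : E)) x)
    (hW : DifferentiableAt ℝ (fun r => (toCoord (chartAt E (c x)) (c r) (W r) : E)) x) (σ : ℝ) :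
    covDeriv B c (fun s => V s + σ • W s) x = covDeriv B c V x + σ • covDeriv B c W x := by
  set e := chartAt E (c x)
  set Ve : ℝ → E := fun r => toCoord e (c r) (V r) with hVe
  set We : ℝ → E := fun r => toCoord e (c r) (W r) with hWe
  have h1 : (fun r => (toCoord e (c r) (V r + σ • W r) : E)) = fun r => Ve r + σ • We r := by
    funext r
    rw [map_add, map_smul]
  have h2 : deriv (fun r => (toCoord e (c r) (V r + σ • W r) : E)) x
      = deriv Ve x + σ • deriv We x := by
    rw [h1]
    exact (hV.hasDerivAt.add (hW.hasDerivAt.const_smul σ)).deriv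
  have h3 : (toCoord e (c x) (V x + σ • W x) : E) = Ve x + σ • We x := congrFun h1 x
  set a := deriv (fun r => e (c r)) x
  have h4 : christoffel B e (e (c x)) a (Ve x + σ • We x) =
      christoffel B e (e (c x)) a (Ve x) + σ • christoffel B e (e (c x)) a (We x) := by
    rw [← christoffelL_apply, map_add, map_smul, christoffelL_apply, christoffelL_apply]
  change (toCoord e (c x)).inverse (deriv (fun r => (toCoord e (c r) (V r + σ • W r) : E)) x +
    christoffel B e (e (c x)) a (toCoord e (c x) (V x + σ • W x) : E)) =
    (toCoord e (c x)).inverse (deriv Ve x + christoffel B e (e (c x)) a (Ve x)) +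
    σ • (toCoord e (c x)).inverse (deriv We x + christoffel B e (e (c x)) a (We x))
  rw [h2, h3, h4, ← map_smul, ← map_add]
  congr 1
  rw [smul_add]
  abel

theorem contMDiff_k₀ (hk : ContMDiff 𝓘(ℝ, ℝ) 𝓘(ℝ, E).tangent ∞ k) :
    ContMDiff 𝓘(ℝ, ℝ) 𝓘(ℝ, E) ∞ (k₀ k) :=
  (Bundle.contMDiff_proj (TangentSpace 𝓘(ℝ, E) (M := M))).comp hk

theorem differentiableAt_toCoord_k₁ (hk : ContMDiff 𝓘(ℝ, ℝ) 𝓘(ℝ, E).tangent ∞ k) (x : ℝ) :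
    DifferentiableAt ℝ (fun r => (toCoord (chartAt E (k₀ k x)) (k₀ k r) (k₁ k r) : E)) x := by
  have he : chartAt E (k₀ k x) ∈ IsManifold.maximalAtlas 𝓘(ℝ, E) ∞ M :=
    IsManifold.chart_mem_maximalAtlas _
  have hJ : IsOpen (k₀ k ⁻¹' (chartAt E (k₀ k x)).source) :=
    (chartAt E (k₀ k x)).open_source.preimage (contMDiff_k₀ hk).continuous
  exact ((contDiffOn_toCoord_comp he hk.contMDiffOn fun x' hx' => hx').contDiffAt
    (hJ.mem_nhds (mem_chart_source E (k₀ k x)))).differentiableAt (by simp)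

theorem differentiableAt_toCoord_velocity {c : ℝ → M} (hc : ContMDiff 𝓘(ℝ, ℝ) 𝓘(ℝ, E) ∞ c) (x : ℝ) :
    DifferentiableAt ℝ (fun r => (toCoord (chartAt E (c x)) (c r) (velocity E c r) : E)) x := by
  have he : chartAt E (c x) ∈ IsManifold.maximalAtlas 𝓘(ℝ, E) ∞ M :=
    IsManifold.chart_mem_maximalAtlas _
  have h1 : ∀ᶠ r in 𝓝 x, c r ∈ (chartAt E (c x)).source :=
    hc.continuous.continuousAt.preimage_mem_nhds (chart_source_mem_nhds E (c x))
  have h2 : (fun r => (toCoord (chartAt E (c x)) (c r) (velocity E c r) : E)) =ᶠ[𝓝 x]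
      deriv (chartAt E (c x) ∘ c) := by
    filter_upwards [h1] with r hr
    exact toCoord_velocity he (hc.mdifferentiable (by simp) r) hr
  have h3 : ContDiffAt ℝ ∞ (chartAt E (c x) ∘ c) x :=
    contDiffAt_chart_comp le_rfl he hc.contMDiffAt (mem_chart_source E (c x))
  have h4 : ContDiffAt ℝ 1 (deriv (chartAt E (c x) ∘ c)) x := by
    have h5 := (h3.fderiv_right (m := 1) (by rw [one_add_one_eq_two]; exact ENat.LEInfty.out)).clm_apply
      (contDiffAt_const (c := (1 : ℝ)))
    exact h5.congr_of_eventuallyEq (Eventually.of_forall fun r => fderiv_apply_one_eq_deriv.symm)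
  exact (h4.differentiableAt (by simp)).congr_of_eventuallyEq h2

/-- Only the bounds on covariant derivatives of orders `0` and `1` enter; `σ = 1` and `σ = -1` give
`u` and `v`. Finiteness keeps the quotient `l` from being zero through an infinite denominator. -/
theorem c1Norm_lt_top (hk : ContMDiff 𝓘(ℝ, ℝ) 𝓘(ℝ, E).tangent ∞ k)
    (hk₀ : BoundedDerivs h (k₀ k) (velocity E (k₀ k))) (hk₁ : BoundedDerivs h (k₀ k) (k₁ k))
    (σ : ℝ) : c1Norm h (k₀ k) (fun x => k₁ k x + σ • velocity E (k₀ k) x) < ⊤ := by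
  obtain ⟨a₀, ha₀⟩ := hk₀ 0
  obtain ⟨a₁, ha₁⟩ := hk₀ 1
  obtain ⟨b₀, hb₀⟩ := hk₁ 0
  obtain ⟨b₁, hb₁⟩ := hk₁ 1
  refine max_lt ?_ ?_
  · refine lt_of_le_of_lt (iSup_le fun x => ENNReal.ofReal_le_ofReal ?_)
      (ENNReal.ofReal_lt_top (r := b₀ + |σ| * a₀))
    refine (vnorm_add_le h _ _).trans (add_le_add (hb₀ x) ?_)
    rw [vnorm_smul]
    exact mul_le_mul_of_nonneg_left (ha₀ x) (abs_nonneg σ)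
  · refine lt_of_le_of_lt (iSup_le fun x => ENNReal.ofReal_le_ofReal ?_)
      (ENNReal.ofReal_lt_top (r := b₁ + |σ| * a₁))
    rw [covDeriv_add_smul h.inner (differentiableAt_toCoord_k₁ hk x)
      (differentiableAt_toCoord_velocity (contMDiff_k₀ hk) x)]
    refine (vnorm_add_le h _ _).trans (add_le_add (hb₁ x) ?_)
    rw [vnorm_smul]
    exact mul_le_mul_of_nonneg_left (ha₁ x) (abs_nonneg σ)

theorem dataU_eq (k : ℝ → TangentBundle 𝓘(ℝ, E) M) :
    dataU k = fun x => k₁ k x + (1 : ℝ) • velocity E (k₀ k) x := by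
  funext x
  rw [one_smul]
  rfl

theorem dataV_eq (k : ℝ → TangentBundle 𝓘(ℝ, E) M) :
    dataV k = fun x => k₁ k x + (-1 : ℝ) • velocity E (k₀ k) x := by
  funext x
  rw [neg_one_smul, ← sub_eq_add_neg]
  rfl

theorem vnorm_le_c1Norm {c : ℝ → M} (V : ∀ s, TangentSpace 𝓘(ℝ, E) (c s)) (x : ℝ) :
    ENNReal.ofReal (vnorm h (V x)) ≤ c1Norm h c V :=
  (le_iSup (fun x => ENNReal.ofReal (vnorm h (V x))) x).trans (le_max_left _ _)

variable [T2Space M]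

/-- The locally uniform radius of `exists_isNormalChart` becomes uniform by compactness. -/
theorem exists_le_injRadius (h : RiemMetric E M) {K : Set M} (hK : IsCompact K) :
    ∃ r > (0 : ℝ≥0∞), ∀ p ∈ K, r ≤ injRadius h p := by
  refine hK.induction_on (p := fun S => ∃ r > (0 : ℝ≥0∞), ∀ p ∈ S, r ≤ injRadius h p) ?_ ?_ ?_ ?_
  · exact ⟨1, one_pos, fun p hp => hp.elim⟩
  · rintro S S' hS ⟨r, hr, h1⟩
    exact ⟨r, hr, fun p hp => h1 p (hS hp)⟩
  · rintro S S' ⟨r, hr, h1⟩ ⟨r', hr', h2⟩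
    refine ⟨min r r', lt_min hr hr', ?_⟩
    rintro p (hp | hp)
    · exact (min_le_left _ _).trans (h1 p hp)
    · exact (min_le_right _ _).trans (h2 p hp)
  · intro p _
    obtain ⟨r, hr, hev⟩ := exists_isNormalChart h p
    refine ⟨_, mem_nhdsWithin_of_mem_nhds hev, ENNReal.ofReal r, ENNReal.ofReal_pos.2 hr, ?_⟩
    rintro q ⟨e, he⟩
    exact le_iSup_of_le r (le_iSup_of_le e (le_iSup_of_le he le_rfl))

theorem Lk_pos_of_periodic (hk : Continuous (k₀ k)) {P : ℝ} (hP : 0 < P)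
    (hper : ∀ x, k (x + P) = k x) {δ : ℝ} (hδ : 0 < δ) (G : ℝ≥0) : 0 < Lk h k δ G := by
  obtain ⟨r, hr, hle⟩ := exists_le_injRadius h ((isCompact_Icc (a := (0 : ℝ)) (b := 0 + P)).image hk)
  have hper' : Function.Periodic (k₀ k) P := fun x => congrArg Bundle.TotalSpace.proj (hper x)
  refine lt_min ?_ (lt_min ?_ ?_)
  · refine ENNReal.div_pos (ne_of_gt (lt_of_lt_of_le hr (le_iInf fun x => hle _ ?_))) (by simp)
    have h1 : k₀ k x ∈ range (k₀ k) := ⟨x, rfl⟩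
    rwa [← hper'.image_Icc hP 0] at h1
  · exact ENNReal.div_pos one_ne_zero (ENNReal.mul_ne_top (by simp) ENNReal.coe_ne_top)
  · exact ENNReal.div_pos (ENNReal.ofReal_pos.2 hδ).ne' (by simp)

theorem stripLength_pos_of_periodic (hk : ContMDiff 𝓘(ℝ, ℝ) 𝓘(ℝ, E).tangent ∞ k)
    (hk₀ : BoundedDerivs h (k₀ k) (velocity E (k₀ k))) (hk₁ : BoundedDerivs h (k₀ k) (k₁ k))
    {P : ℝ} (hP : 0 < P) (hper : ∀ x, k (x + P) = k x) {δ : ℝ} (hδ : 0 < δ) (G : ℝ≥0) :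
    0 < stripLength h k δ G := by
  refine ENNReal.div_pos (Lk_pos_of_periodic (contMDiff_k₀ hk).continuous hP hper hδ G).ne' ?_
  rw [dataU_eq, dataV_eq]
  exact (ENNReal.add_lt_top.2 ⟨c1Norm_lt_top hk hk₀ hk₁ 1, c1Norm_lt_top hk hk₀ hk₁ (-1)⟩).ne

/-- On the strip, the height times a bound of the initial data is at most `L_k / √2`. -/
theorem exists_bound_of_le_stripLength {δ : ℝ} {G : ℝ≥0} {T : ℝ} (hT : 0 < T)
    (hTl : ENNReal.ofReal (√2 * T) ≤ stripLength h k δ G) :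
    ∃ C > 0, (∀ x, vnorm h (dataU k x) ≤ C) ∧ (∀ x, vnorm h (dataV k x) ≤ C) ∧
      ENNReal.ofReal (√2 * T * C) ≤ Lk h k δ G := by
  set a := c1Norm h (k₀ k) (dataU k) + c1Norm h (k₀ k) (dataV k) with ha
  have hTpos : 0 < √2 * T := by positivity
  have hU : ∀ x, ENNReal.ofReal (vnorm h (dataU k x)) ≤ a := fun x =>
    (vnorm_le_c1Norm _ x).trans le_self_add
  have hV : ∀ x, ENNReal.ofReal (vnorm h (dataV k x)) ≤ a := fun x =>
    (vnorm_le_c1Norm _ x).trans le_add_self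
  have hTl' : ENNReal.ofReal (√2 * T) ≤ Lk h k δ G / a := hTl
  have hLtop : Lk h k δ G ≠ ⊤ := by
    refine ne_top_of_le_ne_top ?_ ((min_le_right _ _).trans (min_le_right _ _))
    exact ENNReal.div_ne_top ENNReal.ofReal_ne_top (by simp)
  -- A positive quotient excludes both `L_k = 0` and an infinite denominator.
  have hpos : 0 < Lk h k δ G / a := (ENNReal.ofReal_pos.2 hTpos).trans_le hTl'
  have hL : Lk h k δ G ≠ 0 := fun h0 => by simp [h0] at hpos
  have hatop : a ≠ ⊤ := fun h0 => by simp [h0] at hpos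
  -- If `a = 0` then `u` and `v` vanish and every positive `C` bounds them; this one turns the last
  -- inequality into an equality. Otherwise `a` itself bounds both fields.
  rcases eq_or_ne a 0 with h0 | h0
  · have hLr := ENNReal.toReal_pos hL hLtop
    rw [h0] at hU hV
    refine ⟨(Lk h k δ G).toReal / (√2 * T), by positivity, fun x => ?_, fun x => ?_, ?_⟩
    · exact (ENNReal.ofReal_eq_zero.1 (nonpos_iff_eq_zero.1 (hU x))).trans (by positivity)
    · exact (ENNReal.ofReal_eq_zero.1 (nonpos_iff_eq_zero.1 (hV x))).trans (by positivity)
    · rw [mul_div_cancel₀ _ hTpos.ne', ENNReal.ofReal_toReal hLtop]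
  · refine ⟨a.toReal, ENNReal.toReal_pos h0 hatop, fun x => ?_, fun x => ?_, ?_⟩
    · exact (ENNReal.ofReal_le_iff_le_toReal hatop).1 (hU x)
    · exact (ENNReal.ofReal_le_iff_le_toReal hatop).1 (hV x)
    · rw [ENNReal.ofReal_mul hTpos.le, ENNReal.ofReal_toReal hatop]
      exact (ENNReal.le_div_iff_mul_le (Or.inl h0) (Or.inl hatop)).1 hTl'

/-- Here `b` is the height times the bound of the data. Since `√2 ≥ 1`, the constants `5` and `11`
in `L_k` exceed what the factors `2` and `8` of the a priori estimate need, and the strictness of `2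
* b < √2 * b * 5` yields a normal chart of radius larger than `2 * b`. -/
theorem bounds_of_le_Lk {δ : ℝ} (hδ : 0 < δ) {G : ℝ≥0} {b : ℝ} (hb : 0 < b)
    (hL : ENNReal.ofReal (√2 * b) ≤ Lk h k δ G) :
    2 * b < δ ∧ 8 * (b * G) ≤ 1 ∧
      ∀ x, ∃ r, 2 * b < r ∧ ∃ e, IsNormalChart h (k₀ k x) r e := by
  have h2 : 1 ≤ √2 := Real.one_le_sqrt.2 (by norm_num)
  have hb5 : 2 * b < √2 * b * 5 := by nlinarith
  have h5 : ENNReal.ofReal (√2 * b) * 5 = ENNReal.ofReal (√2 * b * 5) := by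
    rw [ENNReal.ofReal_mul (p := √2 * b) (by positivity)]
    simp
  have hR := hL.trans (min_le_left _ _)
  have hG := (hL.trans (min_le_right _ _)).trans (min_le_left _ _)
  have hd := (hL.trans (min_le_right _ _)).trans (min_le_right _ _)
  rw [ENNReal.le_div_iff_mul_le (by simp) (by simp), h5] at hR hd
  rw [ENNReal.le_div_iff_mul_le (by simp) (by simp)] at hG
  refine ⟨hb5.trans_le ((ENNReal.ofReal_le_ofReal_iff hδ.le).1 hd), ?_, fun x => ?_⟩
  · have h11 : ENNReal.ofReal (√2 * b * (11 * G)) ≤ 1 := by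
      rw [ENNReal.ofReal_mul (p := √2 * b) (by positivity),
        ENNReal.ofReal_mul (p := 11) (by positivity), ENNReal.ofReal_coe_nnreal]
      simpa using hG
    have h3 := ENNReal.ofReal_le_one.1 h11
    have h4 : 0 ≤ b * G := by positivity
    nlinarith
  · have h3 : ENNReal.ofReal (2 * b) < injRadius h (k₀ k x) :=
      ((ENNReal.ofReal_lt_ofReal_iff (by positivity)).2 hb5).trans_le
        (hR.trans (iInf_le (fun x => injRadius h (k₀ k x)) x))
    obtain ⟨r, h4⟩ := lt_iSup_iff.1 h3
    obtain ⟨e, h5⟩ := lt_iSup_iff.1 h4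
    obtain ⟨hn, h6⟩ := lt_iSup_iff.1 h5
    exact ⟨r, (ENNReal.ofReal_lt_ofReal_iff hn.1).1 h6, e, hn⟩

/-- A maximal solution is defined on the strip. -/
theorem IsSolution.strip_subset (hB : IsPseudoMetric B) {D : Set (ℝ × ℝ)} {y : ℝ × ℝ → M}
    (hy : IsSolution B k D y) (hmax : ∀ D' y', IsSolution B k D' y' → D' ⊆ D)
    (hk : ContMDiff 𝓘(ℝ, ℝ) 𝓘(ℝ, E).tangent ∞ k)
    (hk₀ : BoundedDerivs h (k₀ k) (velocity E (k₀ k))) (hk₁ : BoundedDerivs h (k₀ k) (k₁ k))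
    {δ : ℝ} (hδ : 0 < δ) {G : ℝ≥0}
    (hG : ∀ p : M, (∃ x, hdist h (k₀ k x) p < ENNReal.ofReal δ) → christoffelBound h B p ≤ G) :
    strip (stripLength h k δ G) ⊆ D := by
  obtain ⟨a, ha⟩ := hk₀ 0
  obtain ⟨b, hb⟩ := hk₁ 0
  have hax := axis_subset hB h hmax hk (C := max a b) (fun x => (hb x).trans (le_max_right _ _))
    (fun x => (ha x).trans (le_max_left _ _))
  rintro ⟨t, x⟩ ⟨ht, htl⟩
  rcases eq_or_lt_of_le ht with h0 | h0
  · simp only at h0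
    rw [← h0]
    exact hax x
  obtain ⟨C, hC, hU, hV, hL⟩ := exists_bound_of_le_stripLength h0 htl
  rw [mul_assoc] at hL
  obtain ⟨h1, h2, h3⟩ := bounds_of_le_Lk hδ (mul_pos h0 hC) hL
  simp only [mul_comm t C, ← mul_assoc] at h1 h3
  rw [mul_comm t C] at h2
  exact hy.fwdTriangle_subset hB hmax hax hC hG h1 h2 hU hV h3 x ⟨ht, by simp⟩

end InitialData

end WaveMap

end

/-! ### Assembly of the three claims. -/

open WaveMap in
theorem theorem4
    {E : Type*} [NormedAddCommGroup E] [NormedSpace ℝ E] [FiniteDimensional ℝ E]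
    {M : Type*} [TopologicalSpace M] [ChartedSpace E M] [IsManifold 𝓘(ℝ, E) ∞ M]
    [T2Space M] [SecondCountableTopology M]
    (g : LorentzMetric E M) (h : RiemMetric E M)
    (k : ℝ → TangentBundle 𝓘(ℝ, E) M)
    (hk : ContMDiff 𝓘(ℝ, ℝ) 𝓘(ℝ, E).tangent ∞ k)
    (hk₀ : BoundedDerivs h (k₀ k) (velocity E (k₀ k)))
    (hk₁ : BoundedDerivs h (k₀ k) (k₁ k))
    (hspace : ∀ x, 0 ≤ g.inner (k₀ k x) (velocity E (k₀ k) x) (velocity E (k₀ k) x))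
    (hcausal : ∀ x, g.inner (k₀ k x) (k₁ k x) (k₁ k x) ≤ 0)
    (δ : ℝ) (hδ : 0 < δ) (G : ℝ≥0)
    (hG : ∀ p : M, (∃ x, hdist h (k₀ k x) p < ENNReal.ofReal δ) →
      christoffelBound h g.inner p ≤ G) :
    (∃ (U : Set (ℝ × ℝ)) (y : ℝ × ℝ → M), IsOpen U ∧ IsCharClosed U ∧
      strip (stripLength h k δ G) ⊆ U ∧ IsWaveMapOn g U y ∧ HasData k U y) ∧
    (∀ (D : Set (ℝ × ℝ)) (y₁ y₂ : ℝ × ℝ → M), IsCharClosed D →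
      IsWaveMapOn g D y₁ → HasData k D y₁ → IsWaveMapOn g D y₂ → HasData k D y₂ →
      EqOn y₁ y₂ D) ∧
    ((∃ P : ℝ, 0 < P ∧ ∀ x, k (x + P) = k x) → 0 < stripLength h k δ G) := by
  refine ⟨?_, fun D y₁ y₂ hD hy₁ hd₁ hy₂ hd₂ => ?_, ?_⟩
  · obtain ⟨U, y, hy, hmax⟩ := exists_maximal_solution g.isPseudoMetric k
    exact ⟨U, y, hy.isOpen, hy.isCharClosed,
      hy.strip_subset g.isPseudoMetric hmax hk hk₀ hk₁ hδ hG, (isWaveMapOn_iff g).2 hy.isWave,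
      hy.hasData⟩
  · refine wave_unique g.isPseudoMetric hD (y := ![y₁, y₂]) (k := k) (fun j => ?_) (fun j => ?_)
    · fin_cases j
      exacts [(isWaveMapOn_iff g).1 hy₁, (isWaveMapOn_iff g).1 hy₂]
    · fin_cases j
      exacts [hd₁, hd₂]
  · rintro ⟨P, hP, hper⟩
    exact stripLength_pos_of_periodic hk hk₀ hk₁ hP hper hδ G
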